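/- Let $d\ge 1$, let $\phi:[0,\infty)\to\mathbb R\cup\{+\infty\}$ be a pair potential, $\beta>0$, $z>0$. Finite configurations are finite multisets $\gamma=\{x_1,\dots,x_n\}$ of points of $\mathbb R^d$, $|\gamma|=n$, with energy $U(\gamma)=\sum_{i<j}\phi(|x_i-x_j|)$. Assume stability, $U(\gamma)\ge -B|\gamma|$ for all finite $\gamma$, with $B\ge 0$; regularity, i.e. $x\mapsto e^{-\beta\phi(|x|)}-1$ is integrable on $\mathbb R^d$, and put $\nu_1=\int_{\mathbb R^d}|e^{-\beta\phi(|x|)}-1|\,dx$; and, for some $\alpha>d$ and $C=C(\beta)>0$, $$|e^{-\beta\phi(|x|)}-1|\le C\,\overline\nu(x)\quad(x\in\mathbb R^d),\qquad \overline\nu(x)=\frac1{1+|x|^\alpha}.$$ Then $\int_{\mathbb R^d}\overline\nu(x)\,dx<\infty$. Put $\overline\nu_1=C\int_{\mathbb R^d}\overline\nu(x)\,dx$, $h=z e^{2\beta B}$, and assume $$h\,[\nu_1 e+\overline\nu_1(e+2^{1+\alpha})]<1 .$$ For a measurable $j:\mathbb R^d\to[0,1]$ with bounded support let $\chi_j(\eta)=\prod_{x\in\eta}j(x)$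 and $$\rho_j(\eta)=\frac{z^{|\eta|}}{Z_j}\sum_{n\ge 0}\frac{z^n}{n!}\int_{(\mathbb R^d)^n}\chi_j(\eta+\gamma_x)\,e^{-\beta U(\eta+\gamma_x)}\,dx_1\cdots dx_n,\qquad \gamma_x=\{x_1,\dots,x_n\},$$ where $Z_j$ is the same sum of integrals for $\eta=\emptyset$. The infinite-volume correlation function $\rho(\eta)=\lim_{j\to1}\rho_j(\eta)$ exists for all finite configurations $\eta$ (the limit is along every sequence of such $j$ that tends to $1$ pointwise; in particular along indicators of bounded Borel sets exhausting $\mathbb R^d$). The partially truncated correlation functions (PTCF) are defined recursively by $\tilde\rho^T(\eta_1)=\rho(\eta_1)$ and $$\tilde\rho^T(\eta_1;\dots;\eta_m)=\rho\Big(\sum_{i=1}^m\eta_i\Big)-\sum_{k=2}^m\ \sum_{\{I_1,\dots,I_k\}}\ \prod_{s=1}^k\tilde\rho^T\big((\eta_i)_{i\in I_s}\big),$$ the inner sum being over the partitions of $\{1,\dots,m\}$ into $k$ non-empty blocks. Then, for every $m\ge 2$ and all non-empty finite configurations $\eta_1,\dots,\eta_m$, $$|\tilde\rho^T(\eta_1;\dots;\eta_m)|\le\sum_{\sigma=1}^m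 A_{m,\sigma}\ \max_{T}\ \prod_{(i,j)\in T}\ \max_{x_i\in\eta_i,\,x_j\in\eta_j}\overline\nu(x_i-x_j),$$ where $T$ runs over the trees on $\{1,\dots,m\}$. Here the $A_{m,\sigma}>0$ depend only on $m$, $\sigma$, $\alpha$, $C$, $h$, $\nu_1$, $\overline\nu_1$ and the sizes $l_i=|\eta_i|$: with $l=\sum_i l_i$, $u=1-h\nu_1e$ and $w=u-2^{1+\alpha}h\overline\nu_1$, $$A_{m,\sigma}=\Big(\prod_{i=1}^m l_i\Big)\binom{m-1}{\sigma-1}C^{m-1}(1+C)^{l-l_1-m+1}\Big(\frac hu\Big)^{l}\Big[l^{m-2}\Big(\frac{2^{1+\alpha}h\overline\nu_1}{w}\Big)^{\sigma-1}+l^{m-\sigma}S_\sigma\Big],$$ $$S_\sigma=\sum_{r=1}^{\sigma-2}\frac{(\sigma+r-2)!}{r!\,2^r\,(\sigma-2-r)!}\,(l+r)^{\sigma-2-r}\Big(\frac{\sigma\,2^{\alpha(\sigma-1)}h\overline\nu_1}{u}\Big)^r\Big(\frac uw\Big)^{\sigma+r-1},$$ so that $S_1=S_2=0$. -/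

import Mathlib

open MeasureTheory Filter Topology

noncomputable section

namespace PTCF

/-- The one-particle space `ℝ^d` with its Euclidean norm and Lebesgue measure. -/
abbrev Pt (d : ℕ) : Type := EuclideanSpace ℝ (Fin d)

/-- A finite configuration (an element of `Γ₀`): finitely many points of `ℝ^d`, with multiplicity. -/
abbrev Config (d : ℕ) : Type := Multiset (Pt d)

/-- Energy of a list of particles: the sum of `φ(|x - y|)` over all pairs of positions in the list. -/
def listEnergy {d : ℕ} (φ : ℝ → WithTop ℝ) : List (Pt d) → WithTop ℝ
  | [] => 0
  | x :: xs => (xs.map fun y => φ ‖x - y‖).sum + listEnergy φ xs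

theorem listEnergy_perm {d : ℕ} (φ : ℝ → WithTop ℝ) {a b : List (Pt d)} (h : a.Perm b) :
    listEnergy φ a = listEnergy φ b := by
  induction h with
  | nil => rfl
  | cons x h ih => simp only [listEnergy, ih, (h.map _).sum_eq]
  | swap x y l =>
    simp only [listEnergy, List.map_cons, List.sum_cons, norm_sub_rev y x]
    abel
  | trans _ _ ih₁ ih₂ => exact ih₁.trans ih₂

/-- Total energy `U(γ) = ∑_{i<j} φ(|x_i - x_j|)` of a finite configuration `γ = {x_1, …, x_n}`;
the pair potential takes values in `ℝ ∪ {+∞}`. -/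
def energy {d : ℕ} (φ : ℝ → WithTop ℝ) (γ : Config d) : WithTop ℝ :=
  Quot.lift (listEnergy φ) (fun _ _ h => listEnergy_perm φ h) γ

/-- The Boltzmann factor `e^{-β u}`, with `e^{-β (+∞)} = 0`. -/
def boltzmann (β : ℝ) : WithTop ℝ → ℝ
  | ⊤ => 0
  | (u : ℝ) => Real.exp (-β * u)

/-- Stability: `U(γ) ≥ -B |γ|` for all finite configurations in `ℝ^d`. -/
def IsStable (d : ℕ) (φ : ℝ → WithTop ℝ) (B : ℝ) : Prop :=
  ∀ γ : Config d, ((-(B * (Multiset.card γ : ℝ)) : ℝ) : WithTop ℝ) ≤ energy φ γ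

/-- The function `x ↦ e^{-β φ(|x|)} - 1`. -/
def mayer (d : ℕ) (φ : ℝ → WithTop ℝ) (β : ℝ) (x : Pt d) : ℝ :=
  boltzmann β (φ ‖x‖) - 1

/-- `ν₁(β) = ∫ |e^{-β φ(|x|)} - 1| dx`. -/
def nuOne (d : ℕ) (φ : ℝ → WithTop ℝ) (β : ℝ) : ℝ := ∫ x : Pt d, |mayer d φ β x|

/-- The polynomial kernel `1 / (1 + |x|^α)`. -/
def nuBar {d : ℕ} (α : ℝ) (x : Pt d) : ℝ := 1 / (1 + ‖x‖ ^ α)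

/-- The integral of the polynomial kernel over `ℝ^d` (without the prefactor `C(β)`). -/
def nuBarOne (d : ℕ) (α : ℝ) : ℝ := ∫ x : Pt d, nuBar α x

/-- The integral of `F` against the Lebesgue-Poisson measure with activity `z`:
`∑ₙ zⁿ/n! ∫ F({x_1, …, x_n}) dx_1 ⋯ dx_n`. -/
def lpIntegral {d : ℕ} (z : ℝ) (F : Config d → ℝ) : ℝ :=
  ∑' n : ℕ, z ^ n / (n.factorial : ℝ) *
    ∫ x : Fin n → Pt d, F ((List.ofFn x : List (Pt d)) : Multiset (Pt d))

/-- A spatial cutoff: a measurable function with values in `[0, 1]` and bounded support. Smooth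
compactly supported functions and indicators of bounded Borel sets are both included. -/
structure IsCutoff {d : ℕ} (j : Pt d → ℝ) : Prop where
  measurable : Measurable j
  nonneg : ∀ x, 0 ≤ j x
  le_one : ∀ x, j x ≤ 1
  bounded_support : Bornology.IsBounded (Function.support j)

/-- `χ_j(η) = ∏_{x ∈ η} j(x)`, equal to `1` on the empty configuration. -/
def chi {d : ℕ} (j : Pt d → ℝ) (η : Config d) : ℝ := (η.map j).prod

/-- The correlation function with cutoff `j`,
`ρ_j(η) = z^{|η|} Z_j⁻¹ ∫ χ_j(η + γ) e^{-β U(η + γ)} λ_z(dγ)`,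
where `Z_j = ∫ χ_j(γ) e^{-β U(γ)} λ_z(dγ)`. For `j` the indicator of a bounded Borel set `Λ` it is
the finite-volume correlation function of the grand canonical Gibbs measure in `Λ`. -/
def cutoffCorrelation {d : ℕ} (φ : ℝ → WithTop ℝ) (β z : ℝ) (j : Pt d → ℝ) (η : Config d) : ℝ :=
  z ^ Multiset.card η / lpIntegral z (fun γ => chi j γ * boltzmann β (energy φ γ)) *
    lpIntegral z (fun γ => chi j (η + γ) * boltzmann β (energy φ (η + γ)))

/-- `ρ` is the infinite-volume correlation function: for every sequence of cutoffs that converges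
pointwise to `1`, the cutoff correlation functions converge pointwise to `ρ`. -/
def IsInfiniteVolumeCorrelation {d : ℕ} (φ : ℝ → WithTop ℝ) (β z : ℝ) (ρ : Config d → ℝ) : Prop :=
  ∀ j : ℕ → Pt d → ℝ, (∀ n, IsCutoff (j n)) → (∀ x, Tendsto (fun n => j n x) atTop (𝓝 1)) →
    ∀ η : Config d, Tendsto (fun n => cutoffCorrelation φ β z (j n) η) atTop (𝓝 (ρ η))

/-- Partially truncated correlation function of the clusters `(η i)_{i ∈ I}`, defined recursively by
`ρ̃(η_I) = ρ(∑_{i ∈ I} η_i) - ∑ ∏_l ρ̃(η_{I_l})`, the sum being over all partitions of `I` into at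
least two non-empty blocks `I_l`. -/
def ptcf {d : ℕ} {ι : Type} [DecidableEq ι] (ρ : Config d → ℝ) (η : ι → Config d)
    (I : Finset ι) : ℝ :=
  ρ (∑ i ∈ I, η i) -
    ∑ P : {P : Finpartition I // 2 ≤ P.parts.card}, ∏ J : {J : Finset ι // J ∈ P.1.parts},
      ptcf ρ η J.1
termination_by I.card
decreasing_by
  refine Finset.card_lt_card (lt_of_le_of_ne (P.1.le J.2) fun h => ?_)
  obtain ⟨K, hK, hne⟩ := Finset.exists_mem_ne (s := P.1.parts) P.2 J.1
  have hdis := P.1.disjoint hK J.2 hne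
  have hKI : K ≤ J.1 := (P.1.le hK).trans (le_of_eq h.symm)
  exact P.1.ne_bot hK (hdis.eq_bot_of_le hKI)

/-- `max_{x ∈ η, y ∈ η'} 1 / (1 + |x - y|^α)`, for non-empty `η`, `η'`. -/
def clusterMax {d : ℕ} (α : ℝ) (η η' : Config d) : ℝ :=
  sSup {v : ℝ | ∃ x ∈ η, ∃ y ∈ η', v = nuBar α (x - y)}

open Classical in
/-- The product of `clusterMax` over the edges of a graph on the cluster indices. -/
def treeWeight {d m : ℕ} (α : ℝ) (η : Fin m → Config d) (T : SimpleGraph (Fin m)) : ℝ :=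
  ∏ p ∈ Finset.univ.filter (fun p : Fin m × Fin m => p.1 < p.2 ∧ T.Adj p.1 p.2),
    clusterMax α (η p.1) (η p.2)

/-- The maximum of `treeWeight` over all trees on the `m` cluster indices. -/
def maxTreeWeight {d m : ℕ} (α : ℝ) (η : Fin m → Config d) : ℝ :=
  sSup {v : ℝ | ∃ T : SimpleGraph (Fin m), T.IsTree ∧ v = treeWeight α η T}

/-- The constants `A_{m,σ}`. Here `l i` is the number of points of the `i`-th cluster,
`h = z e^{2βB}`, `n₁ = ν₁(β)` and `n₂ = C(β) ∫ 1/(1+|x|^α) dx`. -/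
def constA (α C h n₁ n₂ : ℝ) {m : ℕ} (l : Fin m → ℕ) (σ : ℕ) : ℝ :=
  let L : ℕ := ∑ i, l i
  let u : ℝ := 1 - h * n₁ * Real.exp 1
  let w : ℝ := u - h * n₂ * (2 : ℝ) ^ (1 + α)
  (∏ i, (l i : ℝ)) * ((m - 1).choose (σ - 1) : ℝ) * C ^ (m - 1) *
    (1 + C) ^ (∑ i ∈ Finset.univ.filter (fun i : Fin m => (i : ℕ) ≠ 0), (l i - 1)) *
    (h / u) ^ L *
    ((L : ℝ) ^ (m - 2) * (h * n₂ * (2 : ℝ) ^ (1 + α) / w) ^ (σ - 1) +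
      (L : ℝ) ^ (m - σ) * ∑ r ∈ Finset.Icc 1 (σ - 2),
        ((σ + r - 2).factorial : ℝ) / ((r.factorial : ℝ) * 2 ^ r * ((σ - 2 - r).factorial : ℝ)) *
          ((L : ℝ) + r) ^ (σ - 2 - r) *
          (σ * (2 : ℝ) ^ (α * ((σ : ℝ) - 1)) * (h * n₂ / u)) ^ r * (u / w) ^ (σ + r - 1))

end PTCF

end

set_option linter.unusedSectionVars false

noncomputable section

namespace PTCF

/-! ### The convolution ring of functions of finite index sets. -/

section

open scoped ENNReal

/-! Fix the clusters `η i`. For a correlation function `ρ` and a configuration `A`, the map `I ↦ ρ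
(A + ∑ i ∈ I, η i)` is an element of a commutative ring under convolution over disjoint
decompositions. Multiplying it by the convolution inverse `r` of the element for `A = 0` truncates
it, and for `A = η i₀` the result is the PTCF (`ptcf_eq_truncated`). Since `r` does not depend on
`A`, the truncated functions inherit the linear Kirkwood-Salsburg equation of the cutoff
correlations (`truncated_cons`). At `A = 0` they equal the unit of the ring, so they vanish there as
soon as a cluster is left. Stability always provides a point whose total interaction with the rest
is at most `e^{2βB}`; removing that point costs a factor `h`.

Comparison (`IsKSSolution.enorm_truncated_le`): every nonnegative supersolution of the resulting
inequality dominates the truncated functions, because the error contracts geometrically in the norm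
weighted by `v ^ |A|` as soon as `h e^{v ν₁} < v`.

A supersolution (`confFun_supersolution`) is the product over the points `p` of `A` of `T exp(E p)`,
with the convolution exponential. Integrating out the neighbours of `x` exponentiates, so one needs
`h e^{T ν₁} ≤ T` and: direct links of `x` to clusters, plus `T ∫ fh(x-y) (exp(E y) - 1) dy`, are at
most `E x`. The linear part of the integral is absorbed because convolution with the kernel
multiplies `E` by at most `2^{1+α} ∫ ν̄`; this produces `K = u/w`. The remaining equation for `E`
involves fewer clusters on its right side and is solved by iteration (`skelLog_eq`).

Unfolding `E` gives forests whose branching points are integrated. A star with an integrated centre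
is bounded by stars centred at its end points, by moving the centre to the nearest one (`star_le`).
What survives is a list of edges between clusters connecting all of them, and a spanning tree of it
is bounded by the maximum over trees (`maxLink_le_maxTreeWeight`). The number of forests obeys a
recursion solved exactly by polynomials of binomial type (`clusterPoly_comp_add`, `clusterLog_eq`),
whose coefficients are the numbers in `S_σ`; `sum_constA_ge` compares them with the `A_{m,σ}`.

Existence of `ρ` comes from the same contraction applied to differences of two cutoff correlations.
The bound is proved uniformly in the cutoff and passes to the limit. -/

/-- Functions of finite subsets of `ι`, with the convolution product over disjoint decompositions. -/
@[ext] structure SetFun (ι R : Type*) where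
  /-- The underlying function. -/
  toFun : Finset ι → R

namespace SetFun

instance {ι R : Type*} : CoeFun (SetFun ι R) (fun _ => Finset ι → R) := ⟨toFun⟩

theorem ext_apply {ι R : Type*} {f g : SetFun ι R} (h : ∀ S, f S = g S) : f = g :=
  SetFun.ext (funext h)

instance {ι R : Type*} [PartialOrder R] : PartialOrder (SetFun ι R) :=
  PartialOrder.lift toFun fun _ _ h => SetFun.ext h

instance {ι R : Type*} [Add R] : Add (SetFun ι R) := ⟨fun f g => ⟨fun S => f S + g S⟩⟩

instance {ι R : Type*} [Zero R] : Zero (SetFun ι R) := ⟨⟨fun _ => 0⟩⟩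

@[simp] theorem add_apply {ι R : Type*} [Add R] (f g : SetFun ι R) (S : Finset ι) :
    (f + g) S = f S + g S := rfl

@[simp] theorem zero_apply {ι R : Type*} [Zero R] (S : Finset ι) : (0 : SetFun ι R) S = 0 := rfl

instance {ι R : Type*} [AddCommMonoid R] : AddCommMonoid (SetFun ι R) where
  add_assoc f g h := ext_apply fun S => add_assoc _ _ _
  zero_add f := ext_apply fun S => zero_add _
  add_zero f := ext_apply fun S => add_zero _
  add_comm f g := ext_apply fun S => add_comm _ _
  nsmul := nsmulRec

theorem sum_apply {ι R κ : Type*} [AddCommMonoid R] (s : Finset κ) (f : κ → SetFun ι R)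
    (S : Finset ι) : (∑ k ∈ s, f k) S = ∑ k ∈ s, f k S := by
  classical
  induction s using Finset.induction_on with
  | empty => simp
  | insert a s ha ih => rw [Finset.sum_insert ha, Finset.sum_insert ha, add_apply, ih]

variable {ι R : Type*} [DecidableEq ι]

section Semiring

variable [CommSemiring R]

instance : Mul (SetFun ι R) := ⟨fun f g => ⟨fun S => ∑ A ∈ S.powerset, f A * g (S \ A)⟩⟩

theorem mul_apply (f g : SetFun ι R) (S : Finset ι) :
    (f * g) S = ∑ A ∈ S.powerset, f A * g (S \ A) := rfl

/-- The function supported at `J` with value `c`. -/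
def single (J : Finset ι) (c : R) : SetFun ι R := ⟨fun S => if S = J then c else 0⟩

theorem single_apply (J S : Finset ι) (c : R) :
    (single J c : SetFun ι R) S = if S = J then c else 0 := rfl

instance : One (SetFun ι R) := ⟨single ∅ 1⟩

theorem one_def : (1 : SetFun ι R) = single ∅ 1 := rfl

theorem one_apply (S : Finset ι) : (1 : SetFun ι R) S = if S = ∅ then 1 else 0 := rfl

theorem single_mul_apply (J S : Finset ι) (c : R) (f : SetFun ι R) :
    (single J c * f) S = if J ⊆ S then c * f (S \ J) else 0 := by
  rw [mul_apply]
  simp only [single_apply, ite_mul, zero_mul]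
  rw [Finset.sum_ite_eq' S.powerset J]
  simp [Finset.mem_powerset]

theorem conv_comm (f g : SetFun ι R) : f * g = g * f := by
  refine ext_apply fun S => ?_
  rw [mul_apply, mul_apply]
  refine Finset.sum_nbij' (fun A => S \ A) (fun A => S \ A) ?_ ?_ ?_ ?_ ?_
  · intro A _; simp
  · intro A _; simp
  · intro A hA; simpa using (Finset.mem_powerset.1 hA)
  · intro A hA; simpa using (Finset.mem_powerset.1 hA)
  · intro A hA
    rw [Finset.sdiff_sdiff_eq_self (Finset.mem_powerset.1 hA), mul_comm]

/-- Reindexing of a sum over the ways to split a set into three parts. -/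
theorem sum_powerset_powerset {M : Type*} [AddCommMonoid M]
    (F : Finset ι → Finset ι → Finset ι → M) (S : Finset ι) :
    ∑ A ∈ S.powerset, ∑ B ∈ A.powerset, F B (A \ B) (S \ A) =
      ∑ B ∈ S.powerset, ∑ D ∈ (S \ B).powerset, F B D ((S \ B) \ D) := by
  rw [Finset.sum_sigma', Finset.sum_sigma']
  refine Finset.sum_bij' (fun p _ => ⟨p.2, p.1 \ p.2⟩) (fun p _ => ⟨p.1 ∪ p.2, p.1⟩) ?_ ?_ ?_ ?_ ?_
  · rintro ⟨A, B⟩ h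
    simp only [Finset.mem_sigma, Finset.mem_powerset] at h ⊢
    exact ⟨h.2.trans h.1, Finset.sdiff_subset_sdiff h.1 le_rfl⟩
  · rintro ⟨A, B⟩ h
    simp only [Finset.mem_sigma, Finset.mem_powerset] at h ⊢
    exact ⟨Finset.union_subset h.1 (h.2.trans Finset.sdiff_subset), Finset.subset_union_left⟩
  · rintro ⟨A, B⟩ h
    simp only [Finset.mem_sigma, Finset.mem_powerset] at h
    simp [Finset.union_sdiff_of_subset h.2]
  · rintro ⟨A, B⟩ h
    simp only [Finset.mem_sigma, Finset.mem_powerset] at h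
    have : Disjoint A B := (Finset.disjoint_sdiff).mono_right h.2
    simp [Finset.union_sdiff_cancel_left this]
  · rintro ⟨A, B⟩ h
    simp only [Finset.mem_sigma, Finset.mem_powerset] at h
    have : (S \ B) \ (A \ B) = S \ A := by
      ext x
      simp only [Finset.mem_sdiff]
      have := @h.2 x
      tauto
    simp only [this]

theorem conv_assoc (f g h : SetFun ι R) : f * g * h = f * (g * h) := by
  refine ext_apply fun S => ?_
  simp only [mul_apply, Finset.sum_mul, Finset.mul_sum]
  rw [sum_powerset_powerset fun A B D => f A * g B * h D]
  simp only [mul_assoc]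

theorem one_conv (f : SetFun ι R) : 1 * f = f := by
  refine ext_apply fun S => ?_
  rw [one_def, single_mul_apply]
  simp

instance : CommSemiring (SetFun ι R) where
  mul_assoc := conv_assoc
  one_mul := one_conv
  mul_one f := by rw [conv_comm, one_conv]
  mul_comm := conv_comm
  zero_mul f := ext_apply fun S => by simp [mul_apply]
  mul_zero f := ext_apply fun S => by simp [mul_apply]
  left_distrib f g h := ext_apply fun S => by simp [mul_apply, mul_add, Finset.sum_add_distrib]
  right_distrib f g h := ext_apply fun S => by simp [mul_apply, add_mul, Finset.sum_add_distrib]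

theorem natCast_mul_apply (n : ℕ) (f : SetFun ι R) (S : Finset ι) :
    ((n : SetFun ι R) * f) S = n * f S := by
  induction n with
  | zero => simp
  | succ n ih => simp only [Nat.cast_succ, add_mul, one_mul, add_apply, ih]

theorem mul_empty (f g : SetFun ι R) : (f * g) ∅ = f ∅ * g ∅ := by simp [mul_apply]

theorem pow_empty (f : SetFun ι R) (n : ℕ) : (f ^ n) ∅ = f ∅ ^ n := by
  induction n with
  | zero => simp [one_apply]
  | succ n ih => rw [pow_succ, mul_empty, ih, pow_succ]

theorem single_mul_single (J J' : Finset ι) (c c' : R) (h : Disjoint J J') :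
    (single J c * single J' c' : SetFun ι R) = single (J ∪ J') (c * c') := by
  refine ext_apply fun S => ?_
  rw [single_mul_apply, single_apply, single_apply]
  by_cases hS : S = J ∪ J'
  · subst hS
    simp [Finset.union_sdiff_cancel_left h]
  · rw [if_neg hS]
    split_ifs with h1 h2
    · exact absurd (by rw [← h2, Finset.union_sdiff_of_subset h1]) hS
    · simp
    · rfl

theorem single_empty_mul_apply (c : R) (f : SetFun ι R) (S : Finset ι) :
    (single ∅ c * f : SetFun ι R) S = c * f S := by simp [single_mul_apply]

theorem prod_single (J : Finset ι) (c : ι → R) :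
    ∏ j ∈ J, (single {j} (c j) : SetFun ι R) = single J (∏ j ∈ J, c j) := by
  induction J using Finset.induction_on with
  | empty => simp; rfl
  | insert a s ha ih =>
    rw [Finset.prod_insert ha, Finset.prod_insert ha, ih,
      single_mul_single _ _ _ _ (by simpa using ha)]
    rfl

/-- Multiplication by a multiplicative weight. -/
def weight (μ : ι → R) (f : SetFun ι R) : SetFun ι R := ⟨fun A => (∏ j ∈ A, μ j) * f A⟩

theorem weight_apply (μ : ι → R) (f : SetFun ι R) (S : Finset ι) :
    weight μ f S = (∏ j ∈ S, μ j) * f S := rfl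

/-- A product weight factorizes over disjoint unions, so weighting is a ring homomorphism. It is
used to strip per-cluster factors from the counting recursion. -/
theorem weight_mul (μ : ι → R) (f g : SetFun ι R) :
    weight μ (f * g) = weight μ f * weight μ g := by
  refine ext_apply fun S => ?_
  rw [weight_apply, mul_apply, mul_apply, Finset.mul_sum]
  refine Finset.sum_congr rfl fun A hA => ?_
  rw [← Finset.prod_sdiff (Finset.mem_powerset.1 hA), weight_apply, weight_apply]
  ring

theorem weight_one (μ : ι → R) : weight μ (1 : SetFun ι R) = 1 := by
  refine ext_apply fun S => ?_
  rw [weight_apply, one_apply]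
  split_ifs with h <;> simp [h]

theorem weight_pow (μ : ι → R) (f : SetFun ι R) (n : ℕ) :
    weight μ (f ^ n) = weight μ f ^ n := by
  induction n with
  | zero => simp [weight_one]
  | succ n ih => rw [pow_succ, pow_succ, weight_mul, ih]

end Semiring

instance [CommRing R] : Neg (SetFun ι R) := ⟨fun f => ⟨fun S => - f S⟩⟩

instance [CommRing R] : CommRing (SetFun ι R) where
  zsmul := zsmulRec
  neg_add_cancel f := ext_apply fun S => neg_add_cancel (f S)
  mul_comm := conv_comm

theorem sub_apply [CommRing R] (f g : SetFun ι R) (S : Finset ι) : (f - g) S = f S - g S := by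
  rw [sub_eq_add_neg, sub_eq_add_neg]
  rfl

/-- A set function with value `1` at the empty set has a convolution inverse. -/
theorem exists_mul_eq_one [CommRing R] (f : SetFun ι R) (hf : f ∅ = 1) :
    ∃ g : SetFun ι R, ∀ S, (f * g) S = (1 : SetFun ι R) S := by
  -- `1 - f` vanishes at `∅`, so its `n`-th power needs `n` disjoint nonempty subsets. The inverse
  -- is therefore a geometric series that is finite at each set.
  have hvan : ∀ (n : ℕ) (S : Finset ι), S.card < n → ((1 - f) ^ n) S = 0 := by
    intro n
    induction n with
    | zero => intro S hS; omega
    | succ n ih =>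
      intro S hS
      rw [pow_succ', mul_apply]
      refine Finset.sum_eq_zero fun A hA => ?_
      rcases A.eq_empty_or_nonempty with rfl | hne
      · have : (1 - f) ∅ = 0 := by
          rw [sub_apply, hf, one_apply, if_pos rfl, sub_self]
        rw [this, zero_mul]
      · rw [ih _ ?_, mul_zero]
        have := Finset.card_sdiff_add_card_eq_card (Finset.mem_powerset.1 hA)
        have := hne.card_pos
        omega
  refine ⟨⟨fun S => (∑ n ∈ Finset.range (S.card + 1), (1 - f) ^ n) S⟩, fun S => ?_⟩
  have key : (f * ∑ n ∈ Finset.range (S.card + 1), (1 - f) ^ n) S = (1 : SetFun ι R) S := by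
    have h := mul_neg_geom_sum (1 - f) (S.card + 1)
    rw [sub_sub_cancel] at h
    rw [h]
    rw [sub_apply, hvan _ _ (Nat.lt_succ_self _), sub_zero]
  rw [← key, mul_apply, mul_apply]
  refine Finset.sum_congr rfl fun A hA => ?_
  congr 1
  rw [sum_apply, sum_apply]
  refine Finset.sum_subset (Finset.range_subset_range.2 (by
    have := Finset.card_le_card (Finset.sdiff_subset (s := S) (t := A)); omega)) ?_
  intro n _ hn
  exact hvan _ _ (by simpa using hn)

/-! ### The convolution exponential with values in `ℝ≥0∞`. -/

section Exp

open ENNReal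

theorem mul_mono {f f' g g' : SetFun ι ℝ≥0∞} (hf : f ≤ f') (hg : g ≤ g') : f * g ≤ f' * g' :=
  fun S => Finset.sum_le_sum fun A _ => mul_le_mul' (hf A) (hg (S \ A))

theorem pow_mono {f f' : SetFun ι ℝ≥0∞} (hf : f ≤ f') (n : ℕ) : f ^ n ≤ f' ^ n := by
  induction n with
  | zero => simp
  | succ n ih => rw [pow_succ, pow_succ]; exact mul_mono ih hf

theorem prod_mono {κ : Type*} (s : Finset κ) {f g : κ → SetFun ι ℝ≥0∞} (h : ∀ k ∈ s, f k ≤ g k) :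
    ∏ k ∈ s, f k ≤ ∏ k ∈ s, g k := by
  classical
  induction s using Finset.induction_on with
  | empty => simp
  | insert a s ha ih =>
    rw [Finset.prod_insert ha, Finset.prod_insert ha]
    exact mul_mono (h a (by simp)) (ih fun k hk => h k (by simp [hk]))

/-- The convolution exponential. -/
def exp (f : SetFun ι ℝ≥0∞) : SetFun ι ℝ≥0∞ :=
  ⟨fun S => ∑' n : ℕ, (n.factorial : ℝ≥0∞)⁻¹ * (f ^ n) S⟩

theorem exp_apply (f : SetFun ι ℝ≥0∞) (S : Finset ι) :
    exp f S = ∑' n : ℕ, (n.factorial : ℝ≥0∞)⁻¹ * (f ^ n) S := rfl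

theorem exp_mono {f g : SetFun ι ℝ≥0∞} (h : f ≤ g) : exp f ≤ exp g := fun S =>
  ENNReal.tsum_le_tsum fun n => mul_le_mul' le_rfl (pow_mono h n S)

theorem one_add_le_exp (f : SetFun ι ℝ≥0∞) : 1 + f ≤ exp f := fun S => by
  have h := ENNReal.sum_le_tsum (f := fun n : ℕ => (n.factorial : ℝ≥0∞)⁻¹ * (f ^ n) S)
    (Finset.range 2)
  simpa [Finset.sum_range_succ, exp_apply] using h

/-- Taylor's formula with remainder: the terms of order `n + 2` are compared with those of `f² exp f
/ 2` through `2 · n! ≤ (n + 2)!`. This isolates the linear term, the one that is later absorbed. -/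
theorem exp_le_add_half (f : SetFun ι ℝ≥0∞) (S : Finset ι) :
    exp f S ≤ (1 : SetFun ι ℝ≥0∞) S + f S + 2⁻¹ * (f * f * exp f) S := by
  have h2 : (f * f * exp f) S = ∑' n : ℕ, (n.factorial : ℝ≥0∞)⁻¹ * (f ^ (n + 2)) S := by
    rw [mul_apply]
    simp only [exp_apply, ← ENNReal.tsum_mul_left]
    rw [← Summable.tsum_finsetSum (fun _ _ => ENNReal.summable)]
    refine tsum_congr fun n => ?_
    rw [pow_add, mul_comm (f ^ n), sq, mul_apply, Finset.mul_sum]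
    refine Finset.sum_congr rfl fun A _ => ?_
    ring
  rw [exp_apply, tsum_eq_zero_add' ENNReal.summable, tsum_eq_zero_add' ENNReal.summable, h2,
    ← ENNReal.tsum_mul_left, ← add_assoc]
  refine add_le_add (by simp) (ENNReal.tsum_le_tsum fun n => ?_)
  rw [← mul_assoc]
  refine mul_le_mul' ?_ le_rfl
  rw [← ENNReal.mul_inv (by simp) (by simp), ENNReal.inv_le_inv]
  have : 2 * n.factorial ≤ (n + 1 + 1).factorial := by
    rw [Nat.factorial_succ, Nat.factorial_succ]
    rw [← mul_assoc]
    exact Nat.mul_le_mul_right _ (by nlinarith)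
  exact_mod_cast this

/-- Binomial theorem and Cauchy product; in `ℝ≥0∞` no convergence question arises. -/
theorem exp_add (f g : SetFun ι ℝ≥0∞) : exp (f + g) = exp f * exp g := by
  refine ext_apply fun S => ?_
  have h1 : ∀ n : ℕ, (n.factorial : ℝ≥0∞)⁻¹ * ((f + g) ^ n) S =
      ∑ p ∈ Finset.HasAntidiagonal.antidiagonal n,
        ((p.1.factorial : ℝ≥0∞)⁻¹ * (p.2.factorial : ℝ≥0∞)⁻¹) * (f ^ p.1 * g ^ p.2) S := by
    intro n
    rw [(Commute.all f g).add_pow', sum_apply, Finset.mul_sum]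
    refine Finset.sum_congr rfl fun p hp => ?_
    rw [nsmul_eq_mul, natCast_mul_apply, ← mul_assoc]
    congr 1
    have hp' : p.1 + p.2 = n := Finset.HasAntidiagonal.mem_antidiagonal.1 hp
    subst hp'
    rw [← Nat.add_choose_mul_factorial_mul_factorial p.1 p.2]
    have hc : ((p.1 + p.2).choose p.1 : ℝ≥0∞) ≠ 0 := by
      exact_mod_cast (Nat.choose_pos (Nat.le_add_right _ _)).ne'
    push_cast
    rw [← Nat.choose_symm_add, mul_assoc, ENNReal.mul_inv (Or.inl hc) (Or.inl (ENNReal.natCast_ne_top _)),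
      ENNReal.mul_inv (Or.inl (by exact_mod_cast Nat.factorial_ne_zero _))
        (Or.inl (ENNReal.natCast_ne_top _)), mul_comm, ← mul_assoc,
      ENNReal.mul_inv_cancel hc (ENNReal.natCast_ne_top _), one_mul]
  rw [exp_apply, tsum_congr h1, mul_apply]
  have h2 : ∀ A ∈ S.powerset, exp f A * exp g (S \ A) = ∑' p : ℕ × ℕ,
      ((p.1.factorial : ℝ≥0∞)⁻¹ * (p.2.factorial : ℝ≥0∞)⁻¹) * ((f ^ p.1) A * (g ^ p.2) (S \ A)) := by
    intro A _
    rw [exp_apply, exp_apply, ← ENNReal.tsum_mul_right, ENNReal.tsum_prod']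
    refine tsum_congr fun a => ?_
    rw [← ENNReal.tsum_mul_left]
    refine tsum_congr fun b => ?_
    ring
  rw [Finset.sum_congr rfl h2, ← Summable.tsum_finsetSum (fun _ _ => ENNReal.summable),
    ← Finset.HasAntidiagonal.sigmaAntidiagonalEquivProd.tsum_eq, ENNReal.tsum_sigma']
  refine tsum_congr fun n => ?_
  rw [tsum_fintype, ← Finset.sum_coe_sort]
  refine Finset.sum_congr rfl fun p _ => ?_
  rw [mul_apply, Finset.mul_sum]
  rfl

theorem exp_zero : exp (0 : SetFun ι ℝ≥0∞) = 1 := by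
  refine ext_apply fun S => ?_
  rw [exp_apply, tsum_eq_single 0]
  · simp
  · intro n hn; rw [zero_pow hn]; simp

theorem exp_sum {κ : Type*} (s : Finset κ) (f : κ → SetFun ι ℝ≥0∞) :
    exp (∑ k ∈ s, f k) = ∏ k ∈ s, exp (f k) := by
  classical
  induction s using Finset.induction_on with
  | empty => simp [exp_zero]
  | insert a s ha ih => rw [Finset.sum_insert ha, Finset.prod_insert ha, exp_add, ih]

theorem single_empty_pow (c : ℝ≥0∞) (n : ℕ) :
    (single ∅ c : SetFun ι ℝ≥0∞) ^ n = single ∅ (c ^ n) := by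
  induction n with
  | zero => simp; rfl
  | succ n ih => rw [pow_succ, ih, single_mul_single _ _ _ _ (by simp), pow_succ]; rfl

theorem exp_single_empty (c : ℝ) (hc : 0 ≤ c) :
    exp (single ∅ (ENNReal.ofReal c) : SetFun ι ℝ≥0∞) = single ∅ (ENNReal.ofReal (Real.exp c)) := by
  refine ext_apply fun S => ?_
  rw [exp_apply]
  simp only [single_empty_pow, single_apply]
  split_ifs with h
  · rw [Real.exp_eq_exp_ℝ, NormedSpace.exp_eq_tsum_div, ENNReal.ofReal_tsum_of_nonneg
      (fun n => by positivity) (Real.summable_pow_div_factorial c)]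
    refine tsum_congr fun n => ?_
    rw [ENNReal.ofReal_div_of_pos (by positivity), ENNReal.ofReal_pow hc, ENNReal.ofReal_natCast,
      ENNReal.div_eq_inv_mul]
  · simp

end Exp

end SetFun

end

/-! ### Skeleton polynomials: coefficients and differential equation. -/

section

open Polynomial in
/-- The number of ways to build a forest skeleton with `n + 1` clusters of total size `s` and `r`
branching points, weighted by the edge factor `K` and the branching factor `Θ`. -/
def skelCoeff (K Θ : ℝ) (n r : ℕ) : ℝ :=
  K ^ (n + 1 + r) * Θ ^ r * ((n + r).factorial / (r.factorial * 2 ^ r * (n - r).factorial))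

open Polynomial in
/-- The skeleton polynomial in the number of roots, for `n + 1` clusters of total size `s`. -/
def skelPoly (K Θ : ℝ) (n : ℕ) (s : ℝ) : ℝ[X] :=
  X * ∑ r ∈ Finset.range (n + 1), C (skelCoeff K Θ n r) * (X + C (s + r)) ^ (n - r)

section

open Polynomial

theorem eval_derivative_mul_pow (a c s : ℝ) (k : ℕ) :
    eval a (derivative (X * (C c * (X + C s) ^ k))) =
      c * ((a + s) ^ k + a * (k * (a + s) ^ (k - 1))) := by
  simp [derivative_mul, derivative_pow]
  ring

theorem eval_derivative_two_mul_pow (a c s : ℝ) (k : ℕ) :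
    eval a (derivative (derivative (X * (C c * (X + C s) ^ k)))) =
      c * (2 * (k * (a + s) ^ (k - 1)) + a * (k * ((k - 1 : ℕ) * (a + s) ^ (k - 1 - 1)))) := by
  simp [derivative_mul, derivative_pow]
  ring

theorem skelCoeff_step_last (K Θ : ℝ) (r : ℕ) :
    skelCoeff K Θ (r + 1) (r + 1) = K * (Θ * skelCoeff K Θ (r + 1) r) := by
  unfold skelCoeff
  have h1 : ((r + 1 + (r + 1)).factorial : ℝ) = (r + 1 + (r + 1)) * (r + 1 + r).factorial := by
    rw [show r + 1 + (r + 1) = (r + 1 + r) + 1 by ring, Nat.factorial_succ]; push_cast; ring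
  have h2 : ((r + 1).factorial : ℝ) = (r + 1) * r.factorial := by
    rw [Nat.factorial_succ]; push_cast; ring
  have h3 : r + 1 - r = 1 := by omega
  have : (r.factorial : ℝ) ≠ 0 := by positivity
  have : (r : ℝ) + 1 ≠ 0 := by positivity
  rw [h1, h2, h3, Nat.sub_self]
  simp only [Nat.factorial]
  field_simp
  ring

/-- Coefficient of `(a + s + (r + 1)) ^ j` in the differential equation of `skelPoly_succ_ode`. The
branching index `r + 1` on the left receives index `r + 1` from the attached clusters and index `r`
from the second derivative. -/
theorem skelCoeff_step (K Θ a s : ℝ) (r j : ℕ) :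
    skelCoeff K Θ (r + 1 + (j + 1)) (r + 1) * ((a + s + (r + 1)) + a * (j + 1)) =
      K * (skelCoeff K Θ (r + 1 + j) (r + 1) * ((r + j + 3) * a + s) +
        Θ * (skelCoeff K Θ (r + 1 + (j + 1)) r * (j + 2) *
          ((a + s + (r + 1)) + (a + 1) * (j + 1) / 2))) := by
  unfold skelCoeff
  set F : ℝ := ((2 * r + j + 2).factorial : ℝ) with hF
  have e1 : ((r + 1 + (j + 1) + (r + 1)).factorial : ℝ) = (2 * r + j + 3) * F := by
    rw [show r + 1 + (j + 1) + (r + 1) = (2 * r + j + 2) + 1 by ring, Nat.factorial_succ]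
    push_cast; ring
  have e2 : ((r + 1 + j + (r + 1)).factorial : ℝ) = F := by
    rw [show r + 1 + j + (r + 1) = 2 * r + j + 2 by ring]
  have e3 : ((r + 1 + (j + 1) + r).factorial : ℝ) = F := by
    rw [show r + 1 + (j + 1) + r = 2 * r + j + 2 by ring]
  have d1 : r + 1 + (j + 1) - (r + 1) = j + 1 := by omega
  have d2 : r + 1 + j - (r + 1) = j := by omega
  have d3 : r + 1 + (j + 1) - r = j + 1 + 1 := by omega
  have g1 : ((r + 1).factorial : ℝ) = (r + 1) * r.factorial := by
    rw [Nat.factorial_succ]; push_cast; ring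
  have g2 : ((j + 1 + 1).factorial : ℝ) = (j + 2) * ((j + 1) * j.factorial) := by
    rw [Nat.factorial_succ, Nat.factorial_succ]; push_cast; ring
  have g3 : ((j + 1).factorial : ℝ) = (j + 1) * j.factorial := by
    rw [Nat.factorial_succ]; push_cast; ring
  rw [e1, e2, e3, d1, d2, d3, g1, g2, g3]
  have : (r.factorial : ℝ) ≠ 0 := by positivity
  have : (j.factorial : ℝ) ≠ 0 := by positivity
  have : (r : ℝ) + 1 ≠ 0 := by positivity
  have : (j : ℝ) + 1 ≠ 0 := by positivity
  have : (j : ℝ) + 2 ≠ 0 := by positivity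
  field_simp
  ring

theorem skelCoeff_step_zero (K Θ : ℝ) (n : ℕ) :
    skelCoeff K Θ (n + 1) 0 = K * skelCoeff K Θ n 0 := by
  unfold skelCoeff
  have : ((n + 1).factorial : ℝ) ≠ 0 := by positivity
  have : (n.factorial : ℝ) ≠ 0 := by positivity
  simp
  field_simp
  ring

theorem skelPoly_eq_sum (K Θ : ℝ) (n : ℕ) (s : ℝ) :
    skelPoly K Θ n s = ∑ r ∈ Finset.range (n + 1), X * (C (skelCoeff K Θ n r) *
      (X + C (s + r)) ^ (n - r)) := by
  rw [skelPoly, Finset.mul_sum]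

/-- The shift `a + 1` in the second derivative turns the base `a + s + r` into `a + s + (r + 1)`, so
both sides are expanded in the same powers and compared termwise: index `0`, interior indices, and
the last index are the three `skelCoeff_step` identities. -/
theorem skelPoly_succ_ode (K Θ : ℝ) (n : ℕ) (s a : ℝ) :
    eval a (derivative (skelPoly K Θ (n + 1) s)) =
      K * (((n + 2) * a + s) *
          (∑ r ∈ Finset.range (n + 1), skelCoeff K Θ n r * (a + s + r) ^ (n - r)) +
        Θ / 2 * eval (a + 1) (derivative (derivative (skelPoly K Θ (n + 1) s)))) := by
  rw [skelPoly_eq_sum, derivative_sum, eval_finsetSum, derivative_sum, eval_finsetSum]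
  simp only [eval_derivative_mul_pow, eval_derivative_two_mul_pow]
  rw [Finset.sum_range_succ' (fun r => skelCoeff K Θ (n + 1) r * _),
    Finset.sum_range_succ (fun r => skelCoeff K Θ (n + 1) r * (2 * _ + _)),
    Finset.sum_range_succ' (fun r => skelCoeff K Θ n r * _)]
  have hlast : ∀ r ∈ Finset.range (n + 1), skelCoeff K Θ (n + 1) (r + 1) *
      ((a + (s + ((r + 1 : ℕ) : ℝ))) ^ (n + 1 - (r + 1)) +
        a * (((n + 1 - (r + 1) : ℕ) : ℝ) * (a + (s + ((r + 1 : ℕ) : ℝ))) ^ (n + 1 - (r + 1) - 1))) =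
      K * (((n + 2) * a + s) * (if r < n then skelCoeff K Θ n (r + 1) *
        (a + s + ((r + 1 : ℕ) : ℝ)) ^ (n - (r + 1)) else 0) +
      Θ / 2 * (skelCoeff K Θ (n + 1) r *
        (2 * (((n + 1 - r : ℕ) : ℝ) * (a + 1 + (s + r)) ^ (n + 1 - r - 1)) +
          (a + 1) * (((n + 1 - r : ℕ) : ℝ) * (((n + 1 - r - 1 : ℕ) : ℝ) *
            (a + 1 + (s + r)) ^ (n + 1 - r - 1 - 1)))))) := by
    intro r hr
    have hr' : r ≤ n := Nat.lt_succ_iff.1 (Finset.mem_range.1 hr)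
    obtain ⟨k, rfl⟩ := Nat.exists_eq_add_of_le hr'
    have d1 : r + k + 1 - (r + 1) = k := by omega
    have d2 : r + k + 1 - r = k + 1 := by omega
    rw [d1, d2]
    rcases k with _ | j
    · simp only [Nat.add_zero, lt_irrefl, if_false]
      rw [skelCoeff_step_last]
      simp only [zero_add, pow_zero, Nat.cast_zero, Nat.cast_one, Nat.sub_self, zero_mul, mul_zero]
      ring
    · rw [if_pos (by omega)]
      have hs := skelCoeff_step K Θ a s r j
      have i1 : r + (j + 1) + 1 = r + 1 + (j + 1) := by omega
      have i2 : r + (j + 1) = r + 1 + j := by omega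
      have d3 : r + 1 + j - (r + 1) = j := by omega
      rw [i1, i2, d3]
      have hx : a + 1 + (s + (r : ℝ)) = a + s + (r + 1) := by ring
      rw [hx]
      push_cast
      have e1 : a + (s + ((r : ℝ) + 1)) = a + s + (r + 1) := by ring
      rw [e1, pow_succ]
      linear_combination (a + s + (r + 1)) ^ j * hs
  rw [Finset.sum_congr rfl hlast, ← Finset.mul_sum, Finset.sum_add_distrib, ← Finset.mul_sum,
    ← Finset.mul_sum, Finset.sum_range_succ (fun r => if r < n then _ else _)]
  have hif : ∑ r ∈ Finset.range n, (if r < n then skelCoeff K Θ n (r + 1) *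
      (a + s + ((r + 1 : ℕ) : ℝ)) ^ (n - (r + 1)) else 0) = ∑ r ∈ Finset.range n,
      skelCoeff K Θ n (r + 1) * (a + s + ((r + 1 : ℕ) : ℝ)) ^ (n - (r + 1)) :=
    Finset.sum_congr rfl fun r hr => if_pos (Finset.mem_range.1 hr)
  rw [hif, skelCoeff_step_zero]
  simp
  ring

end

/-! ### Skeleton polynomials of a set of clusters are of binomial type. -/

section

open Polynomial

variable {ι : Type*} [DecidableEq ι]

/-- The skeleton polynomial of a set of clusters with sizes `l`. -/
def clusterPoly (K Θ : ℝ) (l : ι → ℝ) (S : Finset ι) : ℝ[X] :=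
  if S = ∅ then 1 else skelPoly K Θ (S.card - 1) (∑ j ∈ S, l j)

/-- Read on forests with `a` roots: the derivative marks a tree, whose first vertex either meets a
cluster `j`, which brings `l j` new roots, or branches with weight `Θ / 2` into two marked trees and
one additional root. -/
theorem clusterPoly_ode (K Θ : ℝ) (l : ι → ℝ) (S : Finset ι) :
    derivative (clusterPoly K Θ l S) =
      C K * (∑ j ∈ S, (clusterPoly K Θ l (S.erase j)).comp (X + C (l j)) +
        C (Θ / 2) * (derivative (derivative (clusterPoly K Θ l S))).comp (X + 1)) := by
  rcases S.eq_empty_or_nonempty with rfl | hne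
  · simp [clusterPoly]
  obtain ⟨n, hn⟩ : ∃ n, S.card = n + 1 := ⟨S.card - 1, by have := hne.card_pos; omega⟩
  refine Polynomial.funext fun a => ?_
  simp only [eval_mul, eval_C, eval_add, eval_comp, eval_X, eval_one, eval_finsetSum]
  rcases n with _ | n
  · obtain ⟨i, rfl⟩ := Finset.card_eq_one.1 (by simpa using hn)
    simp [clusterPoly, skelPoly, skelCoeff]
  · have hS : clusterPoly K Θ l S = skelPoly K Θ (n + 1) (∑ j ∈ S, l j) := by
      simp [clusterPoly, hne.ne_empty, hn]
    rw [hS, skelPoly_succ_ode]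
    congr 2
    -- Removing cluster `j` lowers the total size by exactly the shift `l j`, so the bases `a + s +
    -- r` agree for all `j`, and only the prefactors `a + l j` remain to be summed.
    have : ∀ j ∈ S, eval (a + l j) (clusterPoly K Θ l (S.erase j)) = (a + l j) *
        ∑ r ∈ Finset.range (n + 1), skelCoeff K Θ n r * (a + (∑ j ∈ S, l j) + r) ^ (n - r) := by
      intro j hj
      have hc : (S.erase j).card = n + 1 := by rw [Finset.card_erase_of_mem hj, hn]; rfl
      have hne' : S.erase j ≠ ∅ := by
        intro h; rw [h] at hc; simp at hc
      rw [clusterPoly, if_neg hne', hc, skelPoly]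
      simp only [eval_mul, eval_X, eval_finsetSum, eval_C, eval_pow, eval_add,
        Nat.add_sub_cancel]
      congr 1
      refine Finset.sum_congr rfl fun r _ => ?_
      rw [← Finset.add_sum_erase S l hj]
      ring
    rw [Finset.sum_congr rfl this, ← Finset.sum_mul, Finset.sum_add_distrib, Finset.sum_const, hn, nsmul_eq_mul]
    push_cast
    ring

theorem clusterPoly_eval_zero (K Θ : ℝ) (l : ι → ℝ) (S : Finset ι) :
    eval 0 (clusterPoly K Θ l S) = (1 : SetFun ι ℝ) S := by
  rw [SetFun.one_apply, clusterPoly]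
  split_ifs <;> simp [skelPoly]

/-- Degree count: the right side has smaller degree than `F'` unless `F'` is constant, and then `F''
= 0` forces `F' = 0`. -/
theorem eq_zero_of_derivative_eq_shift (F : ℝ[X]) (c : ℝ) (h0 : eval 0 F = 0)
    (h : derivative F = C c * (derivative (derivative F)).comp (X + 1)) : F = 0 := by
  have hd : derivative F = 0 := by
    by_contra hne
    by_cases hdeg : (derivative F).natDegree = 0
    · rw [eq_C_of_natDegree_eq_zero hdeg] at h hne
      simp at h
      exact hne (by rw [h]; simp)
    · have h1 : (derivative F).natDegree ≤ (derivative (derivative F)).natDegree := by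
        conv_lhs => rw [h]
        refine (natDegree_C_mul_le _ _).trans ?_
        rw [natDegree_comp]
        have : (X + 1 : ℝ[X]).natDegree = 1 := by simpa using natDegree_X_add_C (1 : ℝ)
        rw [this, mul_one]
      exact absurd (natDegree_derivative_lt hdeg) (not_lt.2 h1)
  have := derivative_eq_zero.1 hd
  rw [eq_C_of_natDegree_eq_zero this] at h0 ⊢
  simp at h0
  rw [h0, C_0]

/-- Binomial-type identity. Both sides agree at `0` and satisfy the equation of `clusterPoly_ode`;
by induction on `S` their source terms coincide, so the difference solves the homogeneous equation
and vanishes. -/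
theorem clusterPoly_comp_add (K Θ : ℝ) (l : ι → ℝ) (S : Finset ι) (b : ℝ) :
    (clusterPoly K Θ l S).comp (X + C b) = ∑ A ∈ S.powerset,
      clusterPoly K Θ l A * C (eval b (clusterPoly K Θ l (S \ A))) := by
  induction hn : S.card using Nat.strong_induction_on generalizing S with
  | _ n ih =>
  subst hn
  rw [← sub_eq_zero]
  set p := clusterPoly K Θ l with hp
  refine eq_zero_of_derivative_eq_shift _ (K * (Θ / 2)) ?_ ?_
  · have h : (∑ A ∈ S.powerset, (1 : SetFun ι ℝ) A * eval b (p (S \ A))) = eval b (p S) := by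
      have := SetFun.mul_apply (1 : SetFun ι ℝ) ⟨fun A => eval b (p A)⟩ S
      rw [one_mul] at this
      exact this.symm
    simp only [eval_sub, eval_comp, eval_add, eval_X, eval_C, zero_add, eval_finsetSum, eval_mul]
    simp only [hp, clusterPoly_eval_zero]
    rw [← hp, h, sub_self]
  -- Equality of the source terms: the induction hypothesis splits `S.erase j`, and `A ↦ insert j A`
  -- exchanges the choice of `j` with that of the subset.
  · have key : ∑ j ∈ S, ((p (S.erase j)).comp (X + C (l j))).comp (X + C b) =
        ∑ A ∈ S.powerset, (∑ j ∈ A, (p (A.erase j)).comp (X + C (l j))) * C (eval b (p (S \ A))) := by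
      have h1 : ∀ j ∈ S, ((p (S.erase j)).comp (X + C (l j))).comp (X + C b) =
          ∑ A ∈ S.powerset with j ∈ A, (p (A.erase j)).comp (X + C (l j)) *
            C (eval b (p (S \ A))) := by
        intro j hj
        have e1 : ((p (S.erase j)).comp (X + C (l j))).comp (X + C b) =
            ((p (S.erase j)).comp (X + C b)).comp (X + C (l j)) := by
          rw [comp_assoc, comp_assoc]
          congr 1
          simp
          ring
        rw [e1, ih _ (Finset.card_erase_lt_of_mem hj) _ rfl, Polynomial.sum_comp]
        refine Finset.sum_bij' (fun A _ => insert j A) (fun A _ => A.erase j) ?_ ?_ ?_ ?_ ?_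
        · intro A hA
          simp only [Finset.mem_powerset, Finset.mem_filter] at hA ⊢
          exact ⟨Finset.insert_subset hj (hA.trans (Finset.erase_subset _ _)),
            Finset.mem_insert_self _ _⟩
        · intro A hA
          simp only [Finset.mem_powerset, Finset.mem_filter] at hA ⊢
          exact Finset.erase_subset_erase _ hA.1
        · intro A hA
          have : j ∉ A := fun h => by simpa using Finset.mem_powerset.1 hA h
          simp [this]
        · intro A hA
          simp only [Finset.mem_powerset, Finset.mem_filter] at hA
          exact Finset.insert_erase hA.2
        · intro A hA
          have : j ∉ A := fun h => by simpa using Finset.mem_powerset.1 hA h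
          have e2 : S \ insert j A = S.erase j \ A := by
            ext x; simp; tauto
          simp [this, e2]
      rw [Finset.sum_congr rfl h1]
      simp only [Finset.sum_mul, Finset.sum_filter]
      rw [Finset.sum_comm]
      refine Finset.sum_congr rfl fun A hA => ?_
      rw [← Finset.sum_filter]
      congr 1
      ext j
      simp only [Finset.mem_filter]
      exact ⟨fun h => h.2, fun h => ⟨Finset.mem_powerset.1 hA h, h⟩⟩
    have d1 : derivative ((p S).comp (X + C b)) = (derivative (p S)).comp (X + C b) := by
      simp [derivative_comp]
    have d2 : derivative (derivative ((p S).comp (X + C b))) =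
        (derivative (derivative (p S))).comp (X + C b) := by
      rw [d1]; simp [derivative_comp]
    have d3 : derivative (∑ A ∈ S.powerset, p A * C (eval b (p (S \ A)))) =
        ∑ A ∈ S.powerset, derivative (p A) * C (eval b (p (S \ A))) := by
      simp
    have d4 : derivative (derivative (∑ A ∈ S.powerset, p A * C (eval b (p (S \ A))))) =
        ∑ A ∈ S.powerset, derivative (derivative (p A)) * C (eval b (p (S \ A))) := by
      rw [d3]; simp
    rw [derivative_sub, derivative_sub, d2, d4, d1, d3]
    have o1 : (derivative (p S)).comp (X + C b) =
        C K * (∑ j ∈ S, ((p (S.erase j)).comp (X + C (l j))).comp (X + C b) +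
        C (Θ / 2) * ((derivative (derivative (p S))).comp (X + C b)).comp (X + 1)) := by
      have h := congrArg (fun q => q.comp (X + C b)) (clusterPoly_ode K Θ l S)
      simp only [← hp] at h
      rw [h]
      simp only [mul_comp, C_comp, add_comp, Polynomial.sum_comp, comp_assoc, X_comp, one_comp]
      rw [add_right_comm X (C b) 1]
    have o2 : ∑ A ∈ S.powerset, derivative (p A) * C (eval b (p (S \ A))) =
        C K * (∑ A ∈ S.powerset,
          (∑ j ∈ A, (p (A.erase j)).comp (X + C (l j))) * C (eval b (p (S \ A))) +
        C (Θ / 2) * (∑ A ∈ S.powerset, derivative (derivative (p A)) *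
          C (eval b (p (S \ A)))).comp (X + 1)) := by
      rw [Polynomial.sum_comp, Finset.mul_sum, ← Finset.sum_add_distrib, Finset.mul_sum]
      refine Finset.sum_congr rfl fun A _ => ?_
      have h := clusterPoly_ode K Θ l A
      rw [← hp] at h
      rw [mul_comp, C_comp]
      linear_combination C (eval b (p (S \ A))) * h
    rw [sub_comp, C_mul, ← key] at *
    linear_combination o1 - o2

/-- The values at `a` of the skeleton polynomials. -/
def clusterVal (K Θ : ℝ) (l : ι → ℝ) (a : ℝ) : SetFun ι ℝ := ⟨fun S => eval a (clusterPoly K Θ l S)⟩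

/-- The logarithm of `clusterVal`: the derivatives at `0`. -/
def clusterLog (K Θ : ℝ) (l : ι → ℝ) : SetFun ι ℝ :=
  ⟨fun S => eval 0 (derivative (clusterPoly K Θ l S))⟩

theorem clusterVal_add (K Θ : ℝ) (l : ι → ℝ) (a b : ℝ) :
    clusterVal K Θ l (a + b) = clusterVal K Θ l a * clusterVal K Θ l b := by
  refine SetFun.ext_apply fun S => ?_
  have := congrArg (eval a) (clusterPoly_comp_add K Θ l S b)
  simpa [eval_comp, eval_finsetSum, SetFun.mul_apply, clusterVal] using this

theorem clusterVal_zero (K Θ : ℝ) (l : ι → ℝ) : clusterVal K Θ l 0 = 1 :=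
  SetFun.ext_apply fun S => clusterPoly_eval_zero K Θ l S

theorem clusterVal_natCast (K Θ : ℝ) (l : ι → ℝ) (n : ℕ) :
    clusterVal K Θ l n = clusterVal K Θ l 1 ^ n := by
  induction n with
  | zero => simp [clusterVal_zero]
  | succ n ih => rw [Nat.cast_succ, clusterVal_add, ih, pow_succ]

theorem derivative_clusterPoly (K Θ : ℝ) (l : ι → ℝ) (S : Finset ι) :
    derivative (clusterPoly K Θ l S) =
      ∑ A ∈ S.powerset, C (clusterLog K Θ l A) * clusterPoly K Θ l (S \ A) := by
  refine Polynomial.funext fun b => ?_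
  have := congrArg (fun q => eval 0 (derivative q)) (clusterPoly_comp_add K Θ l S b)
  simpa [derivative_comp, eval_comp, eval_finsetSum, derivative_sum, clusterLog] using this

theorem eval_iterate_derivative_clusterPoly (K Θ : ℝ) (l : ι → ℝ) (n : ℕ) (S : Finset ι) (b : ℝ) :
    eval b (derivative^[n] (clusterPoly K Θ l S)) =
      (clusterLog K Θ l ^ n * clusterVal K Θ l b) S := by
  induction n generalizing S with
  | zero => simp [clusterVal]
  | succ n ih =>
    rw [Function.iterate_succ_apply, derivative_clusterPoly, iterate_derivative_sum,
      eval_finsetSum, pow_succ', mul_assoc, SetFun.mul_apply]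
    refine Finset.sum_congr rfl fun A _ => ?_
    rw [iterate_derivative_C_mul, eval_mul, eval_C, ih]

theorem clusterLog_pow_apply (K Θ : ℝ) (l : ι → ℝ) (n : ℕ) (S : Finset ι) :
    (clusterLog K Θ l ^ n) S = n.factorial * (clusterPoly K Θ l S).coeff n := by
  have h := eval_iterate_derivative_clusterPoly K Θ l n S 0
  rw [clusterVal_zero, mul_one] at h
  rw [← h, ← coeff_zero_eq_eval_zero, coeff_iterate_derivative]
  simp [Nat.descFactorial_self]

/-- The `n`-th Taylor coefficient at `0` is the `n`-th convolution power of the logarithm divided by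
`n!`; the series at `1` is thus the convolution exponential, with finitely many nonzero terms. -/
theorem clusterVal_one_eq (K Θ : ℝ) (l : ι → ℝ) (S : Finset ι) :
    HasSum (fun n : ℕ => (n.factorial : ℝ)⁻¹ * (clusterLog K Θ l ^ n) S) (clusterVal K Θ l 1 S) := by
  have h : clusterVal K Θ l 1 S = ∑ n ∈ Finset.range ((clusterPoly K Θ l S).natDegree + 1),
      (n.factorial : ℝ)⁻¹ * (clusterLog K Θ l ^ n) S := by
    change eval 1 (clusterPoly K Θ l S) = _
    rw [eval_eq_sum_range]
    refine Finset.sum_congr rfl fun n _ => ?_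
    rw [clusterLog_pow_apply]
    have : (n.factorial : ℝ) ≠ 0 := by positivity
    field_simp
    simp
  rw [h]
  refine hasSum_sum_of_ne_finset_zero fun n hn => ?_
  rw [clusterLog_pow_apply, coeff_eq_zero_of_natDegree_lt (by simpa using hn)]
  simp

/-- The differential equation at `a = 0`, where the second derivative at `1` equals `log² ·
exp(log)`. This is the fixed-point equation of the forest count. -/
theorem clusterLog_eq (K Θ : ℝ) (l : ι → ℝ) (S : Finset ι) :
    clusterLog K Θ l S = K * (∑ j ∈ S, clusterVal K Θ l (l j) (S.erase j) +
      Θ * (2⁻¹ * (clusterLog K Θ l * clusterLog K Θ l * clusterVal K Θ l 1) S)) := by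
  have h2 := eval_iterate_derivative_clusterPoly K Θ l 2 S 1
  rw [sq] at h2
  rw [← h2]
  change eval 0 (derivative (clusterPoly K Θ l S)) = _
  rw [clusterPoly_ode]
  simp [eval_finsetSum, eval_comp, clusterVal]
  left
  ring

theorem clusterPoly_coeff_nonneg (K Θ : ℝ) (hK : 0 ≤ K) (hΘ : 0 ≤ Θ) (l : ι → ℝ)
    (hl : ∀ j, 0 ≤ l j) (S : Finset ι) (n : ℕ) : 0 ≤ (clusterPoly K Θ l S).coeff n := by
  have hmul : ∀ p q : ℝ[X], (∀ n, 0 ≤ p.coeff n) → (∀ n, 0 ≤ q.coeff n) →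
      ∀ n, 0 ≤ (p * q).coeff n := fun p q hp hq n => by
    rw [coeff_mul]
    exact Finset.sum_nonneg fun x _ => mul_nonneg (hp _) (hq _)
  have hone : ∀ n, 0 ≤ (1 : ℝ[X]).coeff n := fun n => by
    rw [coeff_one]; split_ifs <;> norm_num
  have hX : ∀ n, 0 ≤ (X : ℝ[X]).coeff n := fun n => by
    rw [coeff_X]; split_ifs <;> norm_num
  have hC : ∀ c : ℝ, 0 ≤ c → ∀ n, 0 ≤ (C c : ℝ[X]).coeff n := fun c hc n => by
    rw [coeff_C]; split_ifs <;> simp [hc]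
  have hpow : ∀ p : ℝ[X], (∀ n, 0 ≤ p.coeff n) → ∀ k n, 0 ≤ (p ^ k).coeff n := fun p hp k => by
    induction k with
    | zero => simpa using hone
    | succ k ih => rw [pow_succ]; exact hmul _ _ ih hp
  rw [clusterPoly]
  split_ifs
  · exact hone n
  · refine hmul _ _ hX (fun n => ?_) n
    rw [finsetSum_coeff]
    refine Finset.sum_nonneg fun r _ => hmul _ _ (hC _ ?_) (hpow _ (fun k => ?_) _) n
    · unfold skelCoeff; positivity
    · rw [coeff_add]
      exact add_nonneg (hX k) (hC _ (add_nonneg (Finset.sum_nonneg fun j _ => hl j)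
        (Nat.cast_nonneg r)) k)

theorem clusterLog_pow_nonneg (K Θ : ℝ) (hK : 0 ≤ K) (hΘ : 0 ≤ Θ) (l : ι → ℝ)
    (hl : ∀ j, 0 ≤ l j) (n : ℕ) (S : Finset ι) : 0 ≤ (clusterLog K Θ l ^ n) S := by
  rw [clusterLog_pow_apply]
  exact mul_nonneg (by positivity) (clusterPoly_coeff_nonneg K Θ hK hΘ l hl S n)

theorem clusterVal_nonneg (K Θ : ℝ) (hK : 0 ≤ K) (hΘ : 0 ≤ Θ) (l : ι → ℝ)
    (hl : ∀ j, 0 ≤ l j) {a : ℝ} (ha : 0 ≤ a) (S : Finset ι) : 0 ≤ clusterVal K Θ l a S := by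
  change 0 ≤ eval a _
  rw [eval_eq_sum_range]
  exact Finset.sum_nonneg fun n _ => mul_nonneg (clusterPoly_coeff_nonneg K Θ hK hΘ l hl S n)
    (pow_nonneg ha n)

end

end

section

open scoped ENNReal

/-! ### The polynomial kernel and integrated stars. -/

section Kernel

variable {d : ℕ}

theorem nuBar_pos (α : ℝ) (x : Pt d) : 0 < nuBar α x := by
  unfold nuBar; positivity

theorem nuBar_le_one (α : ℝ) (x : Pt d) : nuBar α x ≤ 1 := by
  unfold nuBar
  rw [div_le_one (by positivity)]
  have : 0 ≤ ‖x‖ ^ α := by positivity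
  linarith

theorem nuBar_zero {α : ℝ} (hα : 0 < α) : nuBar α (0 : Pt d) = 1 := by
  simp [nuBar, Real.zero_rpow hα.ne']

theorem nuBar_sub_comm (α : ℝ) (x y : Pt d) : nuBar α (x - y) = nuBar α (y - x) := by
  rw [nuBar, nuBar, norm_sub_rev]

theorem continuous_nuBar {α : ℝ} (hα : 0 < α) : Continuous (nuBar α : Pt d → ℝ) := by
  unfold nuBar
  refine continuous_const.div (continuous_const.add
    (continuous_norm.rpow_const fun x => Or.inr hα.le)) fun x => ?_
  positivity

/-- By the triangle inequality `‖c - p‖ ≤ 2 ‖y - p‖`, and doubling a distance changes the kernel by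
at most `2^α`. -/
theorem nuBar_le_of_nearer {α : ℝ} (hα : 0 < α) {y c p : Pt d} (h : ‖y - c‖ ≤ ‖y - p‖) :
    nuBar α (y - p) ≤ 2 ^ α * nuBar α (c - p) := by
  have h1 : ‖c - p‖ ≤ 2 * ‖y - p‖ := by
    have := norm_sub_le_norm_sub_add_norm_sub c y p
    rw [norm_sub_rev c y] at this
    linarith
  have h2 : ‖c - p‖ ^ α ≤ 2 ^ α * ‖y - p‖ ^ α := by
    rw [← Real.mul_rpow (by norm_num) (norm_nonneg _)]
    exact Real.rpow_le_rpow (norm_nonneg _) h1 hα.le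
  have h3 : (1 : ℝ) ≤ 2 ^ α := Real.one_le_rpow (by norm_num) hα.le
  unfold nuBar
  rw [mul_one_div, div_le_div_iff₀ (by positivity) (by positivity)]
  nlinarith

/-- Comparison with `2^α (1 + ‖x‖)^{-α}`, separately for `‖x‖ ≤ 1` and `‖x‖ ≥ 1`. -/
theorem integrable_nuBar {α : ℝ} (hα : (d : ℝ) < α) : Integrable (nuBar α : Pt d → ℝ) := by
  have hα0 : 0 < α := lt_of_le_of_lt (Nat.cast_nonneg d) hα
  have h := (integrable_one_add_norm (E := Pt d) (μ := volume) (r := α) (by simpa using hα)).const_mul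
    (2 ^ α)
  refine h.mono (continuous_nuBar hα0).aestronglyMeasurable (Eventually.of_forall fun x => ?_)
  rw [Real.norm_of_nonneg (nuBar_pos α x).le, Real.norm_of_nonneg (by positivity)]
  have hx := norm_nonneg x
  rw [Real.rpow_neg (by positivity), ← div_eq_mul_inv, nuBar,
    div_le_div_iff₀ (by positivity) (by positivity), one_mul]
  rcases le_total ‖x‖ 1 with h1 | h1
  · have : (1 + ‖x‖) ^ α ≤ 2 ^ α := Real.rpow_le_rpow (by positivity) (by linarith) hα0.le
    have : 0 ≤ ‖x‖ ^ α := by positivity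
    have : (0 : ℝ) ≤ 2 ^ α := by positivity
    nlinarith
  · have : (1 + ‖x‖) ^ α ≤ (2 * ‖x‖) ^ α := Real.rpow_le_rpow (by positivity) (by linarith) hα0.le
    rw [Real.mul_rpow (by norm_num) hx] at this
    have : (0 : ℝ) ≤ 2 ^ α := by positivity
    nlinarith

/-- The kernel with values in `ℝ≥0∞`. -/
def nb (α : ℝ) (x : Pt d) : ℝ≥0∞ := ENNReal.ofReal (nuBar α x)

theorem nb_zero {α : ℝ} (hα : 0 < α) : nb α (0 : Pt d) = 1 := by
  rw [nb, nuBar_zero hα, ENNReal.ofReal_one]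

theorem nb_sub_comm (α : ℝ) (x y : Pt d) : nb α (x - y) = nb α (y - x) := by
  rw [nb, nb, nuBar_sub_comm]

theorem measurable_nb {α : ℝ} (hα : 0 < α) : Measurable (nb α : Pt d → ℝ≥0∞) :=
  (continuous_nuBar hα).measurable.ennreal_ofReal

theorem lintegral_nb_sub (α : ℝ) (c : Pt d) : ∫⁻ y, nb α (y - c) = ∫⁻ y, nb α (y : Pt d) :=
  lintegral_sub_right_eq_self (fun y => nb α y) c

theorem nb_le_of_nearer {α : ℝ} (hα : 0 < α) {y c p : Pt d} (h : ‖y - c‖ ≤ ‖y - p‖) :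
    nb α (y - p) ≤ ENNReal.ofReal (2 ^ α) * nb α (c - p) := by
  rw [nb, nb, ← ENNReal.ofReal_mul (by positivity)]
  exact ENNReal.ofReal_le_ofReal (nuBar_le_of_nearer hα h)

theorem list_prod_le_pow_mul (A : ℝ≥0∞) (f g : Pt d → ℝ≥0∞) (ps : List (Pt d))
    (h : ∀ p ∈ ps, f p ≤ A * g p) : (ps.map f).prod ≤ A ^ ps.length * (ps.map g).prod := by
  induction ps with
  | nil => simp
  | cons a s ih =>
    simp only [List.map_cons, List.prod_cons, List.length_cons, pow_succ]
    calc f a * (s.map f).prod ≤ (A * g a) * (A ^ s.length * (s.map g).prod) :=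
          mul_le_mul' (h a (by simp)) (ih fun p hp => h p (by simp [hp]))
      _ = _ := by ring

/-- A star centred at `y` is dominated by the stars centred at its end points. -/
theorem star_le {α : ℝ} (hα : 0 < α) (y : Pt d) (ps : List (Pt d)) (hne : ps ≠ []) :
    (ps.map fun p => nb α (y - p)).prod ≤ ENNReal.ofReal (2 ^ α) ^ (ps.length - 1) *
      (ps.map fun c => nb α (y - c) * (ps.map fun p => nb α (c - p)).prod).sum := by
  classical
  -- Take the end point `c` nearest to `y`: the edge `y - c` is kept and the other `length - 1`
  -- edges are moved to `c`, each at the price `2^α`.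
  obtain ⟨c, hc, hmin⟩ := ps.toFinset.exists_min_image (fun p => ‖y - p‖)
    (by simpa using hne)
  rw [List.mem_toFinset] at hc
  have hperm := List.perm_cons_erase hc
  have hstep : (ps.map fun p => nb α (y - p)).prod ≤ ENNReal.ofReal (2 ^ α) ^ (ps.length - 1) *
      (nb α (y - c) * (ps.map fun p => nb α (c - p)).prod) := by
    rw [(hperm.map _).prod_eq, ((hperm.map (fun p => nb α (c - p)))).prod_eq]
    simp only [List.map_cons, List.prod_cons, sub_self, nb_zero hα, one_mul]
    have h := list_prod_le_pow_mul (ENNReal.ofReal (2 ^ α)) (fun p => nb α (y - p))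
      (fun p => nb α (c - p)) (ps.erase c) (fun p hp => nb_le_of_nearer hα
        (hmin p (List.mem_toFinset.2 (List.mem_of_mem_erase hp))))
    rw [List.length_erase_of_mem hc] at h
    calc _ ≤ nb α (y - c) * _ := mul_le_mul' le_rfl h
      _ = _ := by ring
  refine hstep.trans (mul_le_mul' le_rfl ?_)
  exact List.single_le_sum (fun _ _ => bot_le) _ (List.mem_map_of_mem hc)

theorem lintegral_list_sum {X β : Type*} [MeasurableSpace X] (μ : Measure X) (s : List β)
    (f : β → X → ℝ≥0∞) (hf : ∀ b ∈ s, Measurable (f b)) :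
    ∫⁻ x, (s.map fun b => f b x).sum ∂μ = (s.map fun b => ∫⁻ x, f b x ∂μ).sum := by
  induction s with
  | nil => simp
  | cons a s ih =>
    simp only [List.map_cons, List.sum_cons]
    rw [lintegral_add_left (hf a (by simp)), ih fun b hb => hf b (by simp [hb])]

/-- With `x` counted as an end point the star has `ps.length + 1` legs. After `star_le` only one
edge depends on `y` and its integral is that of the kernel. The two summands correspond to the new
centre being `x` or a point of `ps`. -/
theorem lintegral_star_le {α : ℝ} (hα : 0 < α) (x : Pt d) (ps : List (Pt d)) :
    ∫⁻ y, nb α (x - y) * (ps.map fun p => nb α (y - p)).prod ≤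
      ENNReal.ofReal (2 ^ α) ^ ps.length * (∫⁻ y, nb α (y : Pt d)) *
        ((ps.map fun p => nb α (x - p)).prod +
          (ps.map fun c => nb α (x - c) * (ps.map fun p => nb α (c - p)).prod).sum) := by
  have h : ∀ y, nb α (x - y) * (ps.map fun p => nb α (y - p)).prod ≤
      ENNReal.ofReal (2 ^ α) ^ ps.length *
        ((x :: ps).map fun c => nb α (y - c) * ((x :: ps).map fun p => nb α (c - p)).prod).sum := by
    intro y
    have := star_le hα y (x :: ps) (by simp)
    rw [nb_sub_comm α x y]
    simpa using this
  refine (lintegral_mono h).trans ?_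
  rw [lintegral_const_mul' _ _ (ENNReal.pow_ne_top ENNReal.ofReal_ne_top),
    lintegral_list_sum _ _ (fun c y => nb α (y - c) * ((x :: ps).map fun p => nb α (c - p)).prod)
      (fun c _ => ((measurable_nb hα).comp (measurable_sub_const c)).mul_const _)]
  have h2 : ∀ c : Pt d, ∫⁻ y, nb α (y - c) * ((x :: ps).map fun p => nb α (c - p)).prod =
      (∫⁻ y, nb α (y : Pt d)) * ((x :: ps).map fun p => nb α (c - p)).prod := fun c => by
    have hm : Measurable fun y : Pt d => nb α (y - c) :=
      (measurable_nb hα).comp (measurable_sub_const c)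
    rw [lintegral_mul_const _ hm, lintegral_nb_sub]
  simp only [h2]
  rw [List.sum_map_mul_left, mul_assoc]
  refine mul_le_mul' le_rfl (mul_le_mul' le_rfl ?_)
  simp only [List.map_cons, List.sum_cons, List.prod_cons, sub_self, nb_zero hα, one_mul]
  refine add_le_add le_rfl (le_of_eq ?_)
  congr 1
  refine List.map_congr_left fun c _ => ?_
  rw [nb_sub_comm]

end Kernel

/-! ### Edge lists connecting clusters. -/

section MaxLink

variable {ι : Type} [DecidableEq ι]

/-- The edges `E` link every vertex of `S` to some vertex of `J`. -/
def Links (S : Finset ι) (J : List ι) (E : List (ι × ι)) : Prop :=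
  ∀ c : Set ι, (∀ e ∈ E, e.1 ∈ c ↔ e.2 ∈ c) → (∀ j ∈ J, j ∈ c) → ∀ i ∈ S, i ∈ c

/-- The largest weight of an edge list linking `S` to `J`. -/
def maxLink (N : ι → ι → ℝ≥0∞) (S : Finset ι) (J : List ι) : ℝ≥0∞ :=
  ⨆ (E : List (ι × ι)) (_ : Links S J E), (E.map fun e => N e.1 e.2).prod

theorem le_maxLink {N : ι → ι → ℝ≥0∞} {S : Finset ι} {J : List ι} {E : List (ι × ι)}
    (h : Links S J E) : (E.map fun e => N e.1 e.2).prod ≤ maxLink N S J :=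
  le_iSup₂ (f := fun (E : List (ι × ι)) (_ : Links S J E) => (E.map fun e => N e.1 e.2).prod) E h

theorem one_le_maxLink_empty (N : ι → ι → ℝ≥0∞) : 1 ≤ maxLink N ∅ [] := by
  have : Links (∅ : Finset ι) [] [] := fun c _ _ i hi => by simp at hi
  simpa using le_maxLink (N := N) this

theorem maxLink_mul_le (N : ι → ι → ℝ≥0∞) (S₁ S₂ : Finset ι) (J₁ J₂ : List ι) :
    maxLink N S₁ J₁ * maxLink N S₂ J₂ ≤ maxLink N (S₁ ∪ S₂) (J₁ ++ J₂) := by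
  conv_lhs => rw [maxLink, maxLink]
  simp only [ENNReal.iSup_mul, ENNReal.mul_iSup]
  refine iSup₂_le fun E₂ h₂ => iSup₂_le fun E₁ h₁ => ?_
  have : Links (S₁ ∪ S₂) (J₁ ++ J₂) (E₁ ++ E₂) := by
    intro c hE hJ i hi
    rcases Finset.mem_union.1 hi with hi | hi
    · exact h₁ c (fun e he => hE e (by simp [he])) (fun j hj => hJ j (by simp [hj])) i hi
    · exact h₂ c (fun e he => hE e (by simp [he])) (fun j hj => hJ j (by simp [hj])) i hi
  simpa using le_maxLink (N := N) this

/-- Adding the edges from `j` to every element of `J` to an edge list that links `S` to `J` links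
all of `S` to `j` alone. -/
theorem maxLink_mul_star_le (N : ι → ι → ℝ≥0∞) (S : Finset ι) (J : List ι) (j : ι) :
    maxLink N S J * (J.map fun k => N j k).prod ≤ maxLink N (insert j S) [j] := by
  conv_lhs => rw [maxLink]
  simp only [ENNReal.iSup_mul]
  refine iSup₂_le fun E h => ?_
  have : Links (insert j S) [j] (E ++ J.map fun k => (j, k)) := by
    intro c hE hJ i hi
    have hj : j ∈ c := hJ j (by simp)
    rcases Finset.mem_insert.1 hi with rfl | hi
    · exact hj
    · refine h c (fun e he => hE e (by simp [he])) (fun k hk => ?_) i hi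
      exact (hE (j, k) (by simp [hk])).1 hj
  simpa [Function.comp_def] using le_maxLink (N := N) this

theorem maxLink_anti (N : ι → ι → ℝ≥0∞) {S S' : Finset ι} {J J' : List ι} (h : S' ⊆ S)
    (hJ : J ⊆ J') : maxLink N S J ≤ maxLink N S' J' :=
  iSup₂_le fun _ hE => le_maxLink fun c h1 h2 i hi => hE c h1 (fun j hj => h2 j (hJ hj)) i (h hi)

end MaxLink

/-! ### Domination by stars attached to linked clusters. -/

section TreeBound

variable {d : ℕ} {ι : Type} [DecidableEq ι] (α : ℝ) (η : ι → Config d)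

/-- The largest kernel value between two clusters. -/
def clusterKernel (j k : ι) : ℝ≥0∞ := ENNReal.ofReal (clusterMax α (η j) (η k))

variable {η} in
theorem nb_le_clusterKernel {j k : ι} {p q : Pt d} (hp : p ∈ η j) (hq : q ∈ η k) :
    nb α (p - q) ≤ clusterKernel α η j k := by
  refine ENNReal.ofReal_le_ofReal (le_csSup ⟨1, ?_⟩ ⟨p, hp, q, hq, rfl⟩)
  rintro v ⟨x, _, y, _, rfl⟩
  exact nuBar_le_one α _

/-- The elementary functions: the point `x` is joined to the points of `Q` lying in clusters, which
link all clusters of `S`. -/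
def starFun (S : Finset ι) (Q : List (ι × Pt d)) (x : Pt d) : ℝ≥0∞ :=
  maxLink (clusterKernel α η) S (Q.map Prod.fst) * (Q.map fun q => nb α (x - q.2)).prod

/-- `F` is dominated by a combination of elementary functions with total mass at most `c`. -/
def TreeBound (S : Finset ι) (c : ℝ≥0∞) (F : Pt d → ℝ≥0∞) : Prop :=
  ∃ (I : Type) (_ : Countable I) (a : I → ℝ≥0∞) (Q : I → List (ι × Pt d)),
    (∀ i, (∀ q ∈ Q i, q.2 ∈ η q.1) ∧ (Q i).length ≤ S.card) ∧ ∑' i, a i ≤ c ∧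
      ∀ x, F x ≤ ∑' i, a i * starFun α η S (Q i) x

theorem measurable_starFun (hα : 0 < α) (S : Finset ι) (Q : List (ι × Pt d)) :
    Measurable (starFun α η S Q) := by
  refine Measurable.const_mul ?_ _
  induction Q with
  | nil => simp
  | cons q Q ih =>
    simp only [List.map_cons, List.prod_cons]
    exact ((measurable_nb hα).comp (measurable_sub_const q.2)).mul ih

theorem starFun_mul_le (S₁ S₂ : Finset ι) (Q₁ Q₂ : List (ι × Pt d)) (x : Pt d) :
    starFun α η S₁ Q₁ x * starFun α η S₂ Q₂ x ≤ starFun α η (S₁ ∪ S₂) (Q₁ ++ Q₂) x := by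
  unfold starFun
  calc _ = maxLink (clusterKernel α η) S₁ (Q₁.map Prod.fst) *
        maxLink (clusterKernel α η) S₂ (Q₂.map Prod.fst) *
        ((Q₁.map fun q => nb α (x - q.2)).prod * (Q₂.map fun q => nb α (x - q.2)).prod) := by ring
    _ ≤ _ := by
      rw [List.map_append, List.map_append, List.prod_append]
      exact mul_le_mul' (maxLink_mul_le _ _ _ _ _) le_rfl

namespace TreeBound

variable {α η} {S S₁ S₂ : Finset ι} {c c₁ c₂ : ℝ≥0∞} {F F₁ F₂ : Pt d → ℝ≥0∞}

theorem of_starFun {Q : List (ι × Pt d)} (hQ : ∀ q ∈ Q, q.2 ∈ η q.1) (hl : Q.length ≤ S.card) :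
    TreeBound α η S 1 (starFun α η S Q) :=
  ⟨Unit, inferInstance, fun _ => 1, fun _ => Q, fun _ => ⟨hQ, hl⟩, by simp, fun x => by simp⟩

theorem mono (h : TreeBound α η S c₁ F₁) (hc : c₁ ≤ c₂) (hF : ∀ x, F₂ x ≤ F₁ x) :
    TreeBound α η S c₂ F₂ := by
  obtain ⟨I, hI, a, Q, hQ, ha, hb⟩ := h
  exact ⟨I, hI, a, Q, hQ, ha.trans hc, fun x => (hF x).trans (hb x)⟩

theorem tsum {κ : Type} [Countable κ] {c : κ → ℝ≥0∞} {F : κ → Pt d → ℝ≥0∞}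
    (h : ∀ k, TreeBound α η S (c k) (F k)) :
    TreeBound α η S (∑' k, c k) (fun x => ∑' k, F k x) := by
  choose I hI a Q hQ ha hb using h
  refine ⟨Σ k, I k, inferInstance, fun p => a p.1 p.2, fun p => Q p.1 p.2, fun p => hQ p.1 p.2, ?_,
    fun x => ?_⟩
  · rw [ENNReal.tsum_sigma']
    exact ENNReal.tsum_le_tsum ha
  · rw [ENNReal.tsum_sigma']
    exact ENNReal.tsum_le_tsum fun k => hb k x

theorem const_mul (h : TreeBound α η S c F) (b : ℝ≥0∞) :
    TreeBound α η S (b * c) (fun x => b * F x) := by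
  obtain ⟨I, hI, a, Q, hQ, ha, hb⟩ := h
  refine ⟨I, hI, fun i => b * a i, Q, hQ, ?_, fun x => ?_⟩
  · rw [ENNReal.tsum_mul_left]; exact mul_le_mul' le_rfl ha
  · simp only [mul_assoc]
    rw [ENNReal.tsum_mul_left]; exact mul_le_mul' le_rfl (hb x)

theorem zero : TreeBound α η S 0 (fun _ => 0) :=
  ⟨Empty, inferInstance, fun _ => 0, fun _ => [], fun i => i.elim, by simp, fun x => by simp⟩

theorem sum {κ : Type} (s : Finset κ) {c : κ → ℝ≥0∞} {F : κ → Pt d → ℝ≥0∞}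
    (h : ∀ k ∈ s, TreeBound α η S (c k) (F k)) :
    TreeBound α η S (∑ k ∈ s, c k) (fun x => ∑ k ∈ s, F k x) := by
  have := tsum (κ := s) (c := fun k => c k) (F := fun k => F k) fun k => h k k.2
  refine this.mono (le_of_eq (by simp [Finset.sum_attach])) fun x => ?_
  rw [tsum_fintype, ← Finset.sum_coe_sort]

theorem add (h₁ : TreeBound α η S c₁ F₁) (h₂ : TreeBound α η S c₂ F₂) :
    TreeBound α η S (c₁ + c₂) (fun x => F₁ x + F₂ x) := by
  have := sum (α := α) (η := η) (S := S) (Finset.univ : Finset Bool)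
    (c := fun b => cond b c₁ c₂) (F := fun b => cond b F₁ F₂) (by
      intro b _; cases b <;> simpa)
  refine this.mono (by simp) fun x => by simp

theorem list_sum {κ : Type*} (s : List κ) {c : ℝ≥0∞} {F : κ → Pt d → ℝ≥0∞}
    (h : ∀ k ∈ s, TreeBound α η S c (F k)) :
    TreeBound α η S (s.length * c) (fun x => (s.map fun k => F k x).sum) := by
  induction s with
  | nil => simpa using zero
  | cons a s ih =>
    refine ((h a (by simp)).add (ih fun k hk => h k (by simp [hk]))).mono ?_ fun x => by simp
    simp only [List.length_cons, Nat.cast_succ, add_mul, one_mul]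
    rw [add_comm]

/-- Stars with a common centre are concatenated and masses multiply. Disjointness keeps the number
of legs at most the number of clusters. -/
theorem mul (h₁ : TreeBound α η S₁ c₁ F₁) (h₂ : TreeBound α η S₂ c₂ F₂) (hd : Disjoint S₁ S₂) :
    TreeBound α η (S₁ ∪ S₂) (c₁ * c₂) (fun x => F₁ x * F₂ x) := by
  obtain ⟨I₁, hI₁, a₁, Q₁, hQ₁, ha₁, hb₁⟩ := h₁
  obtain ⟨I₂, hI₂, a₂, Q₂, hQ₂, ha₂, hb₂⟩ := h₂
  refine ⟨I₁ × I₂, inferInstance, fun p => a₁ p.1 * a₂ p.2, fun p => Q₁ p.1 ++ Q₂ p.2, ?_, ?_, ?_⟩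
  · intro p
    refine ⟨fun q hq => ?_, ?_⟩
    · rcases List.mem_append.1 hq with h | h
      · exact (hQ₁ p.1).1 q h
      · exact (hQ₂ p.2).1 q h
    · rw [List.length_append, Finset.card_union_of_disjoint hd]
      exact add_le_add (hQ₁ p.1).2 (hQ₂ p.2).2
  · rw [ENNReal.tsum_prod']
    simp only [ENNReal.tsum_mul_left, ENNReal.tsum_mul_right]
    exact mul_le_mul' ha₁ ha₂
  · intro x
    refine (mul_le_mul' (hb₁ x) (hb₂ x)).trans ?_
    rw [← ENNReal.tsum_mul_right, ENNReal.tsum_prod']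
    refine ENNReal.tsum_le_tsum fun i => ?_
    rw [← ENNReal.tsum_mul_left]
    refine ENNReal.tsum_le_tsum fun k => ?_
    calc _ = a₁ i * a₂ k * (starFun α η S₁ (Q₁ i) x * starFun α η S₂ (Q₂ k) x) := by ring
      _ ≤ _ := mul_le_mul' le_rfl (starFun_mul_le α η _ _ _ _ _)

theorem star_prod_le {j : ι} {p : Pt d} (hp : p ∈ η j) {Q : List (ι × Pt d)}
    (hQ : ∀ q ∈ Q, q.2 ∈ η q.1) :
    (Q.map fun q => nb α (p - q.2)).prod ≤
      ((Q.map Prod.fst).map fun k => clusterKernel α η j k).prod := by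
  induction Q with
  | nil => simp
  | cons q Q ih =>
    simp only [List.map_cons, List.prod_cons]
    exact mul_le_mul' (nb_le_clusterKernel α hp (hQ q (by simp))) (ih fun q hq => hQ q (by simp [hq]))

/-- When the centre lies in cluster `j`, the legs themselves are edges between clusters, so the star
closes into a link of everything to `j`. -/
theorem starFun_le {j : ι} {p : Pt d} (hp : p ∈ η j) {Q : List (ι × Pt d)}
    (hQ : ∀ q ∈ Q, q.2 ∈ η q.1) :
    starFun α η S Q p ≤ maxLink (clusterKernel α η) (insert j S) [j] :=
  (mul_le_mul' le_rfl (star_prod_le hp hQ)).trans (maxLink_mul_star_le _ _ _ _)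

theorem apply_le (h : TreeBound α η S c F) {j : ι} {p : Pt d} (hp : p ∈ η j) :
    F p ≤ c * maxLink (clusterKernel α η) (insert j S) [j] := by
  obtain ⟨I, hI, a, Q, hQ, ha, hb⟩ := h
  refine (hb p).trans ?_
  calc _ ≤ ∑' i, a i * maxLink (clusterKernel α η) (insert j S) [j] :=
        ENNReal.tsum_le_tsum fun i => mul_le_mul' le_rfl (starFun_le hp (hQ i).1)
    _ ≤ _ := by rw [ENNReal.tsum_mul_right]; exact mul_le_mul' ha le_rfl

/-- After integration the centre moves either to `x`, which leaves the same star, or to one of the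
`Q.length` end points `q`. In the second case the legs from `q` are absorbed into the links and only
the edge `x - q` remains; this one-legged star is admissible because `S` is nonempty. -/
theorem lintegral_starFun (hα : 0 < α) {Q : List (ι × Pt d)} (hQ : ∀ q ∈ Q, q.2 ∈ η q.1)
    (hl : Q.length ≤ S.card) (hS : S.Nonempty) :
    TreeBound α η S ((Q.length + 1) * (ENNReal.ofReal (2 ^ α) ^ Q.length * ∫⁻ y, nb α (y : Pt d)))
      (fun x => ∫⁻ y, nb α (x - y) * starFun α η S Q y) := by
  set b := ENNReal.ofReal (2 ^ α) ^ Q.length * ∫⁻ y, nb α (y : Pt d) with hb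
  set W := maxLink (clusterKernel α η) S (Q.map Prod.fst) with hW
  have h1 : TreeBound α η S (b * (1 + Q.length * 1)) (fun x => b * (starFun α η S Q x +
      (Q.map fun q => starFun α η S [q] x).sum)) := by
    refine ((of_starFun hQ hl).add (list_sum Q fun q hq => of_starFun ?_ ?_)).const_mul b
    · intro q' hq'
      rw [List.mem_singleton.1 hq']
      exact hQ q hq
    · simpa using hS.card_pos
  refine h1.mono (le_of_eq (by ring)) fun x => ?_
  have h2 := lintegral_star_le hα x (Q.map Prod.snd)
  rw [List.length_map, ← hb] at h2
  have hmeas : Measurable fun y => nb α (x - y) *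
      ((Q.map Prod.snd).map fun p => nb α (y - p)).prod := by
    refine ((measurable_nb hα).comp (measurable_const_sub x)).mul ?_
    generalize Q.map Prod.snd = ps
    induction ps with
    | nil => simp
    | cons q Q ih =>
      simp only [List.map_cons, List.prod_cons]
      exact ((measurable_nb hα).comp (measurable_sub_const q)).mul ih
  calc _ = ∫⁻ y, W * (nb α (x - y) * ((Q.map Prod.snd).map fun p => nb α (y - p)).prod) := by
        refine lintegral_congr fun y => ?_
        rw [starFun, ← hW, List.map_map, Function.comp_def]
        ring
    _ = W * ∫⁻ y, nb α (x - y) * ((Q.map Prod.snd).map fun p => nb α (y - p)).prod :=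
        lintegral_const_mul _ hmeas
    _ ≤ W * (b * (((Q.map Prod.snd).map fun p => nb α (x - p)).prod +
          ((Q.map Prod.snd).map fun c => nb α (x - c) *
            ((Q.map Prod.snd).map fun p => nb α (c - p)).prod).sum)) := mul_le_mul' le_rfl h2
    _ = b * (W * ((Q.map Prod.snd).map fun p => nb α (x - p)).prod +
          ((Q.map Prod.snd).map fun c => W * (nb α (x - c) *
            ((Q.map Prod.snd).map fun p => nb α (c - p)).prod)).sum) := by
        rw [List.sum_map_mul_left]; ring
    _ ≤ _ := by
        refine mul_le_mul' le_rfl (add_le_add (le_of_eq ?_) ?_)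
        · rw [starFun, ← hW, List.map_map, Function.comp_def]
        · rw [List.map_map, Function.comp_def]
          refine List.sum_le_sum fun q hq => ?_
          rw [starFun]
          simp only [List.map_cons, List.map_nil, List.prod_cons, List.prod_nil, mul_one]
          rw [List.map_map, Function.comp_def]
          calc _ = W * (Q.map fun q' => nb α (q.2 - q'.2)).prod * nb α (x - q.2) := by ring
            _ ≤ _ := mul_le_mul' (((mul_le_mul' le_rfl (star_prod_le (hQ q hq) hQ)).trans
              (maxLink_mul_star_le _ _ _ _)).trans
                (maxLink_anti _ (Finset.subset_insert _ _) (List.Subset.refl _))) le_rfl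

theorem lintegral (hα : 0 < α) (h : TreeBound α η S c F) (hS : S.Nonempty) {M : ℕ}
    (hM : S.card < M) :
    TreeBound α η S (M * (ENNReal.ofReal (2 ^ α) ^ (M - 1) * ∫⁻ y, nb α (y : Pt d)) * c)
      (fun x => ∫⁻ y, nb α (x - y) * F y) := by
  obtain ⟨I, hI, a, Q, hQ, ha, hb⟩ := h
  have h1 := tsum (α := α) (η := η) (S := S) fun i =>
    (lintegral_starFun hα (hQ i).1 (hQ i).2 hS).const_mul (a i)
  refine h1.mono ?_ fun x => ?_
  · calc _ ≤ ∑' i, a i * (M * (ENNReal.ofReal (2 ^ α) ^ (M - 1) * ∫⁻ y, nb α (y : Pt d))) := by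
          refine ENNReal.tsum_le_tsum fun i => mul_le_mul' le_rfl (mul_le_mul' ?_
            (mul_le_mul' (pow_le_pow_right₀ ?_ ?_) le_rfl))
          -- At most `|S| ≤ M - 1` legs give at most `M` resulting stars and at most `M - 1` factors
          -- `2^α`, uniformly in `i`.
          · have : (Q i).length + 1 ≤ M := by have := (hQ i).2; omega
            exact_mod_cast this
          · rw [← ENNReal.ofReal_one]
            exact ENNReal.ofReal_le_ofReal (Real.one_le_rpow (by norm_num) hα.le)
          · have := (hQ i).2; omega
      _ ≤ _ := by
          rw [ENNReal.tsum_mul_right, mul_comm]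
          exact mul_le_mul' le_rfl ha
  · calc _ ≤ ∫⁻ y, ∑' i, a i * (nb α (x - y) * starFun α η S (Q i) y) := by
          refine lintegral_mono fun y => (mul_le_mul' le_rfl (hb y)).trans (le_of_eq ?_)
          rw [← ENNReal.tsum_mul_left]
          refine tsum_congr fun i => by ring
      _ = _ := by
          have hm : ∀ i, Measurable fun y => nb α (x - y) * starFun α η S (Q i) y := fun i =>
            ((measurable_nb hα).comp (measurable_const_sub x)).mul (measurable_starFun α η hα S _)
          rw [lintegral_tsum fun i => ((hm i).const_mul _).aemeasurable]
          refine tsum_congr fun i => ?_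
          rw [lintegral_const_mul _ (hm i)]

end TreeBound

end TreeBound

end

/-! ### Locality in the number of clusters, and measurability of set functions. -/

section

open scoped ENNReal

namespace SetFun

variable {ι : Type} [DecidableEq ι]

/-- Two set functions agree on sets with fewer than `k` elements. -/
def AgreeBelow (k : ℕ) (f g : SetFun ι ℝ≥0∞) : Prop := ∀ A : Finset ι, A.card < k → f A = g A

theorem AgreeBelow.mul {k : ℕ} {f f' g g' : SetFun ι ℝ≥0∞} (hf : AgreeBelow k f f')
    (hg : AgreeBelow k g g') : AgreeBelow k (f * g) (f' * g') := fun S hS => by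
  rw [mul_apply, mul_apply]
  refine Finset.sum_congr rfl fun A hA => ?_
  rw [hf A ((Finset.card_le_card (Finset.mem_powerset.1 hA)).trans_lt hS),
    hg _ ((Finset.card_le_card Finset.sdiff_subset).trans_lt hS)]

theorem AgreeBelow.refl (k : ℕ) (f : SetFun ι ℝ≥0∞) : AgreeBelow k f f := fun _ _ => rfl

theorem AgreeBelow.pow {k : ℕ} {f f' : SetFun ι ℝ≥0∞} (hf : AgreeBelow k f f') (n : ℕ) :
    AgreeBelow k (f ^ n) (f' ^ n) := by
  induction n with
  | zero => simpa using AgreeBelow.refl k 1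
  | succ n ih => rw [pow_succ, pow_succ]; exact ih.mul hf

theorem AgreeBelow.exp {k : ℕ} {f f' : SetFun ι ℝ≥0∞} (hf : AgreeBelow k f f') :
    AgreeBelow k (SetFun.exp f) (SetFun.exp f') := fun S hS =>
  tsum_congr fun n => by rw [hf.pow n S hS]

theorem AgreeBelow.multiset_prod {X : Type*} {k : ℕ} {f f' : X → SetFun ι ℝ≥0∞}
    (hf : ∀ x, AgreeBelow k (f x) (f' x)) (s : Multiset X) :
    AgreeBelow k (s.map f).prod (s.map f').prod := by
  induction s using Multiset.induction_on with
  | empty => simpa using AgreeBelow.refl k 1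
  | cons a s ih => simpa using (hf a).mul ih

/-- The terms of order at least two of the exponential, up to the factor `1 / 2`. -/
def quad (f : SetFun ι ℝ≥0∞) : SetFun ι ℝ≥0∞ := single ∅ 2⁻¹ * (f * f * exp f)

theorem quad_apply (f : SetFun ι ℝ≥0∞) (S : Finset ι) : quad f S = 2⁻¹ * (f * f * exp f) S :=
  single_empty_mul_apply _ _ _

theorem quad_empty {f : SetFun ι ℝ≥0∞} (hf : f ∅ = 0) : quad f ∅ = 0 := by
  rw [quad_apply, mul_empty, mul_empty, hf]; simp

/-- One order is gained: both factors vanish at `∅`, so in every nonzero term of `f * f * exp f`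
each argument of `f` is a proper subset. -/
theorem AgreeBelow.quad {k : ℕ} {f g : SetFun ι ℝ≥0∞} (h : AgreeBelow k f g) (hf : f ∅ = 0)
    (hg : g ∅ = 0) : AgreeBelow (k + 1) (SetFun.quad f) (SetFun.quad g) := by
  have hff : AgreeBelow (k + 1) (f * f) (g * g) := by
    intro S hS
    rw [mul_apply, mul_apply]
    refine Finset.sum_congr rfl fun A hA => ?_
    rcases A.eq_empty_or_nonempty with rfl | hne
    · rw [hf, hg, zero_mul, zero_mul]
    · by_cases hAS : S \ A = ∅
      · rw [hAS, hf, hg, mul_zero, mul_zero]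
      · have h1 := Finset.card_sdiff_add_card_eq_card (Finset.mem_powerset.1 hA)
        have h2 := hne.card_pos
        have h3 := (Finset.nonempty_iff_ne_empty.2 hAS).card_pos
        rw [h A (by omega), h (S \ A) (by omega)]
  intro S hS
  rw [quad_apply, quad_apply, mul_apply, mul_apply]
  congr 1
  refine Finset.sum_congr rfl fun A hA => ?_
  rcases A.eq_empty_or_nonempty with rfl | hne
  · rw [mul_empty, mul_empty, hf, hg]; simp
  · have h1 := Finset.card_sdiff_add_card_eq_card (Finset.mem_powerset.1 hA)
    have h2 := hne.card_pos
    rw [hff A (by omega), h.exp (S \ A) (by omega)]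

/-- Pointwise measurability of a family of set functions. -/
def Meas {X : Type*} [MeasurableSpace X] (E : X → SetFun ι ℝ≥0∞) : Prop :=
  ∀ S, Measurable fun x => E x S

section Meas

variable {X : Type*} [MeasurableSpace X] {E E' : X → SetFun ι ℝ≥0∞}

theorem Meas.const (f : SetFun ι ℝ≥0∞) : Meas fun _ : X => f := fun _ => measurable_const

theorem Meas.mul (h : Meas E) (h' : Meas E') : Meas fun x => E x * E' x := fun S => by
  simp only [mul_apply]
  exact Finset.measurable_sum _ fun A _ => (h A).mul (h' _)

theorem Meas.pow (h : Meas E) (n : ℕ) : Meas fun x => E x ^ n := by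
  induction n with
  | zero => simpa using Meas.const 1
  | succ n ih => simp only [pow_succ]; exact ih.mul h

theorem Meas.exp (h : Meas E) : Meas fun x => SetFun.exp (E x) := fun S => by
  simp only [exp_apply]
  exact Measurable.tsum fun n => (h.pow n S).const_mul _

theorem Meas.quad (h : Meas E) : Meas fun x => SetFun.quad (E x) :=
  (Meas.const _).mul ((h.mul h).mul h.exp)

theorem Meas.comp {Y : Type*} [MeasurableSpace Y] (h : Meas E) {f : Y → X} (hf : Measurable f) :
    Meas fun y => E (f y) := fun S => (h S).comp hf

theorem Meas.prod {κ : Type*} (s : Finset κ) {F : κ → X → SetFun ι ℝ≥0∞} (h : ∀ k, Meas (F k)) :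
    Meas fun x => ∏ k ∈ s, F k x := by
  classical
  induction s using Finset.induction_on with
  | empty => simpa using Meas.const 1
  | insert a s ha ih => simp only [Finset.prod_insert ha]; exact (h a).mul ih

end Meas

end SetFun

open SetFun

/-! ### The fixed-point equation for the logarithm of the root weight. -/

section Skeleton

variable {d : ℕ} {ι : Type} [DecidableEq ι] [Fintype ι] (α : ℝ) (η : ι → Config d)
  (T K Cc : ℝ≥0∞) (κ : ι → ℝ≥0∞)

/-- The weight of a root point with logarithm `e`. -/
def rootFun (T : ℝ≥0∞) (e : SetFun ι ℝ≥0∞) : SetFun ι ℝ≥0∞ := single ∅ T * SetFun.exp e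

theorem rootFun_apply (T : ℝ≥0∞) (e : SetFun ι ℝ≥0∞) (S : Finset ι) :
    rootFun T e S = T * SetFun.exp e S := single_empty_mul_apply _ _ _

/-- The weight of a configuration of root points. -/
def confFun (T : ℝ≥0∞) (E : Pt d → SetFun ι ℝ≥0∞) (A : Config d) : SetFun ι ℝ≥0∞ :=
  (A.map fun p => rootFun T (E p)).prod

theorem confFun_add (T : ℝ≥0∞) (E : Pt d → SetFun ι ℝ≥0∞) (A A' : Config d) :
    confFun T E (A + A') = confFun T E A * confFun T E A' := by simp [confFun]

theorem confFun_sum (T : ℝ≥0∞) (E : Pt d → SetFun ι ℝ≥0∞) (J : Finset ι) :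
    confFun T E (∑ j ∈ J, η j) = ∏ j ∈ J, confFun T E (η j) := by
  induction J using Finset.induction_on with
  | empty => simp [confFun]
  | insert a s ha ih => rw [Finset.sum_insert ha, Finset.prod_insert ha, confFun_add, ih]

/-- The sum of the kernel over the points of a cluster. -/
def clusterSum (j : ι) (x : Pt d) : ℝ≥0∞ := ((η j).map fun p => nb α (x - p)).sum

/-- The part of the logarithm in which the point is joined directly to a cluster. -/
def attachFun (E : Pt d → SetFun ι ℝ≥0∞) (x : Pt d) : SetFun ι ℝ≥0∞ :=
  ∑ j, single {j} (κ j * clusterSum α η j x) * confFun T E (η j)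

/-- One step of the recursion for the logarithm of the root weight. -/
def skelStep (E : Pt d → SetFun ι ℝ≥0∞) (x : Pt d) : SetFun ι ℝ≥0∞ :=
  ⟨fun S => K * (attachFun α η T κ E x S +
    T * Cc * ∫⁻ y, nb α (x - y) * SetFun.quad (E y) S)⟩

/-- The iterates of `skelStep`. -/
def skelIter : ℕ → Pt d → SetFun ι ℝ≥0∞
  | 0 => fun _ => 0
  | n + 1 => skelStep α η T K Cc κ (skelIter n)

/-- The logarithm of the root weight. -/
def skelLog : Pt d → SetFun ι ℝ≥0∞ := skelIter α η T K Cc κ (Fintype.card ι + 1)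

theorem attachFun_apply (E : Pt d → SetFun ι ℝ≥0∞) (x : Pt d) (S : Finset ι) :
    attachFun α η T κ E x S = ∑ j, if {j} ⊆ S then κ j * clusterSum α η j x *
      confFun T E (η j) (S \ {j}) else 0 := by
  rw [attachFun, SetFun.sum_apply]
  exact Finset.sum_congr rfl fun j _ => single_mul_apply _ _ _ _

theorem skelStep_empty {E : Pt d → SetFun ι ℝ≥0∞} (hE : ∀ x, E x ∅ = 0) (x : Pt d) :
    skelStep α η T K Cc κ E x ∅ = 0 := by
  change K * (attachFun α η T κ E x ∅ + T * Cc * ∫⁻ y, nb α (x - y) * SetFun.quad (E y) ∅) = 0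
  rw [attachFun_apply]
  simp [quad_empty (hE _)]

theorem skelIter_empty (n : ℕ) (x : Pt d) : skelIter α η T K Cc κ n x ∅ = 0 := by
  induction n generalizing x with
  | zero => rfl
  | succ n ih => exact skelStep_empty _ _ _ _ _ _ ih x

/-- Attaching to a cluster uses up that cluster, and branching gains one order by `AgreeBelow.quad`.
The right side at `S` thus only sees smaller sets. -/
theorem skelStep_agreeBelow {k : ℕ} {E E' : Pt d → SetFun ι ℝ≥0∞}
    (h : ∀ x, AgreeBelow k (E x) (E' x)) (hE : ∀ x, E x ∅ = 0) (hE' : ∀ x, E' x ∅ = 0) (x : Pt d) :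
    AgreeBelow (k + 1) (skelStep α η T K Cc κ E x) (skelStep α η T K Cc κ E' x) := by
  intro S hS
  change K * (attachFun α η T κ E x S + T * Cc * ∫⁻ y, nb α (x - y) * SetFun.quad (E y) S) =
    K * (attachFun α η T κ E' x S + T * Cc * ∫⁻ y, nb α (x - y) * SetFun.quad (E' y) S)
  congr 2
  · rw [attachFun_apply, attachFun_apply]
    refine Finset.sum_congr rfl fun j _ => ?_
    split_ifs with hj
    · congr 1
      refine AgreeBelow.multiset_prod (fun p => (AgreeBelow.refl k _).mul (h p).exp) _ _ ?_
      have h1 := Finset.card_sdiff_add_card_eq_card hj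
      simp only [Finset.card_singleton] at h1
      omega
    · rfl
  · congr 1
    refine lintegral_congr fun y => ?_
    rw [(h y).quad (hE y) (hE' y) S hS]

theorem skelIter_agreeBelow (n : ℕ) (x : Pt d) :
    AgreeBelow n (skelIter α η T K Cc κ n x) (skelIter α η T K Cc κ (n + 1) x) := by
  induction n generalizing x with
  | zero => intro S hS; omega
  | succ n ih =>
    exact skelStep_agreeBelow _ _ _ _ _ _ ih (skelIter_empty _ _ _ _ _ _ _)
      (skelIter_empty _ _ _ _ _ _ _) x

/-- The iterates are stationary on sets with fewer elements than the iteration number, and no set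
has more than `Fintype.card ι` elements. Hence the iterate is an exact fixed point. -/
theorem skelLog_eq (x : Pt d) (S : Finset ι) : skelLog α η T K Cc κ x S =
    K * (attachFun α η T κ (skelLog α η T K Cc κ) x S +
      T * Cc * ∫⁻ y, nb α (x - y) * SetFun.quad (skelLog α η T K Cc κ y) S) :=
  skelIter_agreeBelow α η T K Cc κ (Fintype.card ι + 1) x S
    (Nat.lt_succ_of_le (Finset.card_le_univ S))

variable {α} in
theorem measurable_clusterSum (hα : 0 < α) (j : ι) : Measurable (clusterSum α η j) := by
  have : ∀ s : Multiset (Pt d), Measurable fun x => (s.map fun p => nb α (x - p)).sum := by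
    intro s
    induction s using Multiset.induction_on with
    | empty => simp
    | cons a s ih =>
      simp only [Multiset.map_cons, Multiset.sum_cons]
      exact ((measurable_nb hα).comp (measurable_sub_const a)).add ih
  exact this _

variable {α} in
theorem meas_skelIter (hα : 0 < α) (n : ℕ) : Meas (skelIter α η T K Cc κ n) := by
  induction n with
  | zero => exact Meas.const 0
  | succ n ih =>
    intro S
    refine Measurable.const_mul (Measurable.add ?_ (Measurable.const_mul ?_ _)) _
    · simp only [attachFun_apply]
      refine Finset.measurable_sum _ fun j _ => ?_
      split_ifs
      · exact ((measurable_clusterSum η hα j).const_mul _).mul_const _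
      · exact measurable_const
    · refine Measurable.lintegral_prod_right' (f := fun p : Pt d × Pt d =>
        nb α (p.1 - p.2) * SetFun.quad (skelIter α η T K Cc κ n p.2) S) ?_
      exact ((measurable_nb hα).comp (measurable_fst.sub measurable_snd)).mul
        ((ih.quad S).comp measurable_snd)

variable {α} in
theorem meas_skelLog (hα : 0 < α) : Meas (skelLog α η T K Cc κ) := meas_skelIter _ _ _ _ _ hα _

/-- Convolution with the kernel multiplies `F` by at most the factor `b`. -/
def SlowDecay (α : ℝ) (b : ℝ≥0∞) (F : Pt d → ℝ≥0∞) : Prop :=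
  Measurable F ∧ ∀ x, ∫⁻ y, nb α (x - y) * F y ≤ b * F x

namespace SlowDecay

variable {α} {b : ℝ≥0∞} {F F' : Pt d → ℝ≥0∞}

theorem add (hα : 0 < α) (h : SlowDecay α b F) (h' : SlowDecay α b F') :
    SlowDecay α b fun x => F x + F' x := by
  refine ⟨h.1.add h'.1, fun x => ?_⟩
  have hm : Measurable fun y => nb α (x - y) * F y :=
    ((measurable_nb hα).comp (measurable_const_sub x)).mul h.1
  simp only [mul_add]
  rw [lintegral_add_left hm]
  exact add_le_add (h.2 x) (h'.2 x)

theorem const_mul (hα : 0 < α) (h : SlowDecay α b F) (c : ℝ≥0∞) :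
    SlowDecay α b fun x => c * F x := by
  refine ⟨h.1.const_mul c, fun x => ?_⟩
  have hm : Measurable fun y => nb α (x - y) * F y :=
    ((measurable_nb hα).comp (measurable_const_sub x)).mul h.1
  calc _ = ∫⁻ y, c * (nb α (x - y) * F y) := lintegral_congr fun y => by ring
    _ = c * ∫⁻ y, nb α (x - y) * F y := lintegral_const_mul _ hm
    _ ≤ c * (b * F x) := mul_le_mul' le_rfl (h.2 x)
    _ = _ := by ring

theorem zero : SlowDecay α b fun _ : Pt d => 0 := ⟨measurable_const, fun x => by simp⟩

theorem sum (hα : 0 < α) {κ : Type*} (s : Finset κ) {F : κ → Pt d → ℝ≥0∞}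
    (h : ∀ k ∈ s, SlowDecay α b (F k)) : SlowDecay α b fun x => ∑ k ∈ s, F k x := by
  classical
  induction s using Finset.induction_on with
  | empty => simpa using zero
  | insert a s ha ih =>
    simp only [Finset.sum_insert ha]
    exact (h a (by simp)).add hα (ih fun k hk => h k (by simp [hk]))

/-- The case of a one-legged star in `lintegral_star_le`; both resulting stars equal `nb α (x - p)`,
whence the factor `2`. -/
theorem nb_sub (hα : 0 < α) (p : Pt d) :
    SlowDecay α (2 * (ENNReal.ofReal (2 ^ α) * ∫⁻ y, nb α (y : Pt d))) fun x => nb α (x - p) := by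
  refine ⟨(measurable_nb hα).comp (measurable_sub_const p), fun x => ?_⟩
  have h := lintegral_star_le hα x [p]
  simp only [List.map_cons, List.map_nil, List.prod_cons, List.prod_nil, mul_one, List.sum_cons,
    List.sum_nil, add_zero, sub_self, nb_zero hα, List.length_cons, List.length_nil, zero_add,
    pow_one] at h
  refine h.trans (le_of_eq ?_)
  ring

theorem multiset_sum (hα : 0 < α) (s : Multiset (Pt d)) :
    SlowDecay α (2 * (ENNReal.ofReal (2 ^ α) * ∫⁻ y, nb α (y : Pt d)))
      fun x => (s.map fun p => nb α (x - p)).sum := by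
  induction s using Multiset.induction_on with
  | empty => simpa using zero
  | cons a s ih =>
    simp only [Multiset.map_cons, Multiset.sum_cons]
    exact (nb_sub hα a).add hα ih

/-- A superposition of the functions `nb α (· - p)`; Tonelli reduces to `nb_sub`. -/
theorem conv (hα : 0 < α) {q : Pt d → ℝ≥0∞} (hq : Measurable q) :
    SlowDecay α (2 * (ENNReal.ofReal (2 ^ α) * ∫⁻ y, nb α (y : Pt d)))
      fun x => ∫⁻ y, nb α (x - y) * q y := by
  have hm : Measurable fun p : Pt d × Pt d => nb α (p.1 - p.2) * q p.2 :=
    ((measurable_nb hα).comp (measurable_fst.sub measurable_snd)).mul (hq.comp measurable_snd)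
  refine ⟨hm.lintegral_prod_right', fun x => ?_⟩
  have hsub := fun p => (nb_sub hα p).2 x
  generalize 2 * (ENNReal.ofReal (2 ^ α) * ∫⁻ y, nb α (y : Pt d)) = b at hsub ⊢
  have hx : Measurable fun y : Pt d => nb α (x - y) :=
    (measurable_nb hα).comp (measurable_const_sub x)
  have hy : ∀ y : Pt d, Measurable fun y' => nb α (y - y') * q y' := fun y =>
    ((measurable_nb hα).comp (measurable_const_sub y)).mul hq
  have h2 : Measurable fun p : Pt d × Pt d => nb α (x - p.1) * (nb α (p.1 - p.2) * q p.2) :=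
    (hx.comp measurable_fst).mul hm
  have e1 : ∫⁻ y, nb α (x - y) * ∫⁻ y', nb α (y - y') * q y'
      = ∫⁻ y, ∫⁻ y', nb α (x - y) * (nb α (y - y') * q y') :=
    lintegral_congr fun y => (lintegral_const_mul _ (hy y)).symm
  rw [e1, lintegral_lintegral_swap h2.aemeasurable, ← lintegral_const_mul _ (hy x)]
  refine lintegral_mono fun y' => ?_
  have hm' : Measurable fun y : Pt d => nb α (x - y) * nb α (y - y') :=
    hx.mul ((measurable_nb hα).comp (measurable_sub_const y'))
  have e2 : ∫⁻ y, nb α (x - y) * (nb α (y - y') * q y') =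
      (∫⁻ y, nb α (x - y) * nb α (y - y')) * q y' := by
    rw [← lintegral_mul_const _ hm']
    exact lintegral_congr fun y => (mul_assoc _ _ _).symm
  rw [e2, ← mul_assoc]
  exact mul_le_mul' (hsub y') le_rfl

end SlowDecay

variable {α} in
-- By the fixed-point equation the logarithm is a superposition of translated kernels: sums over
-- cluster points for the attached part, a convolution for the branching part.
theorem slowDecay_skelLog (hα : 0 < α) (S : Finset ι) :
    SlowDecay α (2 * (ENNReal.ofReal (2 ^ α) * ∫⁻ y, nb α (y : Pt d)))
      (fun x => skelLog α η T K Cc κ x S) := by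
  have h : (fun x => skelLog α η T K Cc κ x S) = fun x =>
      K * (attachFun α η T κ (skelLog α η T K Cc κ) x S +
      T * Cc * ∫⁻ y, nb α (x - y) * SetFun.quad (skelLog α η T K Cc κ y) S) :=
    funext fun x => skelLog_eq α η T K Cc κ x S
  rw [h]
  refine SlowDecay.const_mul hα (SlowDecay.add hα ?_ (SlowDecay.const_mul hα
    (SlowDecay.conv hα ((meas_skelLog η T K Cc κ hα).quad S)) _)) _
  simp only [attachFun_apply]
  refine SlowDecay.sum hα _ fun j _ => ?_
  split_ifs
  · have := (SlowDecay.multiset_sum hα (η j)).const_mul hα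
      (κ j * confFun T (skelLog α η T K Cc κ) (η j) (S \ {j}))
    refine (congrArg _ (funext fun x => ?_)).mp this
    rw [clusterSum]
    ring
  · exact SlowDecay.zero

end Skeleton

end

section

open scoped ENNReal
open SetFun

/-! ### A supersolution of the truncated Kirkwood-Salsburg inequality. -/

section Supersolution

variable {d : ℕ} {ι : Type} [DecidableEq ι] [Fintype ι]

/-- The integral of a nonnegative function against the Lebesgue-Poisson measure of unit activity. -/
def lpLint (F : Config d → ℝ≥0∞) : ℝ≥0∞ :=
  ∑' k : ℕ, (k.factorial : ℝ≥0∞)⁻¹ *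
    ∫⁻ y : Fin k → Pt d, F ((List.ofFn y : List (Pt d)) : Multiset (Pt d))

/-- The average of the root weight over a point linked to `x`. -/
def pairFun (fh : Pt d → ℝ≥0∞) (T : ℝ≥0∞) (E : Pt d → SetFun ι ℝ≥0∞) (x : Pt d) : SetFun ι ℝ≥0∞ :=
  ⟨fun S => ∫⁻ y, fh (x - y) * rootFun T (E y) S⟩

theorem meas_rootFun (T : ℝ≥0∞) {E : Pt d → SetFun ι ℝ≥0∞} (hE : Meas E) :
    Meas fun x => rootFun T (E x) := (Meas.const _).mul hE.exp

/-- The exponential in `pairFun` is split by order. Order `0` gives the constant `T ∫ fh`; order `1`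
is at most `T Cc b` times the logarithm by slow decay; the rest is the branching term. Since the
logarithm is `K` times (attached + branching), all of it fits when `1 + T Cc b K ≤ K`. -/
theorem attachFun_add_pairFun_le {α : ℝ} (hα : 0 < α) (η : ι → Config d) (T K Cc : ℝ≥0∞)
    (κ : ι → ℝ≥0∞) {fh : Pt d → ℝ≥0∞} (hfm : Measurable fh) (hfh : ∀ x, fh x ≤ Cc * nb α x)
    (hK : 1 + T * Cc * (2 * (ENNReal.ofReal (2 ^ α) * ∫⁻ y, nb α (y : Pt d))) * K ≤ K) (x : Pt d) :
    attachFun α η T κ (skelLog α η T K Cc κ) x + pairFun fh T (skelLog α η T K Cc κ) x ≤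
      single ∅ (T * ∫⁻ y, fh y) + skelLog α η T K Cc κ x := by
  intro S
  have hEm := meas_skelLog η T K Cc κ hα
  have hslow := (slowDecay_skelLog η T K Cc κ hα S).2 x
  have heq := skelLog_eq α η T K Cc κ x S
  generalize 2 * (ENNReal.ofReal (2 ^ α) * ∫⁻ y, nb α (y : Pt d)) = b at hK hslow
  set E := skelLog α η T K Cc κ with hE
  set L := attachFun α η T κ E x S with hL
  set I := ∫⁻ y, nb α (x - y) * SetFun.quad (E y) S with hI
  have hfx : Measurable fun y => fh (x - y) := hfm.comp (measurable_const_sub x)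
  have hnx : Measurable fun y => nb α (x - y) := (measurable_nb hα).comp (measurable_const_sub x)
  -- The constant term keeps `fh`, whose integral is the sharper `ν₁`; only the other terms use the
  -- polynomial bound.
  have h1 : pairFun fh T E x S ≤ T * (1 : SetFun ι ℝ≥0∞) S * (∫⁻ y, fh y) +
      (T * Cc * ∫⁻ y, nb α (x - y) * E y S) + T * Cc * I := by
    calc pairFun fh T E x S
        ≤ ∫⁻ y, (T * (1 : SetFun ι ℝ≥0∞) S * fh (x - y) + T * Cc * (nb α (x - y) * E y S)) +
            T * Cc * (nb α (x - y) * SetFun.quad (E y) S) := by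
          refine lintegral_mono fun y => ?_
          change fh (x - y) * rootFun T (E y) S ≤ _
          rw [rootFun_apply]
          have hexp := exp_le_add_half (E y) S
          rw [← quad_apply] at hexp
          calc fh (x - y) * (T * SetFun.exp (E y) S)
              ≤ fh (x - y) * (T * ((1 : SetFun ι ℝ≥0∞) S + E y S + SetFun.quad (E y) S)) :=
                mul_le_mul' le_rfl (mul_le_mul' le_rfl hexp)
            _ = T * (1 : SetFun ι ℝ≥0∞) S * fh (x - y) + T * fh (x - y) * E y S +
                  T * fh (x - y) * SetFun.quad (E y) S := by ring
            _ ≤ T * (1 : SetFun ι ℝ≥0∞) S * fh (x - y) + T * (Cc * nb α (x - y)) * E y S +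
                  T * (Cc * nb α (x - y)) * SetFun.quad (E y) S := by
                gcongr <;> exact hfh _
            _ = _ := by ring
      _ = _ := by
          have m1 : Measurable fun y => nb α (x - y) * E y S := hnx.mul (hEm S)
          have m2 : Measurable fun y => nb α (x - y) * SetFun.quad (E y) S := hnx.mul (hEm.quad S)
          rw [lintegral_add_left, lintegral_add_left, lintegral_const_mul _ hfx,
            lintegral_const_mul _ m1, lintegral_const_mul _ m2,
            lintegral_sub_left_eq_self (fun y => fh y) x]
          · exact hfx.const_mul _
          · exact (hfx.const_mul _).add ((hnx.mul (hEm S)).const_mul _)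
  have h2 : T * (1 : SetFun ι ℝ≥0∞) S * (∫⁻ y, fh y) =
      (single ∅ (T * ∫⁻ y, fh y) : SetFun ι ℝ≥0∞) S := by
    rw [one_apply, single_apply]; split_ifs <;> simp
  change L + pairFun fh T E x S ≤ (single ∅ (T * ∫⁻ y, fh y) : SetFun ι ℝ≥0∞) S + E x S
  calc L + pairFun fh T E x S
      ≤ L + (T * (1 : SetFun ι ℝ≥0∞) S * (∫⁻ y, fh y) + (T * Cc * (b * (K * (L + T * Cc * I)))) +
          T * Cc * I) := by
        refine add_le_add le_rfl (h1.trans ?_)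
        rw [← heq]
        gcongr
    _ = (single ∅ (T * ∫⁻ y, fh y) : SetFun ι ℝ≥0∞) S +
          (1 + T * Cc * b * K) * (L + T * Cc * I) := by rw [h2]; ring
    _ ≤ _ := by
        rw [heq]
        gcongr

/-- Tonelli in the first coordinate; each integration produces one convolution factor `pairFun`. -/
theorem lintegral_prod_rootFun {fh : Pt d → ℝ≥0∞} (hfm : Measurable fh) (T : ℝ≥0∞)
    {E : Pt d → SetFun ι ℝ≥0∞} (hE : Meas E) (x : Pt d) (F : SetFun ι ℝ≥0∞) (k : ℕ)
    (S : Finset ι) :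
    ∫⁻ y : Fin k → Pt d, (∏ i, fh (x - y i)) * ((∏ i, rootFun T (E (y i))) * F) S =
      (pairFun fh T E x ^ k * F) S := by
  have hG := meas_rootFun T hE
  induction k generalizing S with
  | zero => simp [volume_pi]
  | succ k ih =>
    have hfx : Measurable fun y => fh (x - y) := hfm.comp (measurable_const_sub x)
    have hm : ∀ S, Measurable fun y : Fin k → Pt d =>
        (∏ i, fh (x - y i)) * ((∏ i, rootFun T (E (y i))) * F) S := fun S =>
      (Finset.measurable_prod _ fun i _ => hfx.comp (measurable_pi_apply i)).mul
        (((Meas.prod Finset.univ fun i => hG.comp (measurable_pi_apply i)).mul (Meas.const F)) S)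
    set g : Pt d × (Fin k → Pt d) → ℝ≥0∞ := fun p => ∑ A ∈ S.powerset,
      (fh (x - p.1) * rootFun T (E p.1) A) *
        ((∏ i, fh (x - p.2 i)) * ((∏ i, rootFun T (E (p.2 i))) * F) (S \ A)) with hg
    have hgm : Measurable g := by
      refine Finset.measurable_sum _ fun A _ => ?_
      exact ((hfx.mul (hG A)).comp measurable_fst).mul ((hm _).comp measurable_snd)
    have hmp := volume_preserving_piFinSuccAbove (fun _ : Fin (k + 1) => Pt d) 0
    have h1 : ∀ y : Fin (k + 1) → Pt d,
        (∏ i, fh (x - y i)) * ((∏ i, rootFun T (E (y i))) * F) S =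
          g (MeasurableEquiv.piFinSuccAbove (fun _ => Pt d) 0 y) := by
      intro y
      rw [Fin.prod_univ_succ, Fin.prod_univ_succ, mul_assoc (rootFun T (E (y 0))), mul_apply,
        Finset.mul_sum, hg]
      refine Finset.sum_congr rfl fun A _ => ?_
      simp only [MeasurableEquiv.piFinSuccAbove_apply, Fin.insertNthEquiv_symm_apply,
        Fin.removeNth, Fin.zero_succAbove]
      ring
    calc _ = ∫⁻ y, g (MeasurableEquiv.piFinSuccAbove (fun _ => Pt d) 0 y) := lintegral_congr h1
      _ = ∫⁻ p, g p := hmp.lintegral_comp hgm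
      _ = ∫⁻ y₀, ∫⁻ y, g (y₀, y) := by
          rw [Measure.volume_eq_prod, lintegral_prod _ hgm.aemeasurable]
      _ = ∫⁻ y₀, ∑ A ∈ S.powerset, (fh (x - y₀) * rootFun T (E y₀) A) *
            (pairFun fh T E x ^ k * F) (S \ A) := by
          refine lintegral_congr fun y₀ => ?_
          rw [hg]
          simp only
          rw [lintegral_finsetSum _ fun A _ => (hm _).const_mul _]
          refine Finset.sum_congr rfl fun A _ => ?_
          rw [lintegral_const_mul _ (hm _), ih]
      _ = _ := by
          have m1 : ∀ A, Measurable fun y => fh (x - y) * rootFun T (E y) A := fun A =>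
            hfx.mul (hG A)
          rw [lintegral_finsetSum _ fun A _ => (m1 A).mul_const _, pow_succ', mul_assoc,
            mul_apply]
          refine Finset.sum_congr rfl fun A _ => ?_
          rw [lintegral_mul_const _ (m1 A)]
          rfl

theorem confFun_ofFn (T : ℝ≥0∞) (E : Pt d → SetFun ι ℝ≥0∞) {k : ℕ} (y : Fin k → Pt d) :
    confFun T E ((List.ofFn y : List (Pt d)) : Multiset (Pt d)) = ∏ i, rootFun T (E (y i)) := by
  rw [confFun, Multiset.map_coe, Multiset.prod_coe, List.map_ofFn, List.prod_ofFn]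
  rfl

/-- Exponential formula: the root weight is multiplicative over points, so the Lebesgue-Poisson
series is the exponential of the one-point integral. -/
theorem lpLint_confFun {fh : Pt d → ℝ≥0∞} (hfm : Measurable fh) (T : ℝ≥0∞)
    {E : Pt d → SetFun ι ℝ≥0∞} (hE : Meas E) (x : Pt d) (B : Config d) (S : Finset ι) :
    lpLint (fun ξ => (ξ.map fun y => fh (x - y)).prod * confFun T E (ξ + B) S) =
      (SetFun.exp (pairFun fh T E x) * confFun T E B) S := by
  have h : ∀ k : ℕ, (k.factorial : ℝ≥0∞)⁻¹ * ∫⁻ y : Fin k → Pt d,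
      ((((List.ofFn y : List (Pt d)) : Multiset (Pt d)).map fun y => fh (x - y)).prod *
        confFun T E (((List.ofFn y : List (Pt d)) : Multiset (Pt d)) + B) S) =
      ∑ A ∈ S.powerset, (k.factorial : ℝ≥0∞)⁻¹ * (pairFun fh T E x ^ k) A *
        confFun T E B (S \ A) := by
    intro k
    simp only [mul_assoc]
    rw [← Finset.mul_sum, ← mul_apply, ← lintegral_prod_rootFun hfm T hE x _ k S]
    congr 1
    refine lintegral_congr fun y => ?_
    rw [confFun_add, confFun_ofFn, Multiset.map_coe, Multiset.prod_coe, List.map_ofFn,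
      List.prod_ofFn]
    rfl
  rw [lpLint, tsum_congr h, Summable.tsum_finsetSum (fun _ _ => ENNReal.summable), mul_apply]
  refine Finset.sum_congr rfl fun A _ => ?_
  rw [ENNReal.tsum_mul_right, exp_apply]

/-- The sum over `J` is the expansion of `∏ (1 + link to cluster j)`, bounded by the exponential of
`attachFun`; the integral over `ξ` is the exponential of `pairFun`. By `attachFun_add_pairFun_le`
their product is at most `e^c exp(E x)`, and `h e^c ≤ T` turns this into the root weight of `x`. -/
theorem confFun_supersolution {α : ℝ} (hα : 0 < α) (η : ι → Config d) (T K Cc h : ℝ≥0∞)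
    (κ : ι → ℝ≥0∞) {fh : Pt d → ℝ≥0∞} (hfm : Measurable fh) (hfh : ∀ x, fh x ≤ Cc * nb α x)
    (hK : 1 + T * Cc * (2 * (ENNReal.ofReal (2 ^ α) * ∫⁻ y, nb α (y : Pt d))) * K ≤ K)
    {c : ℝ} (hc : 0 ≤ c) (hTc : T * ∫⁻ y, fh y = ENNReal.ofReal c)
    (hT : h * ENNReal.ofReal (Real.exp c) ≤ T) (x : Pt d) (kt : ι → ℝ≥0∞)
    (hkt : ∀ j, kt j ≤ κ j * clusterSum α η j x) (A : Config d) (L : Finset ι) :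
    h * ∑ J ∈ L.powerset, (∏ j ∈ J, kt j) * lpLint (fun ξ => (ξ.map fun y => fh (x - y)).prod *
        confFun T (skelLog α η T K Cc κ) (ξ + (A + ∑ j ∈ J, η j)) (L \ J)) ≤
      confFun T (skelLog α η T K Cc κ) (x ::ₘ A) L := by
  have hEm := meas_skelLog η T K Cc κ hα
  have hmain := attachFun_add_pairFun_le hα η T K Cc κ hfm hfh hK x
  set E := skelLog α η T K Cc κ with hE
  set H := pairFun fh T E x with hH
  have h1 : ∑ J ∈ L.powerset, (∏ j ∈ J, kt j) * lpLint (fun ξ =>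
      (ξ.map fun y => fh (x - y)).prod * confFun T E (ξ + (A + ∑ j ∈ J, η j)) (L \ J)) =
      ((∏ j, (1 + single {j} (kt j) * confFun T E (η j))) * SetFun.exp H * confFun T E A) L := by
    rw [Finset.prod_one_add, Finset.sum_mul, Finset.sum_mul, SetFun.sum_apply]
    have hsub : L.powerset ⊆ (Finset.univ : Finset ι).powerset :=
      Finset.powerset_mono.2 (Finset.subset_univ L)
    refine Eq.trans ?_ (Finset.sum_subset hsub ?_)
    · refine Finset.sum_congr rfl fun J hJ => ?_
      rw [lpLint_confFun hfm T hEm, Finset.prod_mul_distrib, prod_single, mul_assoc, mul_assoc,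
        single_mul_apply, if_pos (Finset.mem_powerset.1 hJ), confFun_add, confFun_sum]
      congr 2
      ring
    · intro J _ hJ
      rw [Finset.prod_mul_distrib, prod_single, mul_assoc, mul_assoc, single_mul_apply,
        if_neg (by simpa using hJ)]
  have h2 : (∏ j, (1 + single {j} (kt j) * confFun T E (η j)) : SetFun ι ℝ≥0∞) ≤
      SetFun.exp (attachFun α η T κ E x) := by
    rw [attachFun, exp_sum]
    refine prod_mono _ fun j _ => (one_add_le_exp _).trans' ?_
    intro S
    rw [SetFun.add_apply, SetFun.add_apply]
    refine add_le_add le_rfl (mul_mono (fun S => ?_) le_rfl S)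
    rw [single_apply, single_apply]
    split_ifs
    · exact hkt j
    · exact le_rfl
  rw [h1]
  have h3 : ((∏ j, (1 + single {j} (kt j) * confFun T E (η j))) * SetFun.exp H : SetFun ι ℝ≥0∞) ≤
      single ∅ (ENNReal.ofReal (Real.exp c)) * SetFun.exp (E x) := by
    refine (mul_mono h2 le_rfl).trans ?_
    rw [← exp_add, ← exp_single_empty c hc, ← exp_add, ← hTc]
    exact exp_mono hmain
  refine (mul_le_mul' le_rfl (mul_mono h3 le_rfl L)).trans ?_
  rw [mul_assoc, single_empty_mul_apply, ← mul_assoc]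
  refine (mul_le_mul' hT le_rfl).trans (le_of_eq ?_)
  rw [← single_empty_mul_apply, ← mul_assoc, confFun, confFun, Multiset.map_cons,
    Multiset.prod_cons]
  rfl

end Supersolution

/-! ### Total masses of the tree bounds. -/

section Count

variable {d : ℕ} {ι : Type} [DecidableEq ι] [Fintype ι] {α : ℝ} {η : ι → Config d}

/-- Tree bounds for all small sets. -/
def TreeBounds (α : ℝ) (η : ι → Config d) (M : ℕ) (c : SetFun ι ℝ≥0∞)
    (E : Pt d → SetFun ι ℝ≥0∞) : Prop :=
  ∀ S : Finset ι, S.card < M → TreeBound α η S (c S) fun x => E x S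

namespace TreeBounds

variable {M : ℕ} {c c' : SetFun ι ℝ≥0∞} {E E' : Pt d → SetFun ι ℝ≥0∞}

theorem mul (h : TreeBounds α η M c E) (h' : TreeBounds α η M c' E') :
    TreeBounds α η M (c * c') fun x => E x * E' x := by
  intro S hS
  have : TreeBound α η S (∑ A ∈ S.powerset, c A * c' (S \ A))
      (fun x => ∑ A ∈ S.powerset, E x A * E' x (S \ A)) := by
    refine TreeBound.sum _ fun A hA => ?_
    have hA' := Finset.mem_powerset.1 hA
    have := (h A ((Finset.card_le_card hA').trans_lt hS)).mul
      (h' (S \ A) ((Finset.card_le_card Finset.sdiff_subset).trans_lt hS)) Finset.disjoint_sdiff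
    rwa [Finset.union_sdiff_of_subset hA'] at this
  exact this

theorem one : TreeBounds α η M 1 fun _ => 1 := by
  intro S _
  rcases S.eq_empty_or_nonempty with rfl | hne
  · refine (TreeBound.of_starFun (Q := []) (by simp) (by simp)).mono (by simp [one_apply])
      fun x => ?_
    simpa [starFun, one_apply] using one_le_maxLink_empty (clusterKernel α η)
  · simpa [one_apply, hne.ne_empty] using TreeBound.zero

theorem pow (h : TreeBounds α η M c E) (n : ℕ) : TreeBounds α η M (c ^ n) fun x => E x ^ n := by
  induction n with
  | zero => simpa using one
  | succ n ih => simp only [pow_succ]; exact ih.mul h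

theorem exp (h : TreeBounds α η M c E) :
    TreeBounds α η M (SetFun.exp c) fun x => SetFun.exp (E x) :=
  fun S hS => TreeBound.tsum fun n => (h.pow n S hS).const_mul _

theorem const_mul (h : TreeBounds α η M c E) (b : ℝ≥0∞) :
    TreeBounds α η M (single ∅ b * c) fun x => single ∅ b * E x := by
  intro S hS
  simp only [single_empty_mul_apply]
  exact (h S hS).const_mul b

theorem quad (h : TreeBounds α η M c E) :
    TreeBounds α η M (SetFun.quad c) fun x => SetFun.quad (E x) :=
  ((h.mul h).mul h.exp).const_mul _

theorem multiset_prod_le (h : TreeBounds α η M c E) {j : ι} (s : Multiset (Pt d))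
    (hs : ∀ p ∈ s, p ∈ η j) (S : Finset ι) (hS : S.card < M) :
    (s.map E).prod S ≤ (c ^ Multiset.card s) S *
      maxLink (clusterKernel α η) (insert j S) [j] := by
  induction s using Multiset.induction_on generalizing S with
  | empty =>
    simp only [Multiset.map_zero, Multiset.prod_zero, Multiset.card_zero, pow_zero, one_apply]
    split_ifs with h0
    · subst h0
      have := maxLink_mul_star_le (clusterKernel α η) ∅ [] j
      simp only [List.map_nil, List.prod_nil, mul_one] at this
      simpa using (one_le_maxLink_empty _).trans this
    · simp
  | cons p s ih =>
    rw [Multiset.map_cons, Multiset.prod_cons, Multiset.card_cons, pow_succ', mul_apply, mul_apply,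
      Finset.sum_mul]
    refine Finset.sum_le_sum fun A hA => ?_
    have hA' := Finset.mem_powerset.1 hA
    refine (mul_le_mul' ((h A ((Finset.card_le_card hA').trans_lt hS)).apply_le
      (hs p (by simp))) (ih (fun q hq => hs q (by simp [hq])) (S \ A)
        ((Finset.card_le_card Finset.sdiff_subset).trans_lt hS))).trans ?_
    calc _ = c A * (c ^ Multiset.card s) (S \ A) * (maxLink (clusterKernel α η) (insert j A) [j] *
          maxLink (clusterKernel α η) (insert j (S \ A)) [j]) := by ring
      _ ≤ _ := by
        refine mul_le_mul' le_rfl ((maxLink_mul_le _ _ _ _ _).trans (maxLink_anti _ ?_ ?_))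
        · intro i hi
          rcases Finset.mem_insert.1 hi with rfl | hi
          · simp
          · by_cases hiA : i ∈ A <;> simp [hi, hiA]
        · intro i hi; simpa using hi

end TreeBounds

/-- The recursion for the total masses of the tree bounds of the iterates of `skelStep`. -/
def countStep (η : ι → Config d) (T K Θ' : ℝ≥0∞) (κ : ι → ℝ≥0∞) (c : SetFun ι ℝ≥0∞) :
    SetFun ι ℝ≥0∞ :=
  ⟨fun S => K * (∑ j ∈ S, κ j * Multiset.card (η j) *
    (rootFun T c ^ Multiset.card (η j)) (S.erase j) + Θ' * SetFun.quad c S)⟩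

/-- Tree bounds are stable under products and exponentials, and each integration against the kernel
costs a factor fixed by `M`. So any supersolution `c` of `countStep` bounds the masses of all
iterates, by induction from the zero iterate. -/
theorem treeBounds_skelIter (hα : 0 < α) (T K Cc : ℝ≥0∞) (κ : ι → ℝ≥0∞) (M : ℕ)
    (c : SetFun ι ℝ≥0∞) (hc : countStep η T K
      (T * Cc * (M * (ENNReal.ofReal (2 ^ α) ^ (M - 1) * ∫⁻ y, nb α (y : Pt d)))) κ c ≤ c) (n : ℕ) :
    TreeBounds α η M c (skelIter α η T K Cc κ n) := by
  induction n with
  | zero => exact fun S _ => TreeBound.zero.mono bot_le fun _ => le_rfl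
  | succ n ih =>
    intro S hS
    have hempty := skelIter_empty α η T K Cc κ n
    set E := skelIter α η T K Cc κ n with hE
    have hT : TreeBound α η S (K * ((∑ j ∈ S, κ j * Multiset.card (η j) *
        (rootFun T c ^ Multiset.card (η j)) (S.erase j)) + T * Cc *
        (M * (ENNReal.ofReal (2 ^ α) ^ (M - 1) * ∫⁻ y, nb α (y : Pt d)) * SetFun.quad c S)))
        (fun x => K * (∑ j ∈ S, κ j * clusterSum α η j x * confFun T E (η j) (S.erase j) +
          T * Cc * ∫⁻ y, nb α (x - y) * SetFun.quad (E y) S)) := by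
      refine TreeBound.const_mul (TreeBound.add (TreeBound.sum _ fun j hj => ?_)
        (TreeBound.const_mul ?_ _)) _
      -- The points of cluster `j` are roots of trees covering the other clusters of `S`; together
      -- these link all of `S` to `j`, and only the edge from `x` to a point of `η j` remains as a
      -- leg.
      · have hv : confFun T E (η j) (S.erase j) ≤
            (rootFun T c ^ Multiset.card (η j)) (S.erase j) *
              maxLink (clusterKernel α η) S [j] := by
          have := (ih.exp.const_mul T).multiset_prod_le (j := j) (η j) (fun p hp => hp) (S.erase j)
            ((Finset.card_le_card (Finset.erase_subset _ _)).trans_lt hS)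
          rwa [Finset.insert_erase hj] at this
        obtain ⟨l, hl⟩ : ∃ l : List (Pt d), (l : Multiset (Pt d)) = η j := Quot.exists_rep (η j)
        have h1 := TreeBound.list_sum (α := α) (η := η) (S := S) l (c := 1)
          (F := fun p => starFun α η S [(j, p)]) (fun p hp => TreeBound.of_starFun (by
            intro q hq
            rw [List.mem_singleton.1 hq, ← hl]
            exact hp) (by simpa using Finset.card_pos.2 ⟨j, hj⟩))
        refine (h1.const_mul (κ j * (rootFun T c ^ Multiset.card (η j)) (S.erase j))).mono
          (le_of_eq ?_) fun x => ?_
        · rw [← hl, Multiset.coe_card]; ring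
        · calc _ ≤ κ j * clusterSum α η j x * ((rootFun T c ^ Multiset.card (η j)) (S.erase j) *
                maxLink (clusterKernel α η) S [j]) := mul_le_mul' le_rfl hv
            _ = _ := by
              rw [clusterSum, ← hl, Multiset.map_coe, Multiset.sum_coe]
              simp only [starFun, List.map_cons, List.map_nil, List.prod_cons, List.prod_nil,
                mul_one]
              rw [List.sum_map_mul_left]
              ring
      · rcases S.eq_empty_or_nonempty with rfl | hne
        · refine TreeBound.zero.mono bot_le fun x => ?_
          simp [quad_empty (hempty _)]
        · exact (ih.quad S hS).lintegral hα hne hS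
    refine hT.mono ((le_of_eq ?_).trans (hc S)) fun x => le_of_eq ?_
    · rw [countStep]
      simp only [mul_assoc]
    · change K * (attachFun α η T κ E x S + T * Cc * ∫⁻ y, nb α (x - y) * SetFun.quad (E y) S) = _
      rw [attachFun_apply, ← Finset.sum_filter]
      congr 2
      refine Finset.sum_congr ?_ fun j _ => by rw [Finset.sdiff_singleton_eq_erase]
      ext j; simp

theorem confFun_skelLog_le (hα : 0 < α) (T K Cc : ℝ≥0∞) (κ : ι → ℝ≥0∞) (M : ℕ)
    (c : SetFun ι ℝ≥0∞) (hc : countStep η T K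
      (T * Cc * (M * (ENNReal.ofReal (2 ^ α) ^ (M - 1) * ∫⁻ y, nb α (y : Pt d)))) κ c ≤ c) (j : ι)
    (S : Finset ι) (hS : S.card < M) :
    confFun T (skelLog α η T K Cc κ) (η j) S ≤ (rootFun T c ^ Multiset.card (η j)) S *
      maxLink (clusterKernel α η) (insert j S) [j] :=
  ((treeBounds_skelIter hα T K Cc κ M c hc _).exp.const_mul T).multiset_prod_le (η j)
    (fun _ hp => hp) S hS

end Count

end

/-! ### The skeleton polynomials solve the counting recursion. -/

section

open scoped ENNReal
open SetFun

namespace SetFun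

variable {ι : Type} [DecidableEq ι]

/-- The set function with values in `ℝ≥0∞` associated with a real one. -/
def ofRealFun (f : SetFun ι ℝ) : SetFun ι ℝ≥0∞ := ⟨fun S => ENNReal.ofReal (f S)⟩

theorem ofRealFun_mul {f g : SetFun ι ℝ} (hf : ∀ S, 0 ≤ f S) (hg : ∀ S, 0 ≤ g S) :
    ofRealFun (f * g) = ofRealFun f * ofRealFun g := by
  refine ext_apply fun S => ?_
  change ENNReal.ofReal ((f * g) S) = _
  rw [mul_apply, mul_apply, ENNReal.ofReal_sum_of_nonneg fun A _ => mul_nonneg (hf _) (hg _)]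
  exact Finset.sum_congr rfl fun A _ => ENNReal.ofReal_mul (hf A)

theorem pow_nonneg' {f : SetFun ι ℝ} (hf : ∀ S, 0 ≤ f S) (n : ℕ) (S : Finset ι) :
    0 ≤ (f ^ n) S := by
  induction n generalizing S with
  | zero => rw [pow_zero, one_apply]; split_ifs <;> norm_num
  | succ n ih =>
    rw [pow_succ, mul_apply]
    exact Finset.sum_nonneg fun A _ => mul_nonneg (ih A) (hf _)

theorem ofRealFun_pow {f : SetFun ι ℝ} (hf : ∀ S, 0 ≤ f S) (n : ℕ) :
    ofRealFun (f ^ n) = ofRealFun f ^ n := by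
  induction n with
  | zero =>
    refine ext_apply fun S => ?_
    change ENNReal.ofReal ((f ^ 0) S) = _
    rw [pow_zero, pow_zero, one_apply, one_apply]
    split_ifs <;> simp
  | succ n ih => rw [pow_succ, pow_succ, ofRealFun_mul (pow_nonneg' hf n) hf, ih]

theorem exp_weight (μ : ι → ℝ≥0∞) (f : SetFun ι ℝ≥0∞) :
    exp (weight μ f) = weight μ (exp f) := by
  refine ext_apply fun S => ?_
  rw [exp_apply, weight_apply, exp_apply, ← ENNReal.tsum_mul_left]
  refine tsum_congr fun n => ?_
  rw [← weight_pow, weight_apply]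
  ring

theorem quad_weight (μ : ι → ℝ≥0∞) (f : SetFun ι ℝ≥0∞) (S : Finset ι) :
    quad (weight μ f) S = (∏ j ∈ S, μ j) * quad f S := by
  rw [quad_apply, quad_apply, exp_weight, ← weight_mul, ← weight_mul, weight_apply]
  ring

theorem exp_ofRealFun_clusterLog (K Θ : ℝ) (hK : 0 ≤ K) (hΘ : 0 ≤ Θ) (l : ι → ℝ)
    (hl : ∀ j, 0 ≤ l j) :
    exp (ofRealFun (clusterLog K Θ l)) = ofRealFun (clusterVal K Θ l 1) := by
  have hn := clusterLog_pow_nonneg K Θ hK hΘ l hl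
  have hn1 : ∀ S, 0 ≤ clusterLog K Θ l S := fun S => by simpa using hn 1 S
  refine ext_apply fun S => ?_
  have h := clusterVal_one_eq K Θ l S
  change _ = ENNReal.ofReal (clusterVal K Θ l 1 S)
  rw [← h.tsum_eq, ENNReal.ofReal_tsum_of_nonneg (fun n => mul_nonneg (by positivity) (hn n S))
    h.summable, exp_apply]
  refine tsum_congr fun n => ?_
  rw [← ofRealFun_pow hn1, ENNReal.ofReal_mul (by positivity),
    ENNReal.ofReal_inv_of_pos (by positivity), ENNReal.ofReal_natCast]
  rfl

end SetFun

section

variable {d : ℕ} {ι : Type} [DecidableEq ι] [Fintype ι] (η : ι → Config d)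

/-- The factor contributed by a cluster attached at one of its points. -/
def clusterFactor (τ : ℝ) (κ : ι → ℝ≥0∞) (j : ι) : ℝ≥0∞ :=
  κ j * Multiset.card (η j) * ENNReal.ofReal τ ^ Multiset.card (η j)

theorem rootFun_pow_apply {T : ℝ≥0∞} {τ K Θ : ℝ} (hT : T ≤ ENNReal.ofReal τ) (hK : 0 ≤ K)
    (hΘ : 0 ≤ Θ) (μ : ι → ℝ≥0∞) {l : ι → ℝ} (hl : ∀ j, 0 ≤ l j) (n : ℕ) (S : Finset ι) :
    (rootFun T (weight μ (ofRealFun (clusterLog K Θ l))) ^ n) S ≤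
      ENNReal.ofReal τ ^ n * ((∏ j ∈ S, μ j) * ENNReal.ofReal (clusterVal K Θ l n S)) := by
  rw [rootFun, mul_pow, single_empty_pow, single_empty_mul_apply, exp_weight,
    exp_ofRealFun_clusterLog K Θ hK hΘ l hl, ← weight_pow, weight_apply,
    ← ofRealFun_pow (clusterVal_nonneg K Θ hK hΘ l hl zero_le_one), ← clusterVal_natCast]
  exact mul_le_mul' (pow_le_pow_left' hT n) le_rfl

/-- After the factor `κ j · l j · τ ^ l j` is extracted for every cluster of `S`, the recursion
becomes `clusterLog_eq`; the inequality only comes from `T ≤ τ` and `Θ' ≤ Θ`. -/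
theorem countStep_le {T Θ' : ℝ≥0∞} {τ K Θ : ℝ} (hT : T ≤ ENNReal.ofReal τ) (hK : 0 ≤ K)
    (hΘ : 0 ≤ Θ) (hΘ' : Θ' ≤ ENNReal.ofReal Θ) (κ : ι → ℝ≥0∞) :
    countStep η T (ENNReal.ofReal K) Θ' κ (weight (clusterFactor η τ κ)
      (ofRealFun (clusterLog K Θ fun j => (Multiset.card (η j) : ℝ)))) ≤
    weight (clusterFactor η τ κ)
      (ofRealFun (clusterLog K Θ fun j => (Multiset.card (η j) : ℝ))) := by
  intro S
  set l : ι → ℝ := fun j => (Multiset.card (η j) : ℝ) with hl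
  have hl0 : ∀ j, 0 ≤ l j := fun j => Nat.cast_nonneg _
  set μ := clusterFactor η τ κ with hμ
  have hn1 : ∀ S, 0 ≤ clusterLog K Θ l S := fun S => by
    simpa using clusterLog_pow_nonneg K Θ hK hΘ l hl0 1 S
  have hv := fun a (ha : 0 ≤ a) => clusterVal_nonneg K Θ hK hΘ l hl0 (a := a) ha
  have hprod : ∀ S, 0 ≤ (clusterLog K Θ l * clusterLog K Θ l) S := fun S => by
    simpa [sq] using clusterLog_pow_nonneg K Θ hK hΘ l hl0 2 S
  have hprod' : 0 ≤ (clusterLog K Θ l * clusterLog K Θ l * clusterVal K Θ l 1) S :=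
    Finset.sum_nonneg fun A _ => mul_nonneg (hprod A) (hv 1 zero_le_one _)
  have hq : SetFun.quad (ofRealFun (clusterLog K Θ l)) S =
      ENNReal.ofReal (2⁻¹ * (clusterLog K Θ l * clusterLog K Θ l * clusterVal K Θ l 1) S) := by
    rw [quad_apply, exp_ofRealFun_clusterLog K Θ hK hΘ l hl0, ← ofRealFun_mul hn1 hn1,
      ← ofRealFun_mul hprod (hv 1 zero_le_one), ENNReal.ofReal_mul (by norm_num),
      ENNReal.ofReal_inv_of_pos (by norm_num)]
    simp [ofRealFun]
  change ENNReal.ofReal K * (∑ j ∈ S, κ j * Multiset.card (η j) *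
    (rootFun T (weight μ (ofRealFun (clusterLog K Θ l))) ^ Multiset.card (η j)) (S.erase j) +
      Θ' * SetFun.quad (weight μ (ofRealFun (clusterLog K Θ l))) S) ≤
    (∏ j ∈ S, μ j) * ENNReal.ofReal (clusterLog K Θ l S)
  rw [quad_weight, hq]
  have h1 : ∀ j ∈ S, κ j * Multiset.card (η j) *
      (rootFun T (weight μ (ofRealFun (clusterLog K Θ l))) ^ Multiset.card (η j)) (S.erase j) ≤
      (∏ j ∈ S, μ j) * ENNReal.ofReal (clusterVal K Θ l (l j) (S.erase j)) := by
    intro j hj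
    refine (mul_le_mul' le_rfl (rootFun_pow_apply hT hK hΘ μ hl0 _ _)).trans (le_of_eq ?_)
    rw [← Finset.mul_prod_erase S μ hj, hμ, clusterFactor]
    ring
  calc _ ≤ ENNReal.ofReal K * (∑ j ∈ S, (∏ j ∈ S, μ j) *
        ENNReal.ofReal (clusterVal K Θ l (l j) (S.erase j)) + ENNReal.ofReal Θ *
        ((∏ j ∈ S, μ j) * ENNReal.ofReal
          (2⁻¹ * (clusterLog K Θ l * clusterLog K Θ l * clusterVal K Θ l 1) S))) := by
        exact mul_le_mul' le_rfl (add_le_add (Finset.sum_le_sum h1) (mul_le_mul' hΘ' le_rfl))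
    _ = (∏ j ∈ S, μ j) * (ENNReal.ofReal K * (∑ j ∈ S,
        ENNReal.ofReal (clusterVal K Θ l (l j) (S.erase j)) + ENNReal.ofReal Θ *
        ENNReal.ofReal
          (2⁻¹ * (clusterLog K Θ l * clusterLog K Θ l * clusterVal K Θ l 1) S))) := by
        rw [← Finset.mul_sum]; ring
    _ = _ := by
        rw [clusterLog_eq K Θ l S, ENNReal.ofReal_mul hK, ENNReal.ofReal_add
          (Finset.sum_nonneg fun j _ => hv _ (hl0 j) _) (by positivity), ENNReal.ofReal_mul hΘ,
          ENNReal.ofReal_sum_of_nonneg fun j _ => hv _ (hl0 j) _]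

end

/-! ### From linking edge lists to trees. -/

section MaxTree

variable {d m : ℕ}

theorem clusterMax_nonneg (α : ℝ) (A A' : Config d) : 0 ≤ clusterMax α A A' := by
  refine Real.sSup_nonneg ?_
  rintro v ⟨x, _, y, _, rfl⟩
  exact (nuBar_pos α _).le

theorem clusterMax_le_one (α : ℝ) (A A' : Config d) : clusterMax α A A' ≤ 1 := by
  refine Real.sSup_le ?_ zero_le_one
  rintro v ⟨x, _, y, _, rfl⟩
  exact nuBar_le_one α _

theorem clusterMax_comm (α : ℝ) (A A' : Config d) : clusterMax α A A' = clusterMax α A' A := by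
  unfold clusterMax
  congr 1
  ext v
  constructor
  · rintro ⟨x, hx, y, hy, rfl⟩; exact ⟨y, hy, x, hx, nuBar_sub_comm _ _ _⟩
  · rintro ⟨x, hx, y, hy, rfl⟩; exact ⟨y, hy, x, hx, nuBar_sub_comm _ _ _⟩

theorem treeWeight_nonneg (α : ℝ) (η : Fin m → Config d) (T : SimpleGraph (Fin m)) :
    0 ≤ treeWeight α η T := Finset.prod_nonneg fun _ _ => clusterMax_nonneg _ _ _

theorem treeWeight_le_maxTreeWeight (α : ℝ) (η : Fin m → Config d) {T : SimpleGraph (Fin m)}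
    (hT : T.IsTree) : treeWeight α η T ≤ maxTreeWeight α η := by
  refine le_csSup ⟨1, ?_⟩ ⟨T, hT, rfl⟩
  rintro v ⟨T', _, rfl⟩
  exact Finset.prod_le_one (fun _ _ => clusterMax_nonneg _ _ _) fun _ _ => clusterMax_le_one _ _ _

theorem list_prod_le_prod_toFinset {β : Type*} [DecidableEq β] (f : β → ℝ≥0∞) (hf : ∀ b, f b ≤ 1)
    (E : List β) : (E.map f).prod ≤ ∏ e ∈ E.toFinset, f e := by
  induction E with
  | nil => simp
  | cons a E ih =>
    rw [List.map_cons, List.prod_cons, List.toFinset_cons]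
    by_cases ha : a ∈ E.toFinset
    · rw [Finset.insert_eq_of_mem ha]
      exact (mul_le_mul' (hf a) ih).trans (by rw [one_mul])
    · rw [Finset.prod_insert ha]
      exact mul_le_mul' le_rfl ih

/-- An edge list linking everything to `i₀` spans a connected graph, which contains a spanning tree.
All weights are at most `1`, so loops, repetitions and edges outside the tree can be dropped. -/
theorem maxLink_le_maxTreeWeight (α : ℝ) (η : Fin m → Config d) (i₀ : Fin m) :
    maxLink (clusterKernel α η) Finset.univ [i₀] ≤ ENNReal.ofReal (maxTreeWeight α η) := by
  classical
  refine iSup₂_le fun E hE => ?_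
  let G : SimpleGraph (Fin m) :=
    { Adj := fun a b => a ≠ b ∧ ((a, b) ∈ E ∨ (b, a) ∈ E)
      symm := ⟨fun a b h => ⟨h.1.symm, h.2.symm⟩⟩
      loopless := ⟨fun a h => h.1 rfl⟩ }
  have hreach : ∀ i, G.Reachable i₀ i := by
    intro i
    -- `Links` is tested on the connected component of `i₀`, which is closed under the edges.
    refine hE {i | G.Reachable i₀ i} ?_ ?_ i (Finset.mem_univ i)
    · rintro ⟨a, b⟩ hab
      by_cases h : a = b
      · subst h; rfl
      · have hadj : G.Adj a b := ⟨h, Or.inl hab⟩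
        exact ⟨fun h => h.trans hadj.reachable, fun h => h.trans hadj.symm.reachable⟩
    · intro j hj
      rw [List.mem_singleton.1 hj]
      exact SimpleGraph.Reachable.refl _
  have hconn : G.Connected :=
    { preconnected := fun a b => (hreach a).symm.trans (hreach b)
      nonempty := ⟨i₀⟩ }
  obtain ⟨T, hTG, hT⟩ := hconn.exists_isTree_le
  refine le_trans ?_ (ENNReal.ofReal_le_ofReal (treeWeight_le_maxTreeWeight α η hT))
  have hle : ∀ e : Fin m × Fin m, clusterKernel α η e.1 e.2 ≤ 1 := fun e => by
    rw [← ENNReal.ofReal_one]; exact ENNReal.ofReal_le_ofReal (clusterMax_le_one _ _ _)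
  refine (list_prod_le_prod_toFinset (fun e : Fin m × Fin m => clusterKernel α η e.1 e.2) hle
    E).trans ?_
  rw [treeWeight, ENNReal.ofReal_prod_of_nonneg fun _ _ => clusterMax_nonneg _ _ _]
  set P := Finset.univ.filter (fun p : Fin m × Fin m => p.1 < p.2 ∧ T.Adj p.1 p.2) with hP
  -- Tree edges are ordered pairs `p.1 < p.2`, whereas the list may contain either orientation; `g`
  -- selects one that occurs.
  let g : Fin m × Fin m → Fin m × Fin m := fun p => if p ∈ E then p else p.swap
  have hgE : ∀ p ∈ P, g p ∈ E.toFinset := by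
    intro p hp
    have hadj : G.Adj p.1 p.2 := hTG (Finset.mem_filter.1 hp).2.2
    rw [List.mem_toFinset]
    by_cases h : p ∈ E
    · simp [g, h]
    · simp only [g, h, if_false]
      exact hadj.2.resolve_left h
  have hginj : Set.InjOn g P := by
    intro p hp q hq hpq
    have hp' := (Finset.mem_filter.1 hp).2.1
    have hq' := (Finset.mem_filter.1 hq).2.1
    have hcase : ∀ p, g p = p ∨ g p = p.swap := fun p => by
      by_cases h : p ∈ E <;> simp [g, h]
    rcases hcase p with h1 | h1 <;> rcases hcase q with h2 | h2 <;> rw [h1, h2] at hpq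
    · exact hpq
    · subst hpq; exact absurd hp' (not_lt.2 hq'.le)
    · rw [← hpq] at hq'; exact absurd hp' (not_lt.2 hq'.le)
    · exact Prod.swap_injective hpq
  have hgval : ∀ p, clusterKernel α η (g p).1 (g p).2 =
      ENNReal.ofReal (clusterMax α (η p.1) (η p.2)) := by
    intro p
    by_cases h : p ∈ E
    · simp [g, h, clusterKernel]
    · simp only [g, h, if_false, clusterKernel, Prod.fst_swap, Prod.snd_swap]
      rw [clusterMax_comm]
  calc ∏ e ∈ E.toFinset, clusterKernel α η e.1 e.2
      ≤ ∏ e ∈ P.image g, clusterKernel α η e.1 e.2 :=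
        Finset.prod_le_prod_of_subset_of_le_one' (Finset.image_subset_iff.2 hgE)
          fun e _ _ => hle e
    _ = _ := by
        rw [Finset.prod_image hginj]
        exact Finset.prod_congr rfl fun p _ => hgval p

end MaxTree

/-! ### Comparison with the constants `A_{m,σ}`. -/

section ConstA

/-- Here `m = n + 2`. The term without branching, `(u/w)^{m-1}` with `u/w = 1 + q`, is distributed
over `σ` by the binomial theorem and gives the first parts of the `A_{m,σ}`. The terms with `r ≥ 1`
branchings are exactly `S_m`; the other `S_σ` are nonnegative and not needed. -/
theorem sum_constA_ge {n : ℕ} {α C h n₁ n₂ : ℝ} (hC : 0 < C) (hh : 0 < h) (hn₂ : 0 ≤ n₂)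
    (hw : 0 < 1 - h * n₁ * Real.exp 1 - h * n₂ * (2 : ℝ) ^ (1 + α)) (l : Fin (n + 2) → ℕ) :
    (h / (1 - h * n₁ * Real.exp 1)) ^ l 0 *
      ((∏ j ∈ Finset.univ.erase 0, C * (1 + C) ^ (l j - 1) * l j *
        (h / (1 - h * n₁ * Real.exp 1)) ^ l j) *
      clusterVal ((1 - h * n₁ * Real.exp 1) /
          (1 - h * n₁ * Real.exp 1 - h * n₂ * (2 : ℝ) ^ (1 + α)))
        (((n + 2 : ℕ) : ℝ) * (2 : ℝ) ^ (α * (((n + 2 : ℕ) : ℝ) - 1)) *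
          (h * n₂ / (1 - h * n₁ * Real.exp 1))) (fun j => (l j : ℝ)) (l 0) (Finset.univ.erase 0)) ≤
    ∑ σ ∈ Finset.Icc 1 (n + 2), constA α C h n₁ n₂ l σ := by
  set u := 1 - h * n₁ * Real.exp 1 with hu
  set w := u - h * n₂ * (2 : ℝ) ^ (1 + α) with hwd
  have hq0 : 0 ≤ h * n₂ * (2 : ℝ) ^ (1 + α) := by positivity
  have hu0 : 0 < u := by linarith
  set Θ := ((n + 2 : ℕ) : ℝ) * (2 : ℝ) ^ (α * (((n + 2 : ℕ) : ℝ) - 1)) * (h * n₂ / u) with hΘ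
  set L : ℕ := ∑ i, l i with hL
  have hLsum : (l 0 : ℝ) + ∑ j ∈ Finset.univ.erase (0 : Fin (n + 2)), (l j : ℝ) = L := by
    rw [Finset.add_sum_erase _ (fun j => (l j : ℝ)) (Finset.mem_univ 0), hL]
    push_cast; rfl
  have hcard : (Finset.univ.erase (0 : Fin (n + 2))).card = n + 1 := by
    rw [Finset.card_erase_of_mem (Finset.mem_univ _), Finset.card_univ, Fintype.card_fin]; rfl
  set pref := (∏ i, (l i : ℝ)) * C ^ (n + 1) *
    (1 + C) ^ (∑ i ∈ Finset.univ.filter (fun i : Fin (n + 2) => (i : ℕ) ≠ 0), (l i - 1)) *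
      (h / u) ^ L with hpref
  have hpref0 : 0 ≤ pref := by positivity
  set R := fun r : ℕ => ((n + r).factorial : ℝ) / ((r.factorial : ℝ) * 2 ^ r *
    ((n - r).factorial : ℝ)) * ((L : ℝ) + r) ^ (n - r) * Θ ^ r * (u / w) ^ (n + 1 + r) with hR
  have hval : clusterVal (u / w) Θ (fun j => (l j : ℝ)) (l 0) (Finset.univ.erase 0) =
      l 0 * ∑ r ∈ Finset.range (n + 1), R r := by
    have hne : Finset.univ.erase (0 : Fin (n + 2)) ≠ ∅ := by
      intro h0; rw [h0] at hcard; simp at hcard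
    change Polynomial.eval _ (clusterPoly _ _ _ _) = _
    rw [clusterPoly, if_neg hne, hcard, skelPoly]
    simp only [Polynomial.eval_mul, Polynomial.eval_X, Polynomial.eval_finsetSum, Polynomial.eval_C,
      Polynomial.eval_pow, Polynomial.eval_add, Nat.add_sub_cancel]
    congr 1
    refine Finset.sum_congr rfl fun r _ => ?_
    rw [← add_assoc, hLsum, skelCoeff]
    ring
  have hfilter : Finset.univ.filter (fun i : Fin (n + 2) => (i : ℕ) ≠ 0) =
      Finset.univ.erase 0 := by
    ext i
    rw [Finset.mem_filter, Finset.mem_erase, ne_eq, ne_eq, Fin.ext_iff]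
    exact and_comm
  have hleft : (h / u) ^ l 0 * ((∏ j ∈ Finset.univ.erase 0, C * (1 + C) ^ (l j - 1) * l j *
      (h / u) ^ l j) * (l 0 * ∑ r ∈ Finset.range (n + 1), R r)) =
      pref * ∑ r ∈ Finset.range (n + 1), R r := by
    rw [hpref, hfilter, Finset.prod_mul_distrib, Finset.prod_mul_distrib, Finset.prod_mul_distrib,
      Finset.prod_const, hcard, Finset.prod_pow_eq_pow_sum, Finset.prod_pow_eq_pow_sum, hL,
      ← Finset.add_sum_erase _ l (Finset.mem_univ 0),
      ← Finset.mul_prod_erase _ (fun i => (l i : ℝ)) (Finset.mem_univ 0), pow_add]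
    ring
  rw [hval, hleft]
  set q := h * n₂ * (2 : ℝ) ^ (1 + α) / w with hq
  have hq1 : u / w = q + 1 := by
    rw [hq, div_add_one hw.ne']; congr 1; rw [hwd]; ring
  have hconst : ∀ σ ∈ Finset.Icc 1 (n + 2), constA α C h n₁ n₂ l σ = pref *
      (((n + 1).choose (σ - 1) : ℝ) * q ^ (σ - 1) * (L : ℝ) ^ n +
        ((n + 1).choose (σ - 1) : ℝ) * ((L : ℝ) ^ (n + 2 - σ) * ∑ r ∈ Finset.Icc 1 (σ - 2),
        ((σ + r - 2).factorial : ℝ) / ((r.factorial : ℝ) * 2 ^ r * ((σ - 2 - r).factorial : ℝ)) *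
          ((L : ℝ) + r) ^ (σ - 2 - r) *
          (σ * (2 : ℝ) ^ (α * ((σ : ℝ) - 1)) * (h * n₂ / u)) ^ r * (u / w) ^ (σ + r - 1))) := by
    intro σ _
    change (∏ i, (l i : ℝ)) * ((n + 1).choose (σ - 1) : ℝ) * C ^ (n + 1) *
      (1 + C) ^ (∑ i ∈ Finset.univ.filter (fun i : Fin (n + 2) => (i : ℕ) ≠ 0), (l i - 1)) *
      (h / u) ^ L * ((L : ℝ) ^ n * q ^ (σ - 1) + (L : ℝ) ^ (n + 2 - σ) * _) = _
    rw [hpref]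
    ring
  rw [Finset.sum_congr rfl hconst, ← Finset.mul_sum, Finset.sum_add_distrib]
  refine mul_le_mul_of_nonneg_left ?_ hpref0
  rw [Finset.sum_range_succ', add_comm]
  refine add_le_add (le_of_eq ?_) ?_
  · rw [← Finset.sum_mul]
    have : ∑ σ ∈ Finset.Icc 1 (n + 2), ((n + 1).choose (σ - 1) : ℝ) * q ^ (σ - 1) =
        (q + 1) ^ (n + 1) := by
      rw [add_pow, ← Finset.Ico_add_one_right_eq_Icc, Finset.sum_Ico_eq_sum_range]
      refine Finset.sum_congr rfl fun k _ => ?_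
      simp [mul_comm]
    rw [this, ← hq1, hR]
    simp
    field_simp
  · have hnn : ∀ σ ∈ Finset.Icc 1 (n + 2), 0 ≤ ((n + 1).choose (σ - 1) : ℝ) *
        ((L : ℝ) ^ (n + 2 - σ) * ∑ r ∈ Finset.Icc 1 (σ - 2),
        ((σ + r - 2).factorial : ℝ) / ((r.factorial : ℝ) * 2 ^ r * ((σ - 2 - r).factorial : ℝ)) *
          ((L : ℝ) + r) ^ (σ - 2 - r) *
          (σ * (2 : ℝ) ^ (α * ((σ : ℝ) - 1)) * (h * n₂ / u)) ^ r * (u / w) ^ (σ + r - 1)) := by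
      intro σ _
      positivity
    refine le_trans (le_of_eq ?_) (Finset.single_le_sum hnn
      (show n + 2 ∈ Finset.Icc 1 (n + 2) by simp))
    have e1 : n + 2 - 1 = n + 1 := rfl
    have e2 : n + 2 - 2 = n := rfl
    rw [e1, e2, Nat.choose_self, Nat.sub_self, pow_zero, Nat.cast_one, one_mul, one_mul]
    rw [← Finset.Ico_add_one_right_eq_Icc, Finset.sum_Ico_eq_sum_range]
    refine Finset.sum_congr (by simp) fun r _ => ?_
    rw [hR]
    simp only
    rw [show 1 + r = r + 1 by ring, show n + 2 + (r + 1) - 2 = n + (r + 1) by omega,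
      show n + 2 + (r + 1) - 1 = n + 1 + (r + 1) by omega, hΘ]

theorem constA_pos {m : ℕ} {α C h n₁ n₂ : ℝ} (hC : 0 < C) (hh : 0 < h) (hn₂ : 0 < n₂)
    (hw : 0 < 1 - h * n₁ * Real.exp 1 - h * n₂ * (2 : ℝ) ^ (1 + α)) (hm : 0 < m)
    (l : Fin m → ℕ) (hl : ∀ i, 0 < l i) {σ : ℕ} (hσ : σ ∈ Finset.Icc 1 m) :
    0 < constA α C h n₁ n₂ l σ := by
  have hq0 : 0 < h * n₂ * (2 : ℝ) ^ (1 + α) := by positivity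
  have hu0 : 0 < 1 - h * n₁ * Real.exp 1 := by linarith
  have hL : 0 < ∑ i, l i := Finset.sum_pos (fun i _ => hl i) ⟨⟨0, hm⟩, Finset.mem_univ _⟩
  simp only [constA]
  have h1 : 0 < ∏ i, (l i : ℝ) := Finset.prod_pos fun i _ => by exact_mod_cast hl i
  have h2 : (0 : ℝ) < ((m - 1).choose (σ - 1) : ℝ) := by
    have := Finset.mem_Icc.1 hσ
    exact_mod_cast Nat.choose_pos (by omega)
  have h3 : (0 : ℝ) < ((∑ i, l i : ℕ) : ℝ) := by exact_mod_cast hL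
  refine mul_pos (by positivity) (add_pos_of_pos_of_nonneg ?_ ?_)
  · exact mul_pos (pow_pos h3 _) (pow_pos (div_pos hq0 hw) _)
  · positivity

end ConstA

end

section

/-! ### Boltzmann weights and stability. -/

section Boltzmann

variable {d : ℕ} (φ : ℝ → WithTop ℝ) (β : ℝ)

theorem boltzmann_add (β : ℝ) (a b : WithTop ℝ) :
    boltzmann β (a + b) = boltzmann β a * boltzmann β b := by
  induction a with
  | top => simp [boltzmann]
  | coe a =>
    induction b with
    | top => simp [boltzmann]
    | coe b =>
      rw [← WithTop.coe_add]
      change Real.exp (-β * (a + b)) = Real.exp (-β * a) * Real.exp (-β * b)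
      rw [← Real.exp_add]; ring_nf

theorem boltzmann_zero (β : ℝ) : boltzmann β 0 = 1 := by
  change Real.exp (-β * 0) = 1
  simp

theorem boltzmann_nonneg (β : ℝ) (a : WithTop ℝ) : 0 ≤ boltzmann β a := by
  induction a with
  | top => exact le_rfl
  | coe a => exact (Real.exp_pos _).le

theorem boltzmann_sum (β : ℝ) (s : Multiset (WithTop ℝ)) :
    boltzmann β s.sum = (s.map (boltzmann β)).prod := by
  induction s using Multiset.induction_on with
  | empty => simp [boltzmann_zero]
  | cons a s ih => simp [boltzmann_add, ih]

/-- The Boltzmann weight of a configuration. -/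
def bw (A : Config d) : ℝ := boltzmann β (energy φ A)

/-- The Boltzmann factor of a pair of points. -/
def pairFactor (x y : Pt d) : ℝ := 1 + mayer d φ β (x - y)

theorem pairFactor_eq (x y : Pt d) : pairFactor φ β x y = boltzmann β (φ ‖x - y‖) := by
  simp [pairFactor, mayer]

theorem pairFactor_comm (x y : Pt d) : pairFactor φ β x y = pairFactor φ β y x := by
  rw [pairFactor_eq, pairFactor_eq, norm_sub_rev]

theorem pairFactor_nonneg (x y : Pt d) : 0 ≤ pairFactor φ β x y := by
  rw [pairFactor_eq]; exact boltzmann_nonneg _ _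

theorem energy_cons (x : Pt d) (A : Config d) :
    energy φ (x ::ₘ A) = (A.map fun y => φ ‖x - y‖).sum + energy φ A := by
  induction A using Quot.inductionOn with
  | _ l => rfl

theorem bw_zero : bw φ β (0 : Config d) = 1 := boltzmann_zero β

theorem bw_nonneg (A : Config d) : 0 ≤ bw φ β A := boltzmann_nonneg _ _

theorem bw_cons (x : Pt d) (A : Config d) :
    bw φ β (x ::ₘ A) = (A.map (pairFactor φ β x)).prod * bw φ β A := by
  rw [bw, energy_cons, boltzmann_add, boltzmann_sum, Multiset.map_map, bw]
  congr 3
  funext y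
  exact (pairFactor_eq φ β x y).symm

variable {φ β}

theorem bw_le {B : ℝ} (hβ : 0 < β) (hstab : IsStable d φ B) (A : Config d) :
    bw φ β A ≤ Real.exp (β * B) ^ Multiset.card A := by
  have h := hstab A
  rw [bw]
  generalize energy φ A = U at h
  induction U with
  | top => simp only [boltzmann]; positivity
  | coe U =>
    have h' : -(B * (Multiset.card A : ℝ)) ≤ U := WithTop.coe_le_coe.1 h
    change Real.exp (-β * U) ≤ _
    rw [← Real.exp_nat_mul, Real.exp_le_exp]
    nlinarith

/-- Every pair is counted once from each of its two points. -/
theorem prod_prod_erase_eq_sq [DecidableEq (Pt d)] (A : Config d) :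
    (A.map fun x => ((A.erase x).map (pairFactor φ β x)).prod).prod = bw φ β A ^ 2 := by
  induction A using Multiset.induction_on with
  | empty => simp [bw_zero]
  | cons a A ih =>
    have h : A.map (fun x => (((a ::ₘ A).erase x).map (pairFactor φ β x)).prod) =
        A.map fun x => pairFactor φ β a x * ((A.erase x).map (pairFactor φ β x)).prod := by
      refine Multiset.map_congr rfl fun x hx => ?_
      rw [Multiset.erase_cons_tail_of_mem hx, Multiset.map_cons, Multiset.prod_cons,
        pairFactor_comm]
    rw [Multiset.map_cons, Multiset.prod_cons, Multiset.erase_cons_head, h, Multiset.prod_map_mul,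
      ih, bw_cons]
    ring

theorem pow_card_lt_prod {X : Type*} {c : ℝ} (hc : 0 < c) (g : X → ℝ) (s : Multiset X)
    (hs : ∀ x ∈ s, c < g x) : c ^ Multiset.card s ≤ (s.map g).prod ∧
      (s ≠ 0 → c ^ Multiset.card s < (s.map g).prod) := by
  induction s using Multiset.induction_on with
  | empty => simp
  | cons a s ih =>
    have h1 := (ih fun x hx => hs x (by simp [hx])).1
    have h2 := hs a (by simp)
    have : c ^ Multiset.card (a ::ₘ s) < ((a ::ₘ s).map g).prod := by
      rw [Multiset.card_cons, pow_succ', Multiset.map_cons, Multiset.prod_cons]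
      have : 0 < c ^ Multiset.card s := pow_pos hc _
      nlinarith
    exact ⟨this.le, fun _ => this⟩

/-- In a stable system every nonempty configuration contains a point whose interaction with the
other points is bounded below. -/
theorem exists_good_point {B : ℝ} (hβ : 0 < β) (hstab : IsStable d φ B) {A : Config d}
    (hA : A ≠ 0) : ∃ x A', A = x ::ₘ A' ∧
      (A'.map (pairFactor φ β x)).prod ≤ Real.exp (2 * β * B) := by
  classical
  by_contra! hcon
  -- If every point violated the bound, the product over all points, which is the squared Boltzmann
  -- weight, would exceed `e^{2βB|A|}`, contradicting stability.
  have h1 := (pow_card_lt_prod (Real.exp_pos (2 * β * B))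
    (fun x => ((A.erase x).map (pairFactor φ β x)).prod) A
    fun x hx => hcon x (A.erase x) (Multiset.cons_erase hx).symm).2 hA
  rw [prod_prod_erase_eq_sq] at h1
  have h2 : bw φ β A ^ 2 ≤ (Real.exp (β * B) ^ Multiset.card A) ^ 2 :=
    pow_le_pow_left₀ (bw_nonneg φ β A) (bw_le hβ hstab A) 2
  have h3 : (Real.exp (β * B) ^ Multiset.card A) ^ 2 = Real.exp (2 * β * B) ^ Multiset.card A := by
    rw [← pow_mul, ← Real.exp_nat_mul, ← Real.exp_nat_mul]
    push_cast
    ring_nf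
  rw [h3] at h2
  exact absurd h1 (not_lt.2 h2)

end Boltzmann

/-! ### Measurability of Boltzmann weights. -/

section Measurability

variable {d : ℕ}

/-- The Mayer function is only almost everywhere strongly measurable, so it may be composed only
with maps that pull null sets back to null sets, such as surjective linear ones. -/
theorem quasiMeasurePreserving_of_surjective {I : Type*} [Fintype I]
    (L : (I → Pt d) →ₗ[ℝ] Pt d) (hL : Function.Surjective L) :
    Measure.QuasiMeasurePreserving L volume volume := by
  refine ⟨L.continuous_of_finiteDimensional.measurable, ?_⟩
  obtain ⟨c, -, hc⟩ := L.exists_map_addHaar_eq_smul_addHaar volume volume hL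
  rw [hc]
  exact Measure.smul_absolutelyContinuous

theorem quasiMeasurePreserving_coord_sub {I : Type*} [Fintype I] {i j : I} (hij : i ≠ j) :
    Measure.QuasiMeasurePreserving (fun y : I → Pt d => y i - y j) volume volume := by
  classical
  have := quasiMeasurePreserving_of_surjective
    (LinearMap.proj (R := ℝ) (φ := fun _ : I => Pt d) i - LinearMap.proj j) (fun p => by
      refine ⟨Pi.single i p, ?_⟩
      simp [Pi.single_eq_of_ne hij.symm])
  exact this

theorem quasiMeasurePreserving_coord_sub_const {I : Type*} [Fintype I] (i : I) (a : Pt d) :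
    Measure.QuasiMeasurePreserving (fun y : I → Pt d => y i - a) volume volume := by
  have h1 := quasiMeasurePreserving_of_surjective
    (LinearMap.proj (R := ℝ) (φ := fun _ : I => Pt d) i) (fun p => ⟨fun _ => p, rfl⟩)
  exact (measurePreserving_sub_right volume a).quasiMeasurePreserving.comp h1

theorem aestronglyMeasurable_list_prod {X β : Type*} [MeasurableSpace X] {μ : Measure X}
    (l : List β) (g : β → X → ℝ) (hg : ∀ b ∈ l, AEStronglyMeasurable (g b) μ) :
    AEStronglyMeasurable (fun x => (l.map fun b => g b x).prod) μ := by
  induction l with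
  | nil => simpa using aestronglyMeasurable_const
  | cons a l ih =>
    simp only [List.map_cons, List.prod_cons]
    exact (hg a (by simp)).mul (ih fun b hb => hg b (by simp [hb]))

variable {φ : ℝ → WithTop ℝ} {β : ℝ}

theorem aestronglyMeasurable_bw_add (hf : AEStronglyMeasurable (mayer d φ β)) (A : Config d)
    {I : Type*} [Fintype I] (l : List I) (hl : l.Nodup) :
    AEStronglyMeasurable (fun y : I → Pt d => bw φ β (A + ((l.map y : List (Pt d)) : Multiset _)))
      volume := by
  induction l with
  | nil => simpa using aestronglyMeasurable_const
  | cons i l ih =>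
    have hA : ∀ y : I → Pt d, bw φ β (A + (((i :: l).map y : List (Pt d)) : Multiset _)) =
        ((A.toList.map fun a => pairFactor φ β (y i) a).prod *
          (l.map fun k => pairFactor φ β (y i) (y k)).prod) *
          bw φ β (A + ((l.map y : List (Pt d)) : Multiset _)) := by
      intro y
      rw [List.map_cons, ← Multiset.cons_coe, Multiset.add_cons, bw_cons, Multiset.map_add,
        Multiset.prod_add]
      congr 2
      · conv_lhs => rw [← Multiset.coe_toList A]
        rw [Multiset.map_coe, Multiset.prod_coe]
      · rw [Multiset.map_coe, Multiset.prod_coe, List.map_map]; rfl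
    simp only [hA]
    refine ((aestronglyMeasurable_list_prod _ _ fun a _ => ?_).mul
      (aestronglyMeasurable_list_prod _ _ fun k hk => ?_)).mul (ih hl.of_cons)
    · exact aestronglyMeasurable_const.add
        (hf.comp_quasiMeasurePreserving (quasiMeasurePreserving_coord_sub_const i a))
    · refine aestronglyMeasurable_const.add
        (hf.comp_quasiMeasurePreserving (quasiMeasurePreserving_coord_sub ?_))
      rintro rfl
      exact (List.nodup_cons.1 hl).1 hk

end Measurability

/-! ### Splitting families of points. -/

section Split

variable {d : ℕ}

/-- The configuration of a finite family of points. -/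
def famConf {I : Type*} [Fintype I] (y : I → Pt d) : Config d := Finset.univ.val.map y

theorem famConf_fin {n : ℕ} (y : Fin n → Pt d) :
    famConf y = ((List.ofFn y : List (Pt d)) : Multiset (Pt d)) := Fin.univ_val_map y

theorem famConf_comp_equiv {I J : Type*} [Fintype I] [Fintype J] (e : I ≃ J) (y : J → Pt d) :
    famConf (fun i => y (e i)) = famConf y := by
  rw [famConf, famConf, ← Finset.map_univ_equiv e, Finset.map_val, Multiset.map_map]
  rfl

theorem famConf_split {I : Type*} [Fintype I] (p : I → Prop) [DecidablePred p] (y : I → Pt d) :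
    famConf y = famConf (fun i : {i // p i} => y i) + famConf (fun i : {i // ¬ p i} => y i) := by
  have h : ∀ (q : I → Prop) [DecidablePred q], famConf (fun i : {i // q i} => y i) =
      ((Finset.univ.filter q).val.map y) := by
    intro q _
    rw [famConf, ← Finset.subtype_univ, ← Finset.subtype_map q, Finset.map_val, Multiset.map_map]
    rfl
  rw [h, h, famConf, ← Multiset.map_add, Finset.filter_val, Finset.filter_val,
    Multiset.filter_add_not]

/-- Splitting a family of points along a set of indices preserves Lebesgue measure. -/
theorem exists_split_of_pred {n k l : ℕ} (p : Fin n → Prop) [DecidablePred p]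
    (hk : Fintype.card {i // p i} = k) (hl : k + l = n) :
    ∃ e : (Fin n → Pt d) ≃ᵐ (Fin k → Pt d) × (Fin l → Pt d), MeasurePreserving e ∧
      (∀ y, famConf y = famConf (e y).1 + famConf (e y).2) ∧
      ∀ (y : Fin n → Pt d) (f : Pt d → ℝ),
        ∏ i ∈ Finset.univ.filter p, f (y i) = ∏ i, f ((e y).1 i) := by
  have c2 : Fintype.card {i // ¬ p i} = l := by
    rw [Fintype.card_subtype_compl, hk, Fintype.card_fin]; omega
  let e1 : Fin k ≃ {i // p i} := (Fintype.equivFinOfCardEq hk).symm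
  let e2 : Fin l ≃ {i // ¬ p i} := (Fintype.equivFinOfCardEq c2).symm
  let s := MeasurableEquiv.piEquivPiSubtypeProd (fun _ : Fin n => Pt d) p
  have hs : MeasurePreserving s := volume_preserving_piEquivPiSubtypeProd (fun _ => Pt d) p
  have h1 := (volume_measurePreserving_piCongrLeft (fun _ : {i // p i} => Pt d) e1).symm
  have h2 := (volume_measurePreserving_piCongrLeft (fun _ : {i // ¬ p i} => Pt d) e2).symm
  refine ⟨s.trans (MeasurableEquiv.prodCongr (MeasurableEquiv.piCongrLeft (fun _ => Pt d) e1).symm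
    (MeasurableEquiv.piCongrLeft (fun _ => Pt d) e2).symm), (h1.prod h2).comp hs, ?_, ?_⟩
  · intro y
    rw [famConf_split p y]
    congr 1
    · exact (famConf_comp_equiv e1 _).symm
    · exact (famConf_comp_equiv e2 _).symm
  · intro y f
    rw [← Finset.prod_subtype_eq_prod_filter, Finset.subtype_univ]
    exact (Equiv.prod_comp e1 fun i => f (y i)).symm

theorem exists_split {n k l : ℕ} (S : Finset (Fin n)) (hk : S.card = k) (hl : k + l = n) :
    ∃ e : (Fin n → Pt d) ≃ᵐ (Fin k → Pt d) × (Fin l → Pt d), MeasurePreserving e ∧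
      (∀ y, famConf y = famConf (e y).1 + famConf (e y).2) ∧
      ∀ (y : Fin n → Pt d) (f : Pt d → ℝ), ∏ i ∈ S, f (y i) = ∏ i, f ((e y).1 i) := by
  obtain ⟨e, h1, h2, h3⟩ := exists_split_of_pred (d := d) (· ∈ S)
    (by rw [Fintype.card_subtype, Finset.filter_univ_mem, hk]) hl
  refine ⟨e, h1, h2, fun y f => ?_⟩
  rw [← h3, Finset.filter_univ_mem]

end Split

end

section

open scoped ENNReal

/-! ### Integration against the Lebesgue-Poisson measure. -/

section LebesguePoisson

variable {d : ℕ}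

theorem lpLint_eq (F : Config d → ℝ≥0∞) :
    lpLint F = ∑' k : ℕ, (k.factorial : ℝ≥0∞)⁻¹ * ∫⁻ y : Fin k → Pt d, F (famConf y) := by
  simp only [famConf_fin]; rfl

theorem lpLint_mono {F G : Config d → ℝ≥0∞} (h : ∀ ξ, F ξ ≤ G ξ) : lpLint F ≤ lpLint G :=
  ENNReal.tsum_le_tsum fun _ => mul_le_mul_right (lintegral_mono fun _ => h _) _

theorem lpLint_const_mul {c : ℝ≥0∞} (hc : c ≠ ⊤) (F : Config d → ℝ≥0∞) :
    lpLint (fun ξ => c * F ξ) = c * lpLint F := by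
  rw [lpLint, lpLint, ← ENNReal.tsum_mul_left]
  refine tsum_congr fun k => ?_
  rw [lintegral_const_mul' _ _ hc, mul_left_comm]

/-- The integral of a real function against the Lebesgue-Poisson measure of unit activity. -/
def lpInt (F : Config d → ℝ) : ℝ :=
  ∑' k : ℕ, (k.factorial : ℝ)⁻¹ * ∫ y : Fin k → Pt d, F (famConf y)

/-- Integrability with respect to the Lebesgue-Poisson measure. -/
structure LPIntegrable (F : Config d → ℝ) : Prop where
  meas : ∀ n, AEStronglyMeasurable (fun y : Fin n → Pt d => F (famConf y)) volume
  finite : lpLint (fun ξ => ‖F ξ‖ₑ) < ⊤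

theorem enorm_inv_factorial_mul (k : ℕ) (a : ℝ) :
    ‖(k.factorial : ℝ)⁻¹ * a‖ₑ = (k.factorial : ℝ≥0∞)⁻¹ * ‖a‖ₑ := by
  rw [enorm_mul, enorm_inv (by positivity)]
  simp

theorem enorm_lpInt_le (F : Config d → ℝ) : ‖lpInt F‖ₑ ≤ lpLint (fun ξ => ‖F ξ‖ₑ) := by
  rw [lpInt, lpLint_eq]
  refine enorm_tsum_le_tsum_enorm.trans (ENNReal.tsum_le_tsum fun k => ?_)
  rw [enorm_inv_factorial_mul]
  exact mul_le_mul_right (enorm_integral_le_lintegral_enorm _) _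

namespace LPIntegrable

variable {F G : Config d → ℝ}

theorem integrable (hF : LPIntegrable F) (n : ℕ) :
    Integrable (fun y : Fin n → Pt d => F (famConf y)) := by
  refine ⟨hF.meas n, ?_⟩
  have h := hF.finite
  rw [lpLint_eq] at h
  have h1 := (ENNReal.le_tsum n).trans_lt h
  rw [HasFiniteIntegral]
  by_contra hcon
  rw [not_lt, top_le_iff] at hcon
  rw [hcon, ENNReal.mul_top (by simp)] at h1
  exact lt_irrefl _ h1

theorem summable (hF : LPIntegrable F) :
    Summable fun k : ℕ => (k.factorial : ℝ)⁻¹ * ∫ y : Fin k → Pt d, F (famConf y) := by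
  refine Summable.of_enorm (ne_of_lt (lt_of_le_of_lt ?_ hF.finite))
  rw [lpLint_eq]
  refine ENNReal.tsum_le_tsum fun k => ?_
  rw [enorm_inv_factorial_mul]
  exact mul_le_mul_right (enorm_integral_le_lintegral_enorm _) _

theorem add (hF : LPIntegrable F) (hG : LPIntegrable G) : LPIntegrable fun ξ => F ξ + G ξ := by
  refine ⟨fun n => (hF.meas n).add (hG.meas n), ?_⟩
  refine lt_of_le_of_lt ?_ (ENNReal.add_lt_top.2 ⟨hF.finite, hG.finite⟩)
  rw [lpLint_eq, lpLint_eq, lpLint_eq, ← ENNReal.tsum_add]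
  refine ENNReal.tsum_le_tsum fun k => ?_
  rw [← mul_add, ← lintegral_add_left' (hF.meas k).enorm]
  exact mul_le_mul_right (lintegral_mono fun y => enorm_add_le _ _) _

theorem const_mul (hF : LPIntegrable F) (c : ℝ) : LPIntegrable fun ξ => c * F ξ := by
  refine ⟨fun n => (hF.meas n).const_mul c, ?_⟩
  simp only [enorm_mul]
  rw [lpLint_const_mul enorm_ne_top]
  exact ENNReal.mul_lt_top enorm_lt_top hF.finite

theorem zero : LPIntegrable fun _ : Config d => (0 : ℝ) :=
  ⟨fun _ => aestronglyMeasurable_const, by simp [lpLint]⟩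

theorem sum {κ : Type*} (s : Finset κ) {H : κ → Config d → ℝ} (h : ∀ i ∈ s, LPIntegrable (H i)) :
    LPIntegrable fun ξ => ∑ i ∈ s, H i ξ := by
  classical
  induction s using Finset.induction_on with
  | empty => simpa using zero
  | insert a s ha ih =>
    simp only [Finset.sum_insert ha]
    exact (h a (by simp)).add (ih fun i hi => h i (by simp [hi]))

end LPIntegrable

theorem lpInt_const_mul (c : ℝ) (F : Config d → ℝ) : lpInt (fun ξ => c * F ξ) = c * lpInt F := by
  rw [lpInt, lpInt, ← tsum_mul_left]
  refine tsum_congr fun k => ?_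
  rw [integral_const_mul]; ring

theorem lpInt_add {F G : Config d → ℝ} (hF : LPIntegrable F) (hG : LPIntegrable G) :
    lpInt (fun ξ => F ξ + G ξ) = lpInt F + lpInt G := by
  rw [lpInt, lpInt, lpInt, ← hF.summable.tsum_add hG.summable]
  refine tsum_congr fun k => ?_
  rw [integral_add (hF.integrable k) (hG.integrable k), mul_add]

theorem lpInt_sum {κ : Type*} (s : Finset κ) {H : κ → Config d → ℝ}
    (h : ∀ i ∈ s, LPIntegrable (H i)) :
    lpInt (fun ξ => ∑ i ∈ s, H i ξ) = ∑ i ∈ s, lpInt (H i) := by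
  classical
  induction s using Finset.induction_on with
  | empty => simp [lpInt]
  | insert a s ha ih =>
    simp only [Finset.sum_insert ha]
    rw [lpInt_add (h a (by simp)) (LPIntegrable.sum s fun i hi => h i (by simp [hi])),
      ih fun i hi => h i (by simp [hi])]

theorem famConf_map {I : Type*} [Fintype I] {β : Type*} (y : I → Pt d) (g : Pt d → β) :
    (famConf y).map g = Finset.univ.val.map fun i => g (y i) := by
  rw [famConf, Multiset.map_map]; rfl

theorem famConf_map_prod {I : Type*} [Fintype I] {β : Type*} [CommMonoid β] (y : I → Pt d)
    (g : Pt d → β) : ((famConf y).map g).prod = ∏ i, g (y i) := by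
  rw [famConf_map]; rfl

theorem card_famConf {n : ℕ} (y : Fin n → Pt d) : Multiset.card (famConf y) = n := by
  simp [famConf]

theorem lintegral_prod_ofReal {g : Pt d → ℝ} (hg : Integrable g) (hg0 : ∀ x, 0 ≤ g x) (k : ℕ) :
    ∫⁻ y : Fin k → Pt d, ENNReal.ofReal (∏ i, g (y i)) = ENNReal.ofReal ((∫ x, g x) ^ k) := by
  have hI : Integrable (fun y : Fin k → Pt d => ∏ i, g (y i)) := Integrable.fintype_prod fun _ => hg
  rw [← ofReal_integral_eq_lintegral_ofReal hI (ae_of_all _ fun y => Finset.prod_nonneg fun i _ => hg0 _)]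
  rw [integral_fintype_prod_volume_eq_pow, Fintype.card_fin]

theorem lpLint_prod_lt_top {g : Pt d → ℝ} (hg : Integrable g) (hg0 : ∀ x, 0 ≤ g x) :
    lpLint (fun ξ => ENNReal.ofReal (ξ.map g).prod) < ⊤ := by
  rw [lpLint_eq]
  simp only [famConf_map_prod, lintegral_prod_ofReal hg hg0]
  have h : ∀ k : ℕ, (k.factorial : ℝ≥0∞)⁻¹ * ENNReal.ofReal ((∫ x, g x) ^ k) =
      ENNReal.ofReal ((∫ x, g x) ^ k / k.factorial) := by
    intro k
    rw [ENNReal.ofReal_div_of_pos (by positivity), ENNReal.ofReal_natCast, div_eq_mul_inv, mul_comm]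
  simp only [h]
  have h0 : 0 ≤ ∫ x, g x := integral_nonneg hg0
  rw [← ENNReal.ofReal_tsum_of_nonneg (fun k => by positivity) (Real.summable_pow_div_factorial _)]
  exact ENNReal.ofReal_lt_top

theorem LPIntegrable.of_le_prod {F : Config d → ℝ}
    (hF : ∀ n, AEStronglyMeasurable (fun y : Fin n → Pt d => F (famConf y)) volume)
    {g : Pt d → ℝ} (hg : Integrable g) (hg0 : ∀ x, 0 ≤ g x) {M : ℝ}
    (h : ∀ ξ, |F ξ| ≤ M * (ξ.map g).prod) : LPIntegrable F := by
  refine ⟨hF, ?_⟩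
  have hM : 0 ≤ M := by simpa using (abs_nonneg _).trans (h 0)
  calc _ ≤ lpLint (fun ξ => ENNReal.ofReal M * ENNReal.ofReal (ξ.map g).prod) := by
        refine lpLint_mono fun ξ => ?_
        rw [← Real.enorm_abs, Real.enorm_of_nonneg (abs_nonneg _), ← ENNReal.ofReal_mul hM]
        exact ENNReal.ofReal_le_ofReal (h ξ)
    _ < ⊤ := by
        rw [lpLint_const_mul ENNReal.ofReal_ne_top]
        exact ENNReal.mul_lt_top ENNReal.ofReal_lt_top (lpLint_prod_lt_top hg hg0)

theorem abs_lpInt_le {F : Config d → ℝ} {g : Pt d → ℝ} (hg : Integrable g) {M : ℝ}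
    (h : ∀ ξ, |F ξ| ≤ M * (ξ.map g).prod) : |lpInt F| ≤ M * Real.exp (∫ x, g x) := by
  have hs : HasSum (fun k : ℕ => M * ((∫ x, g x) ^ k / k.factorial)) (M * Real.exp (∫ x, g x)) := by
    rw [Real.exp_eq_exp_ℝ]
    exact (NormedSpace.expSeries_div_hasSum_exp (∫ x, g x)).mul_left M
  rw [← Real.norm_eq_abs]
  refine tsum_of_norm_bounded hs fun k => ?_
  have hI : Integrable (fun y : Fin k → Pt d => M * ∏ i, g (y i)) :=
    Integrable.const_mul (Integrable.fintype_prod fun _ => hg) M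
  have h1 := norm_integral_le_of_norm_le (f := fun y => F (famConf y)) hI (ae_of_all _ fun y => by
    simpa only [famConf_map_prod, Real.norm_eq_abs] using h (famConf y))
  rw [integral_const_mul, integral_fintype_prod_volume_eq_pow, Fintype.card_fin] at h1
  rw [norm_mul, Real.norm_of_nonneg (by positivity)]
  refine (mul_le_mul_of_nonneg_left h1 (by positivity)).trans (le_of_eq ?_)
  field_simp

end LebesguePoisson

/-! ### Expansion of a product inside a Lebesgue-Poisson integral. -/

section Fubini

variable {d : ℕ} {f g : Pt d → ℝ} {W : Config d → ℝ} {M a : ℝ}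

theorem aestronglyMeasurable_famConf_add
    (hW : ∀ n, AEStronglyMeasurable (fun y : Fin n → Pt d => W (famConf y)) volume) (k l : ℕ) :
    AEStronglyMeasurable (fun p : (Fin k → Pt d) × (Fin l → Pt d) =>
      W (famConf p.1 + famConf p.2)) volume := by
  obtain ⟨S, -, hS⟩ := Finset.exists_subset_card_eq
    (show k ≤ (Finset.univ : Finset (Fin (k + l))).card by simp)
  obtain ⟨e, h1, h2, -⟩ := exists_split (d := d) S hS rfl
  have := (hW (k + l)).comp_measurePreserving (MeasurePreserving.symm e h1)
  refine this.congr (ae_of_all _ fun p => ?_)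
  simp only [Function.comp]
  rw [h2, e.apply_symm_apply]

/-- The integrand of the expanded Lebesgue-Poisson integral. -/
def splitTerm (f : Pt d → ℝ) (W : Config d → ℝ) (k l : ℕ)
    (p : (Fin k → Pt d) × (Fin l → Pt d)) : ℝ :=
  (∏ i, f (p.1 i)) * W (famConf p.1 + famConf p.2)

theorem aestronglyMeasurable_splitTerm (hf : Integrable f)
    (hW : ∀ n, AEStronglyMeasurable (fun y : Fin n → Pt d => W (famConf y)) volume) (k l : ℕ) :
    AEStronglyMeasurable (splitTerm f W k l) volume := by
  have h1 : Integrable (fun y : Fin k → Pt d => ∏ i, f (y i)) := Integrable.fintype_prod fun _ => hf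
  exact h1.aestronglyMeasurable.comp_fst.mul (aestronglyMeasurable_famConf_add hW k l)

theorem abs_splitTerm_le (hg0 : ∀ x, 0 ≤ g x) (hga : ∀ x, g x ≤ a)
    (hWb : ∀ ξ, |W ξ| ≤ M * (ξ.map g).prod) {k l : ℕ} (p : (Fin k → Pt d) × (Fin l → Pt d)) :
    |splitTerm f W k l p| ≤ (M * ∏ i, a * |f (p.1 i)|) * ∏ i, g (p.2 i) := by
  have hM : 0 ≤ M := by simpa using (abs_nonneg _).trans (hWb 0)
  have h := hWb (famConf p.1 + famConf p.2)
  rw [Multiset.map_add, Multiset.prod_add, famConf_map_prod, famConf_map_prod] at h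
  rw [splitTerm, abs_mul, Finset.abs_prod]
  calc _ ≤ (∏ i, |f (p.1 i)|) * (M * ((∏ i, g (p.1 i)) * ∏ i, g (p.2 i))) :=
        mul_le_mul_of_nonneg_left h (Finset.prod_nonneg fun _ _ => abs_nonneg _)
    _ = (M * ∏ i, g (p.1 i) * |f (p.1 i)|) * ∏ i, g (p.2 i) := by
        rw [Finset.prod_mul_distrib]; ring
    _ ≤ _ := by
        refine mul_le_mul_of_nonneg_right (mul_le_mul_of_nonneg_left ?_ hM)
          (Finset.prod_nonneg fun _ _ => hg0 _)
        exact Finset.prod_le_prod (fun _ _ => mul_nonneg (hg0 _) (abs_nonneg _))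
          fun _ _ => mul_le_mul_of_nonneg_right (hga _) (abs_nonneg _)

theorem integrable_splitBound (hf : Integrable f) (hg : Integrable g) (k l : ℕ) :
    Integrable (fun p : (Fin k → Pt d) × (Fin l → Pt d) =>
      (M * ∏ i, a * |f (p.1 i)|) * ∏ i, g (p.2 i)) := by
  have h1 : Integrable (fun y : Fin k → Pt d => M * ∏ i, a * |f (y i)|) :=
    Integrable.const_mul (Integrable.fintype_prod fun _ => (hf.abs.const_mul a)) M
  have h2 : Integrable (fun y : Fin l → Pt d => ∏ i, g (y i)) := Integrable.fintype_prod fun _ => hg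
  exact h1.mul_prod h2

theorem integrable_splitTerm (hf : Integrable f) (hg : Integrable g) (hg0 : ∀ x, 0 ≤ g x)
    (hga : ∀ x, g x ≤ a)
    (hW : ∀ n, AEStronglyMeasurable (fun y : Fin n → Pt d => W (famConf y)) volume)
    (hWb : ∀ ξ, |W ξ| ≤ M * (ξ.map g).prod) (k l : ℕ) :
    Integrable (splitTerm f W k l) :=
  (integrable_splitBound (M := M) (a := a) hf hg k l).mono' (aestronglyMeasurable_splitTerm hf hW k l)
    (ae_of_all _ fun p => abs_splitTerm_le hg0 hga hWb p)

theorem integral_abs_splitTerm_le (hf : Integrable f) (hg : Integrable g) (hg0 : ∀ x, 0 ≤ g x)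
    (hga : ∀ x, g x ≤ a)
    (hW : ∀ n, AEStronglyMeasurable (fun y : Fin n → Pt d => W (famConf y)) volume)
    (hWb : ∀ ξ, |W ξ| ≤ M * (ξ.map g).prod) (k l : ℕ) :
    ∫ p, |splitTerm f W k l p| ≤ M * (a * ∫ x, |f x|) ^ k * (∫ x, g x) ^ l := by
  refine (integral_mono (integrable_splitTerm hf hg hg0 hga hW hWb k l).abs
    (integrable_splitBound (M := M) (a := a) hf hg k l)
    fun p => abs_splitTerm_le hg0 hga hWb p).trans (le_of_eq ?_)
  rw [Measure.volume_eq_prod, integral_prod_mul (fun y : Fin k → Pt d => M * ∏ i, a * |f (y i)|)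
    (fun y : Fin l → Pt d => ∏ i, g (y i)), integral_const_mul,
    integral_fintype_prod_volume_eq_pow (fun x => a * |f x|), integral_fintype_prod_volume_eq_pow,
    Fintype.card_fin, Fintype.card_fin, integral_const_mul]

/-- `∏ (1 + f)` is expanded over subsets of the indices. By symmetry each integral depends only on
the size `k` of the subset, and `binom n k / n! = 1 / (k! (n-k)!)`. -/
theorem integral_prod_one_add_mul (hf : Integrable f) (hg : Integrable g) (hg0 : ∀ x, 0 ≤ g x)
    (hga : ∀ x, g x ≤ a)
    (hW : ∀ n, AEStronglyMeasurable (fun y : Fin n → Pt d => W (famConf y)) volume)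
    (hWb : ∀ ξ, |W ξ| ≤ M * (ξ.map g).prod) (n : ℕ) :
    (n.factorial : ℝ)⁻¹ * ∫ y : Fin n → Pt d, (∏ i, (1 + f (y i))) * W (famConf y) =
      ∑ p ∈ Finset.HasAntidiagonal.antidiagonal n, ((p.1.factorial : ℝ)⁻¹ * (p.2.factorial : ℝ)⁻¹) *
        ∫ q, splitTerm f W p.1 p.2 q := by
  have key : ∀ S : Finset (Fin n),
      Integrable (fun y : Fin n → Pt d => (∏ i ∈ S, f (y i)) * W (famConf y)) ∧
      ∫ y : Fin n → Pt d, (∏ i ∈ S, f (y i)) * W (famConf y) =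
        ∫ q, splitTerm f W S.card (n - S.card) q := by
    intro S
    have hS : S.card ≤ n := by simpa using S.card_le_univ
    obtain ⟨e, h1, h2, h3⟩ := exists_split (d := d) S rfl (show S.card + (n - S.card) = n by omega)
    have h4 : (fun y : Fin n → Pt d => (∏ i ∈ S, f (y i)) * W (famConf y)) =
        fun y => splitTerm f W S.card (n - S.card) (e y) := by
      funext y
      rw [splitTerm, h3, h2]
    rw [h4]
    exact ⟨(h1.integrable_comp_emb e.measurableEmbedding).2
      (integrable_splitTerm hf hg hg0 hga hW hWb _ _), h1.integral_comp e.measurableEmbedding _⟩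
  have h1 : ∀ y : Fin n → Pt d, (∏ i, (1 + f (y i))) * W (famConf y) =
      ∑ S : Finset (Fin n), (∏ i ∈ S, f (y i)) * W (famConf y) := by
    intro y
    rw [Finset.prod_one_add, Finset.sum_mul, Finset.powerset_univ]
  simp only [h1]
  rw [integral_finsetSum _ fun S _ => (key S).1, Finset.sum_congr rfl fun S _ => (key S).2,
    ← Finset.powerset_univ, Finset.sum_powerset_apply_card
      (fun k => ∫ q, splitTerm f W k (n - k) q), Finset.card_univ, Fintype.card_fin,
    Finset.Nat.sum_antidiagonal_eq_sum_range_succ_mk, Finset.mul_sum]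
  refine Finset.sum_congr rfl fun k hk => ?_
  have hk' : k ≤ n := by simpa [Nat.lt_succ_iff] using hk
  rw [nsmul_eq_mul, Nat.cast_choose ℝ hk']
  have := n.factorial_ne_zero
  field_simp

/-- Summing `integral_prod_one_add_mul` over `n` rearranges the series into a double sum over the
selected and the unselected points. The bound by products of integrable functions makes everything
absolutely convergent. -/
theorem lpInt_prod_one_add_mul (hf : Integrable f) (hg : Integrable g) (hg0 : ∀ x, 0 ≤ g x)
    (hga : ∀ x, g x ≤ a)
    (hW : ∀ n, AEStronglyMeasurable (fun y : Fin n → Pt d => W (famConf y)) volume)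
    (hWb : ∀ ξ, |W ξ| ≤ M * (ξ.map g).prod) :
    lpInt (fun ξ => (ξ.map fun y => 1 + f y).prod * W ξ) =
      lpInt fun ξ => (ξ.map f).prod * lpInt fun ζ => W (ξ + ζ) := by
  have ha : 0 ≤ a := (hg0 0).trans (hga 0)
  have hM : 0 ≤ M := by simpa using (abs_nonneg _).trans (hWb 0)
  set G : ℕ × ℕ → ℝ := fun p => ((p.1.factorial : ℝ)⁻¹ * (p.2.factorial : ℝ)⁻¹) *
        ∫ q, splitTerm f W p.1 p.2 q with hG
  have hbound : ∀ k l : ℕ, ((k.factorial : ℝ)⁻¹ * (l.factorial : ℝ)⁻¹) *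
      ∫ q, |splitTerm f W k l q| ≤
      (M * ((a * ∫ x, |f x|) ^ k / k.factorial)) * ((∫ x, g x) ^ l / l.factorial) := by
    intro k l
    refine (mul_le_mul_of_nonneg_left
      (integral_abs_splitTerm_le hf hg hg0 hga hW hWb k l) (by positivity)).trans (le_of_eq ?_)
    field_simp
  have hB : Summable fun p : ℕ × ℕ =>
      (M * ((a * ∫ x, |f x|) ^ p.1 / p.1.factorial)) * ((∫ x, g x) ^ p.2 / p.2.factorial) := by
    have hg1 : 0 ≤ ∫ x, g x := integral_nonneg hg0
    have hf1 : 0 ≤ ∫ x, |f x| := integral_nonneg fun _ => abs_nonneg _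
    exact ((Real.summable_pow_div_factorial _).mul_left M).mul_of_nonneg
      (Real.summable_pow_div_factorial _) (fun k => by positivity) (fun l => by positivity)
  have hGs : Summable G := by
    refine Summable.of_norm_bounded hB fun p => ?_
    refine le_trans ?_ (hbound p.1 p.2)
    rw [hG, norm_mul, Real.norm_of_nonneg (by positivity)]
    exact mul_le_mul_of_nonneg_left (norm_integral_le_integral_norm _) (by positivity)
  have hL : lpInt (fun ξ => (ξ.map fun y => 1 + f y).prod * W ξ) =
      ∑' n, ∑ p ∈ Finset.HasAntidiagonal.antidiagonal n, G p := by
    refine tsum_congr fun n => ?_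
    simp only [famConf_map_prod]
    exact integral_prod_one_add_mul hf hg hg0 hga hW hWb n
  have hD : ∑' n, ∑ p ∈ Finset.HasAntidiagonal.antidiagonal n, G p = ∑' p, G p := by
    rw [← Finset.HasAntidiagonal.sigmaAntidiagonalEquivProd.tsum_eq G]
    have hs : Summable (G ∘ Finset.HasAntidiagonal.sigmaAntidiagonalEquivProd) :=
      Finset.HasAntidiagonal.sigmaAntidiagonalEquivProd.summable_iff.2 hGs
    refine Eq.trans ?_ (Summable.tsum_sigma' (fun n => (hasSum_fintype _).summable) hs).symm
    refine tsum_congr fun n => ?_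
    rw [tsum_fintype, ← Finset.sum_coe_sort]
    rfl
  rw [hL, hD, hGs.tsum_prod]
  refine tsum_congr fun k => ?_
  simp only [hG, mul_assoc]
  rw [tsum_mul_left]
  congr 1
  have hFi : ∀ l : ℕ, Integrable (fun y : Fin k → Pt d =>
      (l.factorial : ℝ)⁻¹ * ∫ y' : Fin l → Pt d, splitTerm f W k l (y, y')) := fun l =>
    (integrable_splitTerm hf hg hg0 hga hW hWb k l).integral_prod_left.const_mul _
  have hFs : Summable fun l : ℕ => ∫ y : Fin k → Pt d,
      ‖(l.factorial : ℝ)⁻¹ * ∫ y' : Fin l → Pt d, splitTerm f W k l (y, y')‖ := by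
    have h0 : Summable fun l : ℕ => (M * (a * ∫ x, |f x|) ^ k) * ((∫ x, g x) ^ l / l.factorial) :=
      (Real.summable_pow_div_factorial _).mul_left _
    refine Summable.of_nonneg_of_le (fun l => integral_nonneg fun _ => norm_nonneg _)
      (fun l => ?_) h0
    have hi := integrable_splitTerm hf hg hg0 hga hW hWb k l
    calc _ ≤ ∫ y : Fin k → Pt d, (l.factorial : ℝ)⁻¹ *
            ∫ y' : Fin l → Pt d, |splitTerm f W k l (y, y')| := by
          refine integral_mono (hFi l).norm (hi.abs.integral_prod_left.const_mul _) fun y => ?_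
          simp only
          rw [norm_mul, Real.norm_of_nonneg (by positivity)]
          exact mul_le_mul_of_nonneg_left (norm_integral_le_integral_norm _) (by positivity)
      _ = (l.factorial : ℝ)⁻¹ * ∫ q, |splitTerm f W k l q| := by
          rw [integral_const_mul, Measure.volume_eq_prod, integral_prod _ hi.abs]
      _ ≤ _ := by
          refine (mul_le_mul_of_nonneg_left
            (integral_abs_splitTerm_le hf hg hg0 hga hW hWb k l) (by positivity)).trans
            (le_of_eq ?_)
          field_simp
  have h3 := integral_tsum_of_summable_integral_norm hFi hFs
  calc _ = ∑' l : ℕ, ∫ y : Fin k → Pt d,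
        (l.factorial : ℝ)⁻¹ * ∫ y' : Fin l → Pt d, splitTerm f W k l (y, y') := by
        refine tsum_congr fun l => ?_
        rw [integral_const_mul, Measure.volume_eq_prod,
          integral_prod _ (integrable_splitTerm hf hg hg0 hga hW hWb k l)]
    _ = _ := by
        rw [h3]
        refine integral_congr_ae (ae_of_all _ fun y => ?_)
        simp only [famConf_map_prod, splitTerm, lpInt]
        rw [← tsum_mul_left]
        refine tsum_congr fun l => ?_
        rw [integral_const_mul]; ring

theorem aestronglyMeasurable_lpInt_add (hg : Integrable g) (hg0 : ∀ x, 0 ≤ g x)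
    (hW : ∀ (A : Config d) (n : ℕ),
      AEStronglyMeasurable (fun y : Fin n → Pt d => W (A + famConf y)) volume)
    (hWb : ∀ ξ, |W ξ| ≤ M * (ξ.map g).prod) (A : Config d) (k : ℕ) :
    AEStronglyMeasurable (fun y : Fin k → Pt d => lpInt fun ξ => W (A + famConf y + ξ)) volume := by
  have h1 : ∀ l : ℕ, AEStronglyMeasurable (fun y : Fin k → Pt d =>
      (l.factorial : ℝ)⁻¹ * ∫ y' : Fin l → Pt d, W (A + famConf y + famConf y')) volume := by
    intro l
    have := aestronglyMeasurable_famConf_add (W := fun ξ => W (A + ξ)) (hW A) k l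
    simp only [← add_assoc] at this
    exact this.integral_prod_right'.const_mul _
  refine aestronglyMeasurable_of_tendsto_ae atTop
    (f := fun n (y : Fin k → Pt d) => ∑ l ∈ Finset.range n, (l.factorial : ℝ)⁻¹ *
      ∫ y' : Fin l → Pt d, W (A + famConf y + famConf y'))
    (fun n => Finset.aestronglyMeasurable_fun_sum _ fun l _ => h1 l) (ae_of_all _ fun y => ?_)
  have : LPIntegrable fun ξ => W (A + famConf y + ξ) :=
    LPIntegrable.of_le_prod (hW _) hg hg0 (M := M * ((A + famConf y).map g).prod) fun ξ => by
      rw [mul_assoc, ← Multiset.prod_add, ← Multiset.map_add]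
      exact hWb _
  exact this.summable.hasSum.tendsto_sum_nat

end Fubini

end

section

open scoped ENNReal

/-! ### Cutoff correlation functions and the Kirkwood-Salsburg equation. -/

section KirkwoodSalsburg

variable {d : ℕ} (φ : ℝ → WithTop ℝ) (β z : ℝ) (j : Pt d → ℝ)

/-- The unnormalized Gibbs density with cutoff. -/
def gibbs (A : Config d) : ℝ := z ^ Multiset.card A * (chi j A * bw φ β A)

theorem gibbs_cons (x : Pt d) (A : Config d) :
    gibbs φ β z j (x ::ₘ A) =
      (z * j x * (A.map (pairFactor φ β x)).prod) * gibbs φ β z j A := by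
  simp only [gibbs, chi, bw_cons, Multiset.card_cons, Multiset.map_cons, Multiset.prod_cons, pow_succ]
  ring

theorem lpIntegral_eq (F : Config d → ℝ) :
    lpIntegral z F = lpInt fun ξ => z ^ Multiset.card ξ * F ξ := by
  refine tsum_congr fun n => ?_
  simp only [card_famConf, ← famConf_fin]
  rw [integral_const_mul]; ring

theorem cutoffCorrelation_eq (A : Config d) :
    cutoffCorrelation φ β z j A =
      lpInt (fun ξ => gibbs φ β z j (A + ξ)) / lpInt (gibbs φ β z j) := by
  rw [cutoffCorrelation, lpIntegral_eq, lpIntegral_eq, div_mul_eq_mul_div, ← lpInt_const_mul]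
  congr 1
  refine congrArg lpInt (funext fun ξ => ?_)
  rw [gibbs, Multiset.card_add, pow_add, mul_assoc]; rfl

variable {φ β z j}

theorem integrable_cutoff (hj : IsCutoff j) : Integrable j := by
  have h1 : IntegrableOn j (Function.support j) := by
    refine Measure.integrableOn_of_bounded (M := 1) hj.bounded_support.measure_lt_top.ne
      hj.measurable.aestronglyMeasurable (ae_of_all _ fun x => ?_)
    rw [Real.norm_of_nonneg (hj.nonneg x)]
    exact hj.le_one x
  exact (integrableOn_iff_integrable_of_support_subset subset_rfl).1 h1

theorem chi_nonneg (hj : IsCutoff j) (A : Config d) : 0 ≤ chi j A :=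
  Multiset.prod_nonneg fun a ha => by
    obtain ⟨x, -, rfl⟩ := Multiset.mem_map.1 ha
    exact hj.nonneg x

theorem gibbs_nonneg (hz : 0 < z) (hj : IsCutoff j) (A : Config d) : 0 ≤ gibbs φ β z j A :=
  mul_nonneg (pow_nonneg hz.le _) (mul_nonneg (chi_nonneg hj A) (bw_nonneg _ _ _))

theorem prod_map_const_mul (a : ℝ) (A : Config d) :
    (A.map fun y => a * j y).prod = a ^ Multiset.card A * chi j A := by
  rw [Multiset.prod_map_mul, Multiset.map_const', Multiset.prod_replicate, chi]

theorem abs_gibbs_le {B : ℝ} (hβ : 0 < β) (hz : 0 < z) (hstab : IsStable d φ B) (hj : IsCutoff j)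
    (A : Config d) :
    |gibbs φ β z j A| ≤ 1 * (A.map fun y => z * Real.exp (β * B) * j y).prod := by
  rw [abs_of_nonneg (gibbs_nonneg hz hj A), one_mul, prod_map_const_mul, gibbs, mul_pow, mul_assoc,
    mul_comm (chi j A)]
  refine mul_le_mul_of_nonneg_left (mul_le_mul_of_nonneg_right (bw_le hβ hstab A)
    (chi_nonneg hj A)) (pow_nonneg hz.le _)

theorem aestronglyMeasurable_gibbs_add (hf : AEStronglyMeasurable (mayer d φ β))
    (hj : IsCutoff j) (A : Config d) (n : ℕ) :
    AEStronglyMeasurable (fun y : Fin n → Pt d => gibbs φ β z j (A + famConf y)) volume := by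
  have h1 := aestronglyMeasurable_bw_add hf A (List.finRange n) (List.nodup_finRange n)
  have h2 : ∀ y : Fin n → Pt d, gibbs φ β z j (A + famConf y) = (z ^ (Multiset.card A + n) *
      ((chi j A * ∏ i, j (y i)) *
        bw φ β (A + (((List.finRange n).map y : List (Pt d)) : Multiset _)))) := by
    intro y
    rw [gibbs, Multiset.card_add, card_famConf, chi, Multiset.map_add, Multiset.prod_add,
      famConf_map_prod, famConf_fin, List.ofFn_eq_map]
    rfl
  simp only [h2]
  refine (AEStronglyMeasurable.mul ?_ h1).const_mul _
  refine AEStronglyMeasurable.const_mul ?_ _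
  exact (Finset.measurable_fun_prod _ fun i _ =>
    hj.measurable.comp (measurable_pi_apply i)).aestronglyMeasurable

variable {B : ℝ}

theorem LPIntegrable.gibbs (hf : AEStronglyMeasurable (mayer d φ β)) (hβ : 0 < β) (hz : 0 < z)
    (hstab : IsStable d φ B) (hj : IsCutoff j) : LPIntegrable (gibbs φ β z j) :=
  LPIntegrable.of_le_prod (fun n => by
      simpa only [zero_add] using aestronglyMeasurable_gibbs_add hf hj 0 n)
    ((integrable_cutoff hj).const_mul _)
    (fun x => mul_nonneg (by positivity) (hj.nonneg x)) (abs_gibbs_le hβ hz hstab hj)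

theorem one_le_lpInt_gibbs (hf : AEStronglyMeasurable (mayer d φ β)) (hβ : 0 < β) (hz : 0 < z)
    (hstab : IsStable d φ B) (hj : IsCutoff j) : 1 ≤ lpInt (gibbs φ β z j) := by
  -- The empty configuration alone contributes `1`.
  have h := (LPIntegrable.gibbs hf hβ hz hstab hj).summable.le_tsum 0 fun n _ =>
    mul_nonneg (by positivity) (integral_nonneg fun y => gibbs_nonneg hz hj _)
  refine le_trans (le_of_eq ?_) h
  have : ∀ y : Fin 0 → Pt d, gibbs φ β z j (famConf y) = 1 := fun y => by
    have : famConf y = 0 := by simp [famConf]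
    rw [this, PTCF.gibbs, bw_zero]; simp [chi]
  simp [this, Measure.real, volume_pi]

theorem cutoffCorrelation_zero (hf : AEStronglyMeasurable (mayer d φ β)) (hβ : 0 < β) (hz : 0 < z)
    (hstab : IsStable d φ B) (hj : IsCutoff j) : cutoffCorrelation φ β z j 0 = 1 := by
  rw [cutoffCorrelation_eq]
  simp only [zero_add]
  exact div_self (zero_lt_one.trans_le (one_le_lpInt_gibbs hf hβ hz hstab hj)).ne'

theorem aestronglyMeasurable_cutoffCorrelation_add (hf : AEStronglyMeasurable (mayer d φ β))
    (hβ : 0 < β) (hz : 0 < z) (hstab : IsStable d φ B) (hj : IsCutoff j) (A : Config d) (k : ℕ) :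
    AEStronglyMeasurable (fun y : Fin k → Pt d => cutoffCorrelation φ β z j (A + famConf y))
      volume := by
  simp only [cutoffCorrelation_eq, div_eq_mul_inv]
  exact (aestronglyMeasurable_lpInt_add ((integrable_cutoff hj).const_mul _)
    (fun x => mul_nonneg (by positivity) (hj.nonneg x)) (aestronglyMeasurable_gibbs_add hf hj)
    (abs_gibbs_le hβ hz hstab hj) A k).mul_const _

theorem exists_abs_cutoffCorrelation_le (hf : AEStronglyMeasurable (mayer d φ β))
    (hβ : 0 < β) (hz : 0 < z) (hstab : IsStable d φ B) (hj : IsCutoff j) :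
    ∃ M, 0 ≤ M ∧ ∀ A : Config d,
      |cutoffCorrelation φ β z j A| ≤ M * (z * Real.exp (β * B)) ^ Multiset.card A := by
  refine ⟨Real.exp (∫ x, z * Real.exp (β * B) * j x), by positivity, fun A => ?_⟩
  have h1 := abs_lpInt_le (F := fun ξ => gibbs φ β z j (A + ξ))
    ((integrable_cutoff hj).const_mul _)
    (M := (A.map fun y => z * Real.exp (β * B) * j y).prod) (fun ξ => by
      rw [← Multiset.prod_add, ← Multiset.map_add]
      simpa using abs_gibbs_le hβ hz hstab hj (A + ξ))
  have h2 := one_le_lpInt_gibbs hf hβ hz hstab hj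
  rw [cutoffCorrelation_eq, abs_div, abs_of_pos (zero_lt_one.trans_le h2)]
  refine (div_le_self (abs_nonneg _) h2).trans (h1.trans ?_)
  rw [mul_comm]
  refine mul_le_mul_of_nonneg_left ?_ (by positivity)
  rw [prod_map_const_mul]
  refine mul_le_of_le_one_right (by positivity) ?_
  rw [chi]
  refine Multiset.prod_induction (fun t => 0 ≤ t ∧ t ≤ 1) _ 
    (fun a b ha hb => ⟨mul_nonneg ha.1 hb.1, mul_le_one₀ ha.2 hb.1 hb.2⟩) ⟨zero_le_one, le_rfl⟩
    (fun a ha => ?_) |>.2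
  obtain ⟨x, -, rfl⟩ := Multiset.mem_map.1 ha
  exact ⟨hj.nonneg x, hj.le_one x⟩

/-- The Kirkwood-Salsburg equation. -/
theorem cutoffCorrelation_cons (hf : Integrable (mayer d φ β))
    (hβ : 0 < β) (hz : 0 < z) (hstab : IsStable d φ B) (hj : IsCutoff j) (x : Pt d) (A : Config d) :
    cutoffCorrelation φ β z j (x ::ₘ A) = (z * j x * (A.map (pairFactor φ β x)).prod) *
      lpInt fun ξ => (ξ.map fun y => mayer d φ β (x - y)).prod *
        cutoffCorrelation φ β z j (A + ξ) := by
  have hg0 : ∀ x, 0 ≤ z * Real.exp (β * B) * j x :=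
    fun x => mul_nonneg (by positivity) (hj.nonneg x)
  -- The interaction of `x` with the integrated particles is `∏ (1 + f(x - y))`; expanding it leaves
  -- the unnormalized correlation of `A + ξ` inside.
  have h1 := lpInt_prod_one_add_mul (W := fun ξ => gibbs φ β z j (A + ξ)) (hf.comp_sub_left x)
    ((integrable_cutoff hj).const_mul (z * Real.exp (β * B))) hg0
    (a := z * Real.exp (β * B)) (fun y => mul_le_of_le_one_right (by positivity) (hj.le_one y))
    (aestronglyMeasurable_gibbs_add hf.aestronglyMeasurable hj A)
    (M := (A.map fun y => z * Real.exp (β * B) * j y).prod) (fun ξ => by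
      rw [← Multiset.prod_add, ← Multiset.map_add]
      simpa using abs_gibbs_le hβ hz hstab hj (A + ξ))
  have h2 : (fun ξ => gibbs φ β z j (x ::ₘ A + ξ)) = fun ξ =>
      (z * j x * (A.map (pairFactor φ β x)).prod) *
        ((ξ.map fun y => 1 + mayer d φ β (x - y)).prod * gibbs φ β z j (A + ξ)) := by
    funext ξ
    rw [Multiset.cons_add, gibbs_cons, Multiset.map_add, Multiset.prod_add]
    rw [show (fun y => 1 + mayer d φ β (x - y)) = pairFactor φ β x from rfl]
    ring
  rw [cutoffCorrelation_eq, h2, lpInt_const_mul, h1, mul_div_assoc]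
  congr 1
  simp only [cutoffCorrelation_eq]
  rw [div_eq_mul_inv, mul_comm, ← lpInt_const_mul]
  refine congrArg lpInt (funext fun ξ => ?_)
  simp only [add_assoc]
  ring

end KirkwoodSalsburg

end

section

open scoped ENNReal
open SetFun

/-! ### Truncation as multiplication by a convolution inverse. -/

section Truncated

variable {d : ℕ} {φ : ℝ → WithTop ℝ} {β : ℝ} {z h : ℝ} {ρ : Config d → ℝ}

/-- A solution of the Kirkwood-Salsburg equations with a bounded activity profile. -/
structure IsKSSolution (φ : ℝ → WithTop ℝ) (β z h : ℝ) (ρ : Config d → ℝ) : Prop where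
  zero : ρ 0 = 1
  meas : ∀ A k, AEStronglyMeasurable (fun y : Fin k → Pt d => ρ (A + famConf y)) volume
  bound : ∃ M, 0 ≤ M ∧ ∀ A, |ρ A| ≤ M * h ^ Multiset.card A
  cons : ∀ x, ∃ ζ, 0 ≤ ζ ∧ ζ ≤ z ∧ ∀ A, ρ (x ::ₘ A) = (ζ * (A.map (pairFactor φ β x)).prod) *
    lpInt fun ξ => (ξ.map fun y => mayer d φ β (x - y)).prod * ρ (A + ξ)

theorem isKSSolution_cutoffCorrelation {B : ℝ} {j : Pt d → ℝ} (hf : Integrable (mayer d φ β))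
    (hβ : 0 < β) (hz : 0 < z) (hB : 0 ≤ B) (hstab : IsStable d φ B) (hj : IsCutoff j) :
    IsKSSolution φ β z (z * Real.exp (2 * β * B)) (cutoffCorrelation φ β z j) where
  zero := cutoffCorrelation_zero hf.aestronglyMeasurable hβ hz hstab hj
  meas := aestronglyMeasurable_cutoffCorrelation_add hf.aestronglyMeasurable hβ hz hstab hj
  bound := by
    obtain ⟨M, hM, h⟩ :=
      exists_abs_cutoffCorrelation_le hf.aestronglyMeasurable hβ hz hstab hj
    refine ⟨M, hM, fun A => (h A).trans (mul_le_mul_of_nonneg_left ?_ hM)⟩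
    have : β * B ≤ 2 * β * B := by nlinarith
    gcongr
  cons x := ⟨z * j x, mul_nonneg hz.le (hj.nonneg x), mul_le_of_le_one_right hz.le (hj.le_one x),
    cutoffCorrelation_cons hf hβ hz hstab hj x⟩

namespace IsKSSolution

theorem lpIntegrable (hρ : IsKSSolution φ β z h ρ) (hf : Integrable (mayer d φ β)) (hh : 0 ≤ h)
    (x : Pt d) (A : Config d) :
    LPIntegrable fun ξ => (ξ.map fun y => mayer d φ β (x - y)).prod * ρ (A + ξ) := by
  obtain ⟨M, hM, hb⟩ := hρ.bound
  have hfx := hf.comp_sub_left x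
  refine LPIntegrable.of_le_prod (g := fun y => h * |mayer d φ β (x - y)|)
    (M := M * h ^ Multiset.card A) (fun n => ?_)
    (hfx.abs.const_mul h) (fun y => mul_nonneg hh (abs_nonneg _)) fun ξ => ?_
  · simp only [famConf_map_prod]
    have h1 : Integrable (fun y : Fin n → Pt d => ∏ i, mayer d φ β (x - y i)) :=
      Integrable.fintype_prod fun _ => hfx
    exact h1.aestronglyMeasurable.mul (hρ.meas A n)
  · have h1 := hb (A + ξ)
    have h2 : |(ξ.map fun y => mayer d φ β (x - y)).prod| =
        (ξ.map fun y => |mayer d φ β (x - y)|).prod := by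
      induction ξ using Multiset.induction_on with
      | empty => simp
      | cons a s ih => simp [abs_mul, ih (hb _)]
    rw [abs_mul, h2, Multiset.prod_map_mul, Multiset.map_const', Multiset.prod_replicate]
    rw [Multiset.card_add, pow_add] at h1
    refine (mul_le_mul_of_nonneg_left h1 ?_).trans (le_of_eq (by ring))
    exact Multiset.prod_nonneg fun a ha => by
      obtain ⟨x, -, rfl⟩ := Multiset.mem_map.1 ha
      exact abs_nonneg _

end IsKSSolution

variable {ι : Type} [DecidableEq ι] (η : ι → Config d)

/-- The correlation function of a configuration together with a family of clusters. -/
def clusterCorr (ρ : Config d → ℝ) (A : Config d) : SetFun ι ℝ := ⟨fun I => ρ (A + ∑ i ∈ I, η i)⟩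

theorem clusterCorr_apply (A : Config d) (I : Finset ι) :
    clusterCorr η ρ A I = ρ (A + ∑ i ∈ I, η i) := rfl

/-- The interaction of a point with a cluster. -/
def pointCluster (φ : ℝ → WithTop ℝ) (β : ℝ) (x : Pt d) (j : ι) : ℝ :=
  ((η j).map (pairFactor φ β x)).prod - 1

theorem prod_map_sum_pairFactor (x : Pt d) (I : Finset ι) :
    ((∑ i ∈ I, η i).map (pairFactor φ β x)).prod =
      ∑ J ∈ I.powerset, ∏ j ∈ J, pointCluster η φ β x j := by
  rw [← Finset.prod_one_add]
  induction I using Finset.induction_on with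
  | empty => simp
  | insert a s ha ih =>
    rw [Finset.sum_insert ha, Finset.prod_insert ha, Multiset.map_add, Multiset.prod_add, ih,
      pointCluster]
    ring

variable {η}

/-- The Kirkwood-Salsburg equation for truncated correlation functions. -/
theorem IsKSSolution.truncated_cons (hρ : IsKSSolution φ β z h ρ) (hf : Integrable (mayer d φ β))
    (hh : 0 ≤ h) (r : SetFun ι ℝ) (x : Pt d) : ∃ ζ, 0 ≤ ζ ∧ ζ ≤ z ∧ ∀ (A : Config d) (L : Finset ι),
      (clusterCorr η ρ (x ::ₘ A) * r) L = (ζ * (A.map (pairFactor φ β x)).prod) *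
        ∑ J ∈ L.powerset, (∏ j ∈ J, pointCluster η φ β x j) *
          lpInt fun ξ => (ξ.map fun y => mayer d φ β (x - y)).prod *
            (clusterCorr η ρ (ξ + (A + ∑ j ∈ J, η j)) * r) (L \ J) := by
  obtain ⟨ζ, h0, h1, hcons⟩ := hρ.cons x
  refine ⟨ζ, h0, h1, fun A L => ?_⟩
  set f := fun ξ : Config d => (ξ.map fun y => mayer d φ β (x - y)).prod with hfdef
  -- `J` is the set of clusters that interact with `x`; they join the configuration, and the others
  -- remain in the set argument. Convolution with `r` then acts on the latter only.
  have hA : ∀ I : Finset ι, clusterCorr η ρ (x ::ₘ A) I = ∑ J ∈ I.powerset,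
      (ζ * (A.map (pairFactor φ β x)).prod) * ((∏ j ∈ J, pointCluster η φ β x j) *
        lpInt fun ξ => f ξ * clusterCorr η ρ (ξ + (A + ∑ j ∈ J, η j)) (I \ J)) := by
    intro I
    rw [clusterCorr_apply, Multiset.cons_add, hcons, Multiset.map_add, Multiset.prod_add,
      prod_map_sum_pairFactor, ← mul_assoc, mul_assoc, Finset.sum_mul, Finset.mul_sum]
    refine Finset.sum_congr rfl fun J hJ => ?_
    congr 3
    funext ξ
    rw [clusterCorr_apply, ← Finset.sum_sdiff (Finset.mem_powerset.1 hJ)]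
    congr 2
    abel
  have hlin : ∀ J : Finset ι, (lpInt fun ξ => f ξ *
      (clusterCorr η ρ (ξ + (A + ∑ j ∈ J, η j)) * r) (L \ J)) = ∑ D ∈ (L \ J).powerset,
        (lpInt fun ξ => f ξ * clusterCorr η ρ (ξ + (A + ∑ j ∈ J, η j)) D) * r ((L \ J) \ D) := by
    intro J
    simp only [mul_apply, Finset.mul_sum]
    have hI : ∀ D : Finset ι, LPIntegrable fun ξ =>
        r ((L \ J) \ D) * (f ξ * clusterCorr η ρ (ξ + (A + ∑ j ∈ J, η j)) D) := by
      intro D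
      refine LPIntegrable.const_mul ?_ _
      have := hρ.lpIntegrable hf hh x (A + ∑ j ∈ J, η j + ∑ j ∈ D, η j)
      have e : (fun ξ => f ξ * clusterCorr η ρ (ξ + (A + ∑ j ∈ J, η j)) D) = fun ξ =>
          (ξ.map fun y => mayer d φ β (x - y)).prod *
            ρ (A + ∑ j ∈ J, η j + ∑ j ∈ D, η j + ξ) := by
        funext ξ
        rw [clusterCorr_apply]
        congr 2
        abel
      rw [e]
      exact this
    have h2 : ∀ (ξ : Config d) (D : Finset ι),
        f ξ * (clusterCorr η ρ (ξ + (A + ∑ j ∈ J, η j)) D * r ((L \ J) \ D)) =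
        r ((L \ J) \ D) * (f ξ * clusterCorr η ρ (ξ + (A + ∑ j ∈ J, η j)) D) := fun ξ D => by ring
    simp only [h2]
    rw [lpInt_sum _ fun D _ => hI D]
    refine Finset.sum_congr rfl fun D _ => ?_
    rw [lpInt_const_mul, mul_comm]
  change _ = (ζ * (A.map (pairFactor φ β x)).prod) *
    ∑ J ∈ L.powerset, (∏ j ∈ J, pointCluster η φ β x j) *
      lpInt fun ξ => f ξ * (clusterCorr η ρ (ξ + (A + ∑ j ∈ J, η j)) * r) (L \ J)
  simp only [hlin]
  rw [mul_apply]
  simp only [hA, Finset.sum_mul]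
  rw [sum_powerset_powerset fun J D E => (ζ * (A.map (pairFactor φ β x)).prod) *
    ((∏ j ∈ J, pointCluster η φ β x j) *
        lpInt fun ξ => f ξ * clusterCorr η ρ (ξ + (A + ∑ j ∈ J, η j)) D) * r E, Finset.mul_sum]
  refine Finset.sum_congr rfl fun J _ => ?_
  rw [Finset.mul_sum, Finset.mul_sum]
  refine Finset.sum_congr rfl fun D _ => ?_
  ring

end Truncated

/-! ### The comparison principle. -/

section Comparison

variable {d : ℕ} {φ : ℝ → WithTop ℝ} {β : ℝ} {z h B : ℝ} {ρ : Config d → ℝ}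
variable {ι : Type} [DecidableEq ι] {η : ι → Config d}

/-- Additivity holds for arbitrary `F`, since one measurable summand suffices. -/
theorem lpLint_add_prod {fh : Pt d → ℝ≥0∞} (hfm : Measurable fh) (x : Pt d) (c v : ℝ≥0∞)
    (F : Config d → ℝ≥0∞) :
    lpLint (fun ξ => (ξ.map fun y => fh (x - y)).prod * (F ξ + c * v ^ Multiset.card ξ)) =
      lpLint (fun ξ => (ξ.map fun y => fh (x - y)).prod * F ξ) +
        c * lpLint (fun ξ => (ξ.map fun y => fh (x - y)).prod * v ^ Multiset.card ξ) := by
  have hm : ∀ k : ℕ, Measurable fun y : Fin k → Pt d => (∏ i, fh (x - y i)) * v ^ k := fun k =>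
    (Finset.measurable_fun_prod _ fun i _ =>
      (hfm.comp (measurable_const_sub x)).comp (measurable_pi_apply i)).mul_const _
  simp only [lpLint_eq, famConf_map_prod, card_famConf]
  rw [← ENNReal.tsum_mul_left, ← ENNReal.tsum_add]
  refine tsum_congr fun k => ?_
  rw [mul_left_comm, ← lintegral_const_mul _ (hm k), ← mul_add,
    ← lintegral_add_right _ ((hm k).const_mul c)]
  congr 1
  refine lintegral_congr fun y => ?_
  ring

/-- The exponential formula `lpLint_confFun` without clusters, obtained with `ι = Empty`. -/
theorem lpLint_prod_pow {fh : Pt d → ℝ≥0∞} (hfm : Measurable fh) (x : Pt d) (v : ℝ≥0∞) {c : ℝ}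
    (hc : 0 ≤ c) (hv : v * ∫⁻ y, fh y = ENNReal.ofReal c) :
    lpLint (fun ξ => (ξ.map fun y => fh (x - y)).prod * v ^ Multiset.card ξ) =
      ENNReal.ofReal (Real.exp c) := by
  have h := lpLint_confFun (ι := Empty) hfm v (E := fun _ => 0) (Meas.const _) x 0 ∅
  have h1 : ∀ ξ : Config d, confFun v (fun _ => (0 : SetFun Empty ℝ≥0∞)) (ξ + 0) ∅ =
      v ^ Multiset.card ξ := by
    intro ξ
    rw [add_zero, confFun, Multiset.map_const', Multiset.prod_replicate, pow_empty, rootFun_apply,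
      exp_zero]
    simp [one_apply]
  simp only [h1] at h
  have h2 : pairFun fh v (fun _ => (0 : SetFun Empty ℝ≥0∞)) x = single ∅ (ENNReal.ofReal c) := by
    refine ext_apply fun S => ?_
    rw [Subsingleton.elim S ∅, single_apply, if_pos rfl, ← hv]
    have hfx : Measurable fun y => fh (x - y) := hfm.comp (measurable_const_sub x)
    change ∫⁻ y, fh (x - y) * rootFun v 0 ∅ = _
    rw [rootFun_apply, exp_zero, one_apply, if_pos rfl, mul_one,
      lintegral_mul_const _ hfx, mul_comm,
      lintegral_sub_left_eq_self (fun y => fh y) x]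
  rw [h, h2, exp_single_empty c hc, mul_empty, single_apply, if_pos rfl]
  simp [confFun, one_apply]

theorem enorm_multiset_prod_le {X : Type*} (s : Multiset X) (f : X → ℝ) (g : X → ℝ≥0∞)
    (h : ∀ x, ‖f x‖ₑ ≤ g x) : ‖(s.map f).prod‖ₑ ≤ (s.map g).prod := by
  induction s using Multiset.induction_on with
  | empty => simp
  | cons a s ih =>
    simp only [Multiset.map_cons, Multiset.prod_cons, enorm_mul]
    exact mul_le_mul' (h a) ih

theorem enorm_finset_prod {X : Type*} (s : Finset X) (f : X → ℝ) :
    ‖∏ x ∈ s, f x‖ₑ = ∏ x ∈ s, ‖f x‖ₑ := by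
  classical
  induction s using Finset.induction_on with
  | empty => simp
  | insert a s ha ih => rw [Finset.prod_insert ha, Finset.prod_insert ha, enorm_mul, ih]

theorem prod_pairFactor_nonneg (x : Pt d) (A : Config d) :
    0 ≤ (A.map (pairFactor φ β x)).prod :=
  Multiset.prod_nonneg fun a ha => by
    obtain ⟨y, -, rfl⟩ := Multiset.mem_map.1 ha
    exact pairFactor_nonneg _ _ _ _

theorem IsKSSolution.enorm_truncated_le_step (hρ : IsKSSolution φ β z h ρ)
    (hf : Integrable (mayer d φ β)) (hβ : 0 < β) (hz : 0 < z) (hstab : IsStable d φ B)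
    (hh : h = z * Real.exp (2 * β * B)) (r : SetFun ι ℝ) {fh : Pt d → ℝ≥0∞}
    (hfh : ∀ x, ‖mayer d φ β x‖ₑ ≤ fh x) {A : Config d} (hA : A ≠ 0) :
    ∃ x A', A = x ::ₘ A' ∧ ∀ L : Finset ι, ‖(clusterCorr η ρ A * r) L‖ₑ ≤
      ENNReal.ofReal h * ∑ J ∈ L.powerset, (∏ j ∈ J, ‖pointCluster η φ β x j‖ₑ) *
        lpLint fun ξ => (ξ.map fun y => fh (x - y)).prod *
          ‖(clusterCorr η ρ (ξ + (A' + ∑ j ∈ J, η j)) * r) (L \ J)‖ₑ := by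
  have hh0 : 0 ≤ h := by rw [hh]; positivity
  obtain ⟨x, A', rfl, hP⟩ := exists_good_point hβ hstab hA
  refine ⟨x, A', rfl, fun L => ?_⟩
  obtain ⟨ζ, h0, h1, hcons⟩ := hρ.truncated_cons (η := η) hf hh0 r x
  have hP0 := prod_pairFactor_nonneg (φ := φ) (β := β) x A'
  rw [hcons, enorm_mul, Real.enorm_of_nonneg (mul_nonneg h0 hP0)]
  refine mul_le_mul' (ENNReal.ofReal_le_ofReal ?_) ((enorm_sum_le _ _).trans
    (Finset.sum_le_sum fun J _ => ?_))
  · rw [hh]; exact mul_le_mul h1 hP hP0 hz.le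
  · rw [enorm_mul, enorm_finset_prod]
    refine mul_le_mul' le_rfl ((enorm_lpInt_le _).trans (lpLint_mono fun ξ => ?_))
    rw [enorm_mul]
    exact mul_le_mul' (enorm_multiset_prod_le _ _ _ fun y => hfh _) le_rfl

/-- A supersolution of the Kirkwood-Salsburg inequalities dominates the truncated correlation
functions. -/
theorem IsKSSolution.enorm_truncated_le (hρ : IsKSSolution φ β z h ρ)
    (hf : Integrable (mayer d φ β)) (hβ : 0 < β) (hz : 0 < z) (hstab : IsStable d φ B)
    (hh : h = z * Real.exp (2 * β * B)) {r : SetFun ι ℝ}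
    (hr : ∀ S, (clusterCorr η ρ 0 * r) S = (1 : SetFun ι ℝ) S) {fh : Pt d → ℝ≥0∞}
    (hfm : Measurable fh) (hfh : ∀ x, ‖mayer d φ β x‖ₑ ≤ fh x)
    {Ψ : Config d → Finset ι → ℝ≥0∞} (hΨ0 : 1 ≤ Ψ 0 ∅)
    (hΨ : ∀ x A L, ENNReal.ofReal h * ∑ J ∈ L.powerset,
      (∏ j ∈ J, ‖pointCluster η φ β x j‖ₑ) * lpLint (fun ξ =>
        (ξ.map fun y => fh (x - y)).prod * Ψ (ξ + (A + ∑ j ∈ J, η j)) (L \ J)) ≤ Ψ (x ::ₘ A) L)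
    {v c : ℝ} (hv : h ≤ v) (hc : 0 ≤ c) (hvc : ENNReal.ofReal v * ∫⁻ y, fh y = ENNReal.ofReal c)
    (hθ : h * Real.exp c < v) (L : Finset ι) (A : Config d) :
    ‖(clusterCorr η ρ A * r) L‖ₑ ≤ Ψ A L := by
  have hh0 : 0 ≤ h := by rw [hh]; positivity
  have hv0 : 0 < v := lt_of_le_of_lt (by positivity) hθ
  induction L using Finset.strongInduction generalizing A with
  | H L ih =>
    -- A priori bound that starts the contraction; its constant may depend on `L` and on the cutoff.
    obtain ⟨M, hM⟩ : ∃ M : ℝ, ∀ A, |(clusterCorr η ρ A * r) L| ≤ M * v ^ Multiset.card A := by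
      obtain ⟨M, hM0, hM⟩ := hρ.bound
      refine ⟨∑ I ∈ L.powerset, M * h ^ Multiset.card (∑ i ∈ I, η i) * |r (L \ I)|, fun A => ?_⟩
      rw [mul_apply, Finset.sum_mul]
      refine (Finset.abs_sum_le_sum_abs _ _).trans (Finset.sum_le_sum fun I _ => ?_)
      rw [abs_mul, clusterCorr_apply]
      have h1 := hM (A + ∑ i ∈ I, η i)
      rw [Multiset.card_add, pow_add] at h1
      calc _ ≤ (M * (h ^ Multiset.card A * h ^ Multiset.card (∑ i ∈ I, η i))) * |r (L \ I)| :=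
            mul_le_mul_of_nonneg_right h1 (abs_nonneg _)
        _ ≤ (M * (v ^ Multiset.card A * h ^ Multiset.card (∑ i ∈ I, η i))) * |r (L \ I)| := by
            gcongr
        _ = _ := by ring
    set θ : ℝ≥0∞ := ENNReal.ofReal (h * Real.exp c / v) with hθdef
    set V : ℝ≥0∞ := ENNReal.ofReal v with hV
    set m : ℝ≥0∞ := ENNReal.ofReal M with hm
    have hθV : ENNReal.ofReal h * ENNReal.ofReal (Real.exp c) = θ * V := by
      rw [hθdef, hV, ← ENNReal.ofReal_mul hh0, ← ENNReal.ofReal_mul (by positivity),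
        div_mul_cancel₀ _ hv0.ne']
    -- Each use of the equation multiplies the error weight by `θ = h e^c / v < 1`. Only `J = ∅`
    -- keeps the set `L`; for other `J` the outer induction on `L` gives the bound without error.
    have key : ∀ n A, ‖(clusterCorr η ρ A * r) L‖ₑ ≤
        Ψ A L + m * θ ^ n * V ^ Multiset.card A := by
      intro n
      induction n with
      | zero =>
        intro A
        refine le_add_left ?_
        rw [pow_zero, mul_one, hm, hV, ← ENNReal.ofReal_pow hv0.le, ← ENNReal.ofReal_mul' (by positivity),
          ← Real.enorm_abs, Real.enorm_of_nonneg (abs_nonneg _)]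
        exact ENNReal.ofReal_le_ofReal (hM A)
      | succ n ihn =>
        intro A
        by_cases hA : A = 0
        · subst hA
          refine le_add_right ?_
          rw [hr, one_apply]
          split_ifs with hL
          · rw [hL]; simpa using hΨ0
          · simp
        obtain ⟨x, A', rfl, hstep⟩ :=
          hρ.enorm_truncated_le_step (η := η) hf hβ hz hstab hh r hfh hA
        refine (hstep L).trans ?_
        have hempty : ∅ ∈ L.powerset := Finset.empty_mem_powerset L
        have h1 : ∀ J ∈ L.powerset, (∏ j ∈ J, ‖pointCluster η φ β x j‖ₑ) *
            (lpLint fun ξ => (ξ.map fun y => fh (x - y)).prod *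
              ‖(clusterCorr η ρ (ξ + (A' + ∑ j ∈ J, η j)) * r) (L \ J)‖ₑ) ≤
            (∏ j ∈ J, ‖pointCluster η φ β x j‖ₑ) * lpLint (fun ξ =>
              (ξ.map fun y => fh (x - y)).prod * Ψ (ξ + (A' + ∑ j ∈ J, η j)) (L \ J)) +
            if J = ∅ then m * θ ^ n * V ^ Multiset.card A' * ENNReal.ofReal (Real.exp c) else 0 := by
          intro J hJ
          split_ifs with hJe
          · subst hJe
            simp only [Finset.prod_empty, one_mul, Finset.sum_empty, add_zero, Finset.sdiff_empty]
            rw [← lpLint_prod_pow hfm x V hc hvc, ← lpLint_add_prod hfm]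
            refine lpLint_mono fun ξ => mul_le_mul' le_rfl ((ihn _).trans (le_of_eq ?_))
            rw [Multiset.card_add, pow_add]; ring
          · rw [add_zero]
            refine mul_le_mul' le_rfl (lpLint_mono fun ξ => mul_le_mul' le_rfl (ih _ ?_ _))
            exact Finset.sdiff_ssubset (Finset.mem_powerset.1 hJ) (Finset.nonempty_iff_ne_empty.2 hJe)
        refine (mul_le_mul' le_rfl (Finset.sum_le_sum h1)).trans ?_
        rw [Finset.sum_add_distrib, mul_add, Finset.sum_ite_eq' _ _, if_pos hempty]
        refine add_le_add (hΨ x A' L) (le_of_eq ?_)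
        rw [Multiset.card_cons, pow_succ, pow_succ]
        calc _ = m * θ ^ n * V ^ Multiset.card A' *
              (ENNReal.ofReal h * ENNReal.ofReal (Real.exp c)) := by ring
          _ = _ := by rw [hθV]; ring
    have hlim : Tendsto (fun n : ℕ => Ψ A L + m * θ ^ n * V ^ Multiset.card A) atTop
        (𝓝 (Ψ A L + m * 0 * V ^ Multiset.card A)) := by
      refine tendsto_const_nhds.add (ENNReal.Tendsto.mul_const (ENNReal.Tendsto.const_mul
        (ENNReal.tendsto_pow_atTop_nhds_zero_of_lt_one ?_) (Or.inr ENNReal.ofReal_ne_top))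
        (Or.inr (ENNReal.pow_ne_top ENNReal.ofReal_ne_top)))
      rw [hθdef, ENNReal.ofReal_lt_one]
      exact (div_lt_one hv0).2 hθ
    rw [mul_zero, zero_mul, add_zero] at hlim
    exact ge_of_tendsto' hlim fun n => key n A

end Comparison

end

section

open scoped ENNReal
open SetFun

/-! ### Measurable majorants, point-cluster interactions, and the choice of activity. -/

section Majorant

variable {d : ℕ} {φ : ℝ → WithTop ℝ} {β α C : ℝ}

theorem lintegral_nb (hα : (d : ℝ) < α) :
    ∫⁻ y : Pt d, nb α y = ENNReal.ofReal (nuBarOne d α) :=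
  (ofReal_integral_eq_lintegral_ofReal (integrable_nuBar hα)
    (ae_of_all _ fun x => (nuBar_pos α x).le)).symm

theorem nuBarOne_pos (hα : (d : ℝ) < α) : 0 < nuBarOne d α := by
  have hs : Function.support (nuBar α : Pt d → ℝ) = Set.univ :=
    Set.eq_univ_of_forall fun x => (nuBar_pos α x).ne'
  refine (integral_pos_iff_support_of_nonneg (fun x => (nuBar_pos α x).le)
    (integrable_nuBar hα)).2 ?_
  rw [hs]
  exact isOpen_univ.measure_pos _ Set.univ_nonempty

/-- A measurable version of the Mayer function is replaced by the polynomial bound on a measurable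
null set. The result dominates at every point and its integral is still `ν₁`. -/
theorem exists_measurable_majorant (hα : 0 < α) (hC : 0 < C) (hf : Integrable (mayer d φ β))
    (hpoly : ∀ x : Pt d, |mayer d φ β x| ≤ C * nuBar α x) :
    ∃ fh : Pt d → ℝ≥0∞, Measurable fh ∧ (∀ x, ‖mayer d φ β x‖ₑ ≤ fh x) ∧
      (∀ x, fh x ≤ ENNReal.ofReal C * nb α x) ∧
      ∫⁻ y, fh y = ENNReal.ofReal (nuOne d φ β) := by
  classical
  have hen : ∀ x, ‖mayer d φ β x‖ₑ ≤ ENNReal.ofReal C * nb α x := fun x => by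
    rw [nb, ← ENNReal.ofReal_mul hC.le, ← Real.enorm_abs, Real.enorm_of_nonneg (abs_nonneg _)]
    exact ENNReal.ofReal_le_ofReal (hpoly x)
  set g := hf.aestronglyMeasurable.mk _ with hg
  have hfg : mayer d φ β =ᵐ[volume] g := hf.aestronglyMeasurable.ae_eq_mk
  set N := toMeasurable volume {x | ¬ mayer d φ β x = g x} with hN
  have hN0 : volume N = 0 := by rw [hN, measure_toMeasurable]; exact hfg
  have hNm : MeasurableSet N := measurableSet_toMeasurable _ _
  have hout : ∀ x, x ∉ N → g x = mayer d φ β x := fun x hx => by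
    by_contra hne
    exact hx (subset_toMeasurable _ _ (fun h => hne h.symm))
  refine ⟨fun x => if x ∈ N then ENNReal.ofReal C * nb α x else ‖g x‖ₑ, ?_, fun x => ?_,
    fun x => ?_, ?_⟩
  · exact Measurable.ite hNm ((measurable_nb hα).const_mul _)
      hf.aestronglyMeasurable.stronglyMeasurable_mk.enorm
  · dsimp only
    split_ifs with hx
    · exact hen x
    · rw [hout x hx]
  · dsimp only
    split_ifs with hx
    · exact le_rfl
    · rw [hout x hx]; exact hen x
  · rw [nuOne, ofReal_integral_eq_lintegral_ofReal hf.abs (ae_of_all _ fun _ => abs_nonneg _)]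
    refine lintegral_congr_ae ?_
    have : ∀ᵐ x ∂volume, x ∉ N := measure_eq_zero_iff_ae_notMem.1 hN0
    filter_upwards [this] with x hx
    rw [if_neg hx, hout x hx, ← Real.enorm_abs, Real.enorm_of_nonneg (abs_nonneg _)]

/-- Telescoping one point at a time: each step gives a Mayer factor, bounded by the kernel, times
pair factors bounded by `1 + C`. -/
theorem abs_prod_pairFactor_sub_one_le (hC : 0 < C)
    (hpoly : ∀ x : Pt d, |mayer d φ β x| ≤ C * nuBar α x) (x : Pt d) (A : Config d) :
    |(A.map (pairFactor φ β x)).prod| ≤ (1 + C) ^ Multiset.card A ∧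
    |(A.map (pairFactor φ β x)).prod - 1| ≤
      C * (1 + C) ^ (Multiset.card A - 1) * (A.map fun p => nuBar α (x - p)).sum := by
  induction A using Multiset.induction_on with
  | empty => simp
  | cons a A ih =>
    obtain ⟨ih1, ih2⟩ := ih
    have hfa := hpoly (x - a)
    have hfa1 : |mayer d φ β (x - a)| ≤ C :=
      hfa.trans (mul_le_of_le_one_right hC.le (nuBar_le_one _ _))
    have hp : |pairFactor φ β x a| ≤ 1 + C := by
      rw [pairFactor]
      exact (abs_add_le _ _).trans (by rw [abs_one]; linarith)
    have hs : 0 ≤ (A.map fun p => nuBar α (x - p)).sum := Multiset.sum_nonneg fun t ht => by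
      obtain ⟨y, -, rfl⟩ := Multiset.mem_map.1 ht
      exact (nuBar_pos _ _).le
    rw [Multiset.map_cons, Multiset.prod_cons, Multiset.card_cons, Multiset.map_cons,
      Multiset.sum_cons, Nat.add_sub_cancel]
    refine ⟨?_, ?_⟩
    · rw [abs_mul, pow_succ']
      exact mul_le_mul hp ih1 (abs_nonneg _) (by positivity)
    · have he : pairFactor φ β x a * (A.map (pairFactor φ β x)).prod - 1 =
          mayer d φ β (x - a) * (A.map (pairFactor φ β x)).prod +
            ((A.map (pairFactor φ β x)).prod - 1) := by rw [pairFactor]; ring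
      rw [he]
      refine (abs_add_le _ _).trans ?_
      rw [abs_mul]
      have h1 : |mayer d φ β (x - a)| * |(A.map (pairFactor φ β x)).prod| ≤
          (C * nuBar α (x - a)) * (1 + C) ^ Multiset.card A :=
        mul_le_mul hfa ih1 (abs_nonneg _) (mul_nonneg hC.le (nuBar_pos _ _).le)
      have h2 : (1 + C) ^ (Multiset.card A - 1) ≤ (1 + C) ^ Multiset.card A :=
        pow_le_pow_right₀ (by linarith) (Nat.sub_le _ _)
      have h3 : C * (1 + C) ^ (Multiset.card A - 1) * (A.map fun p => nuBar α (x - p)).sum ≤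
          C * (1 + C) ^ Multiset.card A * (A.map fun p => nuBar α (x - p)).sum := by gcongr
      linarith

theorem enorm_pointCluster_le {ι : Type} (η : ι → Config d) (hC : 0 < C)
    (hpoly : ∀ x : Pt d, |mayer d φ β x| ≤ C * nuBar α x) (x : Pt d) (j : ι) :
    ‖pointCluster η φ β x j‖ₑ ≤
      ENNReal.ofReal (C * (1 + C) ^ (Multiset.card (η j) - 1)) * clusterSum α η j x := by
  have h := (abs_prod_pairFactor_sub_one_le hC hpoly x (η j)).2
  have hs : ∀ A : Config d, (A.map fun p => nb α (x - p)).sum =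
      ENNReal.ofReal (A.map fun p => nuBar α (x - p)).sum := by
    intro A
    induction A using Multiset.induction_on with
    | empty => simp
    | cons a A ih =>
      rw [Multiset.map_cons, Multiset.sum_cons, Multiset.map_cons, Multiset.sum_cons, ih,
        ENNReal.ofReal_add (nuBar_pos _ _).le, nb]
      exact Multiset.sum_nonneg fun t ht => by
        obtain ⟨y, -, rfl⟩ := Multiset.mem_map.1 ht
        exact (nuBar_pos _ _).le
  rw [clusterSum, hs, ← ENNReal.ofReal_mul (by positivity), ← Real.enorm_abs,
    Real.enorm_of_nonneg (abs_nonneg _)]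
  exact ENNReal.ofReal_le_ofReal h

/-- `y e^{-y}` runs continuously from `0` to `1/e` on `[0, 1]`. For the root, `e^y (1 - t e) = e^y -
y e ≤ e^y (1 - y) ≤ 1`, using `y ≤ 1`. -/
theorem exists_root {t : ℝ} (ht : 0 ≤ t) (ht1 : t * Real.exp 1 < 1) :
    ∃ y, 0 ≤ y ∧ t * Real.exp y = y ∧ Real.exp y * (1 - t * Real.exp 1) ≤ 1 := by
  have hcont : ContinuousOn (fun y : ℝ => y * Real.exp (-y)) (Set.Icc 0 1) := by fun_prop
  have hmem : t ∈ Set.Icc ((0 : ℝ) * Real.exp (-0)) (1 * Real.exp (-1)) := by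
    refine ⟨by simpa using ht, ?_⟩
    rw [one_mul, Real.exp_neg]
    rw [← one_div, le_div_iff₀ (Real.exp_pos 1)]
    exact ht1.le
  obtain ⟨y, ⟨hy0, hy1⟩, hy⟩ := intermediate_value_Icc zero_le_one hcont hmem
  have hyt : t * Real.exp y = y := by
    rw [← hy]
    simp only
    rw [mul_assoc, ← Real.exp_add]; simp
  refine ⟨y, hy0, hyt, ?_⟩
  have h1 : Real.exp y * (1 - t * Real.exp 1) = Real.exp y - y * Real.exp 1 := by
    rw [mul_sub, mul_one, ← mul_assoc, mul_comm (Real.exp y) t, hyt]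
  have h2 : Real.exp y * (1 - y) ≤ 1 := by
    have h3 : 1 - y ≤ Real.exp (-y) := by linarith [Real.add_one_le_exp (-y)]
    calc Real.exp y * (1 - y) ≤ Real.exp y * Real.exp (-y) :=
          mul_le_mul_of_nonneg_left h3 (Real.exp_pos _).le
      _ = 1 := by rw [← Real.exp_add]; simp
  have h4 : Real.exp y ≤ Real.exp 1 := Real.exp_le_exp.2 hy1
  rw [h1]
  nlinarith

end Majorant

/-! ### Uniform bounds for cutoff correlations and their truncations. -/

section Bounds

variable {d : ℕ} {φ : ℝ → WithTop ℝ} {β α C z h B : ℝ} {ρ : Config d → ℝ}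

/-- The uniform radius of the correlation functions. -/
def ksRadius (d : ℕ) (φ : ℝ → WithTop ℝ) (β α C : ℝ) : ℝ := (nuOne d φ β + C * nuBarOne d α)⁻¹

theorem nuOne_nonneg : 0 ≤ nuOne d φ β := integral_nonneg fun _ => abs_nonneg _

theorem ksRadius_pos (hα : (d : ℝ) < α) (hC : 0 < C) : 0 < ksRadius d φ β α C := by
  have h1 := nuBarOne_pos hα
  have h2 := nuOne_nonneg (d := d) (φ := φ) (β := β)
  unfold ksRadius; positivity

/-- With this radius the exponent is at most `1`, so `h e (ν₁ + ν̄₁) < 1` suffices. This is where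
the term `ν̄₁ e` in the smallness condition enters. -/
theorem mul_exp_lt_ksRadius (hα : (d : ℝ) < α) (hC : 0 < C) (hh : 0 < h)
    (hsmall : h * (nuOne d φ β * Real.exp 1 + C * nuBarOne d α *
      (Real.exp 1 + (2 : ℝ) ^ (1 + α))) < 1) :
    h * Real.exp (ksRadius d φ β α C * nuOne d φ β) < ksRadius d φ β α C := by
  have h1 := nuBarOne_pos hα
  have h2 := nuOne_nonneg (d := d) (φ := φ) (β := β)
  have h3 : ksRadius d φ β α C * nuOne d φ β ≤ 1 := by
    rw [ksRadius, inv_mul_eq_div]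
    exact div_le_one_of_le₀ (by have := mul_pos hC h1; linarith) (by positivity)
  calc h * Real.exp (ksRadius d φ β α C * nuOne d φ β) ≤ h * Real.exp 1 := by gcongr
    _ < ksRadius d φ β α C := by
      rw [ksRadius, ← one_div, lt_div_iff₀ (by positivity)]
      have : 0 < h * (C * nuBarOne d α) * (2 : ℝ) ^ (1 + α) := by positivity
      nlinarith

theorem ofReal_ksRadius_mul (hα : (d : ℝ) < α) (hC : 0 < C) :
    ENNReal.ofReal (ksRadius d φ β α C) * ENNReal.ofReal (nuOne d φ β) =
      ENNReal.ofReal (ksRadius d φ β α C * nuOne d φ β) :=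
  (ENNReal.ofReal_mul (ksRadius_pos hα hC).le).symm

/-- Comparison principle with no clusters and the supersolution `v ^ |A|`. Unlike the a priori
bound, this one does not depend on the cutoff. -/
theorem IsKSSolution.enorm_le (hρ : IsKSSolution φ β z h ρ) (hα : (d : ℝ) < α) (hC : 0 < C)
    (hf : Integrable (mayer d φ β)) (hpoly : ∀ x : Pt d, |mayer d φ β x| ≤ C * nuBar α x)
    (hβ : 0 < β) (hz : 0 < z) (hstab : IsStable d φ B) (hh : h = z * Real.exp (2 * β * B))
    (hsmall : h * (nuOne d φ β * Real.exp 1 + C * nuBarOne d α *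
      (Real.exp 1 + (2 : ℝ) ^ (1 + α))) < 1) (A : Config d) :
    ‖ρ A‖ₑ ≤ ENNReal.ofReal (ksRadius d φ β α C) ^ Multiset.card A := by
  have hα0 : 0 < α := lt_of_le_of_lt (Nat.cast_nonneg d) hα
  have hh0 : 0 < h := by rw [hh]; positivity
  obtain ⟨fh, hfm, hfh, -, hint⟩ := exists_measurable_majorant hα0 hC hf hpoly
  have hv := mul_exp_lt_ksRadius hα hC hh0 hsmall
  have hv0 := ksRadius_pos (φ := φ) (β := β) hα hC
  have hc : 0 ≤ ksRadius d φ β α C * nuOne d φ β := mul_nonneg hv0.le nuOne_nonneg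
  have hvc : ENNReal.ofReal (ksRadius d φ β α C) * ∫⁻ y, fh y =
      ENNReal.ofReal (ksRadius d φ β α C * nuOne d φ β) := by
    rw [hint, ofReal_ksRadius_mul hα hC]
  have hhv : h ≤ ksRadius d φ β α C :=
    (le_mul_of_one_le_right hh0.le (Real.one_le_exp hc)).trans hv.le
  have key := hρ.enorm_truncated_le (η := fun _ : Empty => (0 : Config d)) (r := 1) hf hβ hz hstab
    hh (fun S => by
      rw [mul_one, Subsingleton.elim S ∅, clusterCorr_apply]
      simpa [one_apply] using hρ.zero) hfm hfh
    (Ψ := fun A _ => ENNReal.ofReal (ksRadius d φ β α C) ^ Multiset.card A) (by simp)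
    (fun x A L => by
      rw [Subsingleton.elim L ∅]
      simp only [Finset.powerset_empty, Finset.sum_singleton, Finset.prod_empty, one_mul,
        Finset.sum_empty, Multiset.card_add, Multiset.card_cons, Multiset.card_zero, pow_add,
        pow_one, pow_zero, mul_one]
      simp only [← mul_assoc, mul_comm _ (ENNReal.ofReal (ksRadius d φ β α C) ^ Multiset.card A)]
      simp only [mul_assoc]
      rw [lpLint_const_mul (ENNReal.pow_ne_top ENNReal.ofReal_ne_top),
        lpLint_prod_pow hfm x _ hc hvc, mul_left_comm, ← ENNReal.ofReal_mul hh0.le]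
      exact mul_le_mul' le_rfl (ENNReal.ofReal_le_ofReal hv.le)) hhv hc hvc hv ∅ A
  simpa [clusterCorr_apply] using key

theorem sum_constA_nonneg {n : ℕ} {n₁ n₂ : ℝ} (hC : 0 < C) (hh : 0 < h) (hn₂ : 0 < n₂)
    (hw : 0 < 1 - h * n₁ * Real.exp 1 - h * n₂ * (2 : ℝ) ^ (1 + α)) (l : Fin (n + 2) → ℕ) :
    0 ≤ ∑ σ ∈ Finset.Icc 1 (n + 2), constA α C h n₁ n₂ l σ := by
  have hq0 : 0 < h * n₂ * (2 : ℝ) ^ (1 + α) := by positivity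
  have hu : 0 < 1 - h * n₁ * Real.exp 1 := by linarith
  refine le_trans (mul_nonneg (by positivity) (mul_nonneg (Finset.prod_nonneg fun i _ => by
    positivity) (clusterVal_nonneg _ _ (by positivity) (by positivity) _
      (fun j => Nat.cast_nonneg _) (Nat.cast_nonneg _) _))) (sum_constA_ge hC hh hn₂.le hw l)

theorem maxTreeWeight_nonneg {m : ℕ} (α : ℝ) (η : Fin m → Config d) : 0 ≤ maxTreeWeight α η := by
  refine Real.sSup_nonneg ?_
  rintro v ⟨G, -, rfl⟩
  exact treeWeight_nonneg _ _ _

theorem confFun_skelLog_le_sum_constA {n : ℕ} {n₁ : ℝ} (hα : (d : ℝ) < α) (hC : 0 < C) (hh : 0 < h)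
    (hw : 0 < 1 - h * n₁ * Real.exp 1 - h * (C * nuBarOne d α) * (2 : ℝ) ^ (1 + α))
    (hu : 0 < 1 - h * n₁ * Real.exp 1) (η : Fin (n + 2) → Config d) {T : ℝ≥0∞}
    (hT : T ≤ ENNReal.ofReal (h / (1 - h * n₁ * Real.exp 1))) :
    confFun T (skelLog α η T (ENNReal.ofReal ((1 - h * n₁ * Real.exp 1) /
        (1 - h * n₁ * Real.exp 1 - h * (C * nuBarOne d α) * (2 : ℝ) ^ (1 + α)))) (ENNReal.ofReal C)
      fun j => ENNReal.ofReal (C * (1 + C) ^ (Multiset.card (η j) - 1))) (η 0)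
        (Finset.univ.erase 0) ≤
      ENNReal.ofReal ((∑ σ ∈ Finset.Icc 1 (n + 2), constA α C h n₁ (C * nuBarOne d α)
        (fun i => Multiset.card (η i)) σ) * maxTreeWeight α η) := by
  have hα0 : 0 < α := lt_of_le_of_lt (Nat.cast_nonneg d) hα
  have hnb := nuBarOne_pos hα
  have hlin := lintegral_nb hα
  have hn₂0 : 0 < C * nuBarOne d α := mul_pos hC hnb
  have h3 := sum_constA_ge (n := n) hC hh hn₂0.le hw fun i => Multiset.card (η i)
  have hA0 := sum_constA_nonneg hC hh hn₂0 hw fun i => Multiset.card (η i)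
  set u := 1 - h * n₁ * Real.exp 1
  set w := u - h * (C * nuBarOne d α) * (2 : ℝ) ^ (1 + α)
  set κ : Fin (n + 2) → ℝ≥0∞ := fun j =>
    ENNReal.ofReal (C * (1 + C) ^ (Multiset.card (η j) - 1)) with hκ
  set K := u / w
  have hK0 : 0 < K := div_pos hu hw
  set Θ : ℝ := ((n + 2 : ℕ) : ℝ) * (2 : ℝ) ^ (α * (((n + 2 : ℕ) : ℝ) - 1)) *
    (h * (C * nuBarOne d α) / u) with hΘ
  have hΘ0 : 0 ≤ Θ := by positivity
  have hΘ' : T * ENNReal.ofReal C * (((n + 2 : ℕ) : ℝ≥0∞) *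
      (ENNReal.ofReal (2 ^ α) ^ (n + 2 - 1) * ∫⁻ y : Pt d, nb α y)) ≤ ENNReal.ofReal Θ := by
    -- `M = n + 2 = m` in the counting recursion; this gives the factor `m 2^{α(m-1)}` in `S_m`.
    have hpow : ((2 : ℝ) ^ α) ^ (n + 2 - 1) = (2 : ℝ) ^ (α * (((n + 2 : ℕ) : ℝ) - 1)) := by
      rw [← Real.rpow_natCast, ← Real.rpow_mul two_pos.le, show n + 2 - 1 = n + 1 from rfl]
      push_cast
      ring_nf
    refine (mul_le_mul' (mul_le_mul' hT le_rfl) le_rfl).trans ?_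
    rw [hlin, ← ENNReal.ofReal_natCast (n + 2), ← ENNReal.ofReal_pow (by positivity),
      ← ENNReal.ofReal_mul (by positivity),
      ← ENNReal.ofReal_mul (by positivity), ← ENNReal.ofReal_mul (by positivity),
      ← ENNReal.ofReal_mul (by positivity), hpow]
    refine ENNReal.ofReal_le_ofReal (le_of_eq ?_)
    rw [hΘ]; ring
  have hcard : (Finset.univ.erase (0 : Fin (n + 2))).card < n + 2 := by
    rw [Finset.card_erase_of_mem (Finset.mem_univ _)]; simp
  have h1 := confFun_skelLog_le hα0 T (ENNReal.ofReal K) (ENNReal.ofReal C) κ (n + 2) _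
    (countStep_le η hT hK0.le hΘ0 hΘ' κ) 0 (Finset.univ.erase 0) hcard
  rw [Finset.insert_erase (Finset.mem_univ _)] at h1
  have h2 := rootFun_pow_apply (T := T) hT hK0.le hΘ0 (clusterFactor η (h / u) κ)
    (l := fun j => (Multiset.card (η j) : ℝ)) (fun j => Nat.cast_nonneg _) (Multiset.card (η 0))
    (Finset.univ.erase 0)
  have hprod : ∏ j ∈ Finset.univ.erase 0, clusterFactor η (h / u) κ j = ENNReal.ofReal
      (∏ j ∈ Finset.univ.erase 0, C * (1 + C) ^ (Multiset.card (η j) - 1) *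
        (Multiset.card (η j) : ℝ) * (h / u) ^ Multiset.card (η j)) := by
    rw [ENNReal.ofReal_prod_of_nonneg fun i _ => by positivity]
    refine Finset.prod_congr rfl fun j _ => ?_
    rw [clusterFactor, hκ, ENNReal.ofReal_mul (by positivity), ENNReal.ofReal_mul (by positivity),
      ENNReal.ofReal_pow (by positivity), ENNReal.ofReal_natCast]
  rw [hprod, ← ENNReal.ofReal_pow (by positivity),
    ← ENNReal.ofReal_mul (Finset.prod_nonneg fun i _ => by positivity),
    ← ENNReal.ofReal_mul (by positivity)] at h2
  rw [ENNReal.ofReal_mul hA0]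
  exact h1.trans (mul_le_mul' (h2.trans (ENNReal.ofReal_le_ofReal h3))
    (maxLink_le_maxTreeWeight α η 0))

/-- The tree bound for the truncated correlation functions. -/
theorem IsKSSolution.abs_truncated_le {n : ℕ} {η : Fin (n + 2) → Config d}
    (hρ : IsKSSolution φ β z h ρ) (hα : (d : ℝ) < α)
    (hC : 0 < C) (hf : Integrable (mayer d φ β))
    (hpoly : ∀ x : Pt d, |mayer d φ β x| ≤ C * nuBar α x)
    (hβ : 0 < β) (hz : 0 < z) (hstab : IsStable d φ B) (hh : h = z * Real.exp (2 * β * B))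
    (hsmall : h * (nuOne d φ β * Real.exp 1 + C * nuBarOne d α *
      (Real.exp 1 + (2 : ℝ) ^ (1 + α))) < 1) {r : SetFun (Fin (n + 2)) ℝ}
    (hr : ∀ S, (clusterCorr η ρ 0 * r) S = (1 : SetFun (Fin (n + 2)) ℝ) S) :
    |(clusterCorr η ρ (η 0) * r) (Finset.univ.erase 0)| ≤
      (∑ σ ∈ Finset.Icc 1 (n + 2), constA α C h (nuOne d φ β) (C * nuBarOne d α)
        (fun i => Multiset.card (η i)) σ) * maxTreeWeight α η := by
  have hα0 : 0 < α := lt_of_le_of_lt (Nat.cast_nonneg d) hα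
  have hh0 : 0 < h := by rw [hh]; positivity
  obtain ⟨fh, hfm, hfh, hfb, hint⟩ := exists_measurable_majorant hα0 hC hf hpoly
  have hv := mul_exp_lt_ksRadius hα hC hh0 hsmall
  have hv0 := ksRadius_pos (φ := φ) (β := β) hα hC
  have hc : 0 ≤ ksRadius d φ β α C * nuOne d φ β := mul_nonneg hv0.le nuOne_nonneg
  have hvc : ENNReal.ofReal (ksRadius d φ β α C) * ∫⁻ y, fh y =
      ENNReal.ofReal (ksRadius d φ β α C * nuOne d φ β) := by
    rw [hint, ofReal_ksRadius_mul hα hC]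
  have hhv : h ≤ ksRadius d φ β α C :=
    (le_mul_of_one_le_right hh0.le (Real.one_le_exp hc)).trans hv.le
  have hnb := nuBarOne_pos hα
  have hν := nuOne_nonneg (d := d) (φ := φ) (β := β)
  have hlin := lintegral_nb hα
  set n₁ := nuOne d φ β with hn₁
  set n₂ := C * nuBarOne d α with hn₂
  have hn₂0 : 0 < n₂ := mul_pos hC hnb
  set u := 1 - h * n₁ * Real.exp 1 with hu
  set w := u - h * n₂ * (2 : ℝ) ^ (1 + α) with hw
  have hq : 0 < h * n₂ * (2 : ℝ) ^ (1 + α) := by positivity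
  have hw0 : 0 < w := by
    have : 0 < h * n₂ * Real.exp 1 := by positivity
    rw [hw, hu]; nlinarith
  have hu0 : 0 < u := by linarith
  -- `T = h e^y` with `y = h ν₁ e^y` satisfies `T ν₁ = y` and `h e^{T ν₁} = T`, while `e^y ≤ 1/u`
  -- gives `T ≤ h / u`.
  obtain ⟨y, hy0, hy, hyu⟩ := exists_root (t := h * n₁) (by positivity) (by linarith)
  set T := ENNReal.ofReal (h * Real.exp y) with hT
  have hTτ : h * Real.exp y ≤ h / u := by
    rw [le_div_iff₀ hu0, mul_assoc]
    exact mul_le_of_le_one_right hh0.le hyu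
  have hTτ' : T ≤ ENNReal.ofReal (h / u) := ENNReal.ofReal_le_ofReal hTτ
  have h2α : (2 : ℝ) ^ (1 + α) = 2 * 2 ^ α := by
    rw [Real.rpow_add two_pos, Real.rpow_one]
  set κ : Fin (n + 2) → ℝ≥0∞ := fun j =>
    ENNReal.ofReal (C * (1 + C) ^ (Multiset.card (η j) - 1)) with hκ
  set K := u / w with hK
  have hK0 : 0 < K := div_pos hu0 hw0
  -- `K = u/w` solves `1 + (h ν̄₁ 2^{1+α} / u) K = K`, because `w = u - h ν̄₁ 2^{1+α}`.
  have hKeq : 1 + T * ENNReal.ofReal C *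
      (2 * (ENNReal.ofReal (2 ^ α) * ∫⁻ y : Pt d, nb α y)) * ENNReal.ofReal K ≤
      ENNReal.ofReal K := by
    rw [hlin, hT, ← ENNReal.ofReal_ofNat 2, ← ENNReal.ofReal_one, ← ENNReal.ofReal_mul (by positivity),
      ← ENNReal.ofReal_mul (by positivity), ← ENNReal.ofReal_mul (by positivity),
      ← ENNReal.ofReal_mul (by positivity), ← ENNReal.ofReal_mul (by positivity),
      ← ENNReal.ofReal_add (by positivity) (by positivity)]
    refine ENNReal.ofReal_le_ofReal ?_
    calc 1 + h * Real.exp y * C * (2 * (2 ^ α * nuBarOne d α)) * K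
        ≤ 1 + h / u * C * (2 * (2 ^ α * nuBarOne d α)) * K := by gcongr
      _ = 1 + (h * n₂ * (2 : ℝ) ^ (1 + α)) / w := by
          rw [h2α, hn₂, hK]; field_simp
      _ = K := by
          rw [hK, show h * n₂ * (2 : ℝ) ^ (1 + α) = u - w by rw [hw]; ring]; field_simp; ring
  have hTc : T * ∫⁻ y, fh y = ENNReal.ofReal y := by
    rw [hint, hT, ← ENNReal.ofReal_mul (by positivity)]
    congr 1
    linarith
  have hTh : ENNReal.ofReal h * ENNReal.ofReal (Real.exp y) ≤ T := by
    rw [hT, ENNReal.ofReal_mul hh0.le]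
  have key := hρ.enorm_truncated_le hf hβ hz hstab hh hr hfm hfh
    (Ψ := fun A L => confFun T (skelLog α η T (ENNReal.ofReal K) (ENNReal.ofReal C) κ) A L)
    (by simp [confFun, one_apply])
    (fun x A L => confFun_supersolution hα0 η T _ _ _ κ hfm hfb hKeq hy0 hTc hTh x _
      (fun j => enorm_pointCluster_le η hC hpoly x j) A L)
    hhv hc hvc hv (Finset.univ.erase 0) (η 0)
  have h5 := key.trans (confFun_skelLog_le_sum_constA hα hC hh0 hw0 hu0 η hTτ')
  rw [← Real.enorm_abs, Real.enorm_of_nonneg (abs_nonneg _)] at h5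
  exact (ENNReal.ofReal_le_ofReal_iff (mul_nonneg (sum_constA_nonneg hC hh0 hn₂0 hw0 _)
    (maxTreeWeight_nonneg α η))).1 h5

end Bounds

end

section

open scoped ENNReal

/-! ### Existence of the infinite-volume limit. -/

section Limit

variable {d : ℕ}

/-- Dominated convergence twice: for each number of particles, and for the series as an integral
against counting measure. -/
theorem tendsto_lpLint_zero {F : ℕ → Config d → ℝ≥0∞} {G : Config d → ℝ≥0∞}
    (hF : ∀ N k, AEMeasurable (fun y : Fin k → Pt d => F N (famConf y)) volume)
    (hFG : ∀ N ξ, F N ξ ≤ G ξ) (hG : lpLint G ≠ ⊤)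
    (hlim : ∀ ξ, Tendsto (fun N => F N ξ) atTop (𝓝 0)) :
    Tendsto (fun N => lpLint (F N)) atTop (𝓝 0) := by
  have hGk : ∀ k : ℕ, ∫⁻ y : Fin k → Pt d, G (famConf y) ≠ ⊤ := by
    intro k hk
    rw [lpLint_eq] at hG
    refine ENNReal.ne_top_of_tsum_ne_top hG k ?_
    rw [hk, ENNReal.mul_top (by simp)]
  have h1 : ∀ k : ℕ, Tendsto (fun N => (k.factorial : ℝ≥0∞)⁻¹ *
      ∫⁻ y : Fin k → Pt d, F N (famConf y)) atTop (𝓝 0) := by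
    intro k
    have := tendsto_lintegral_of_dominated_convergence' (f := fun _ => 0)
      (fun y : Fin k → Pt d => G (famConf y))
      (fun N => hF N k) (fun N => ae_of_all _ fun y => hFG N _) (hGk k)
      (ae_of_all _ fun y => hlim (famConf y))
    rw [lintegral_zero] at this
    simpa using ENNReal.Tendsto.const_mul this (Or.inr (by simp [Nat.factorial_ne_zero]))
  have h2 := tendsto_lintegral_of_dominated_convergence (μ := Measure.count) (f := fun _ : ℕ => 0)
    (F := fun N k => (k.factorial : ℝ≥0∞)⁻¹ * ∫⁻ y : Fin k → Pt d, F N (famConf y))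
    (fun k : ℕ => (k.factorial : ℝ≥0∞)⁻¹ * ∫⁻ y : Fin k → Pt d, G (famConf y))
    (fun N => measurable_from_nat)
    (fun N => ae_of_all _ fun k => mul_le_mul' le_rfl (lintegral_mono fun y => hFG N _))
    (by rw [lintegral_count, ← lpLint_eq]; exact hG) (ae_of_all _ h1)
  simpa only [lintegral_count, lintegral_zero, ← lpLint_eq] using h2

variable {φ : ℝ → WithTop ℝ} {β α C z B : ℝ}

/-- The difference of the correlation functions of two cutoffs, one step of the Kirkwood-Salsburg
recursion. -/
theorem enorm_cutoffCorrelation_sub_le (hf : Integrable (mayer d φ β)) (hβ : 0 < β) (hz : 0 < z)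
    (hB : 0 ≤ B) (hstab : IsStable d φ B) {fh : Pt d → ℝ≥0∞} (hfh : ∀ x, ‖mayer d φ β x‖ₑ ≤ fh x)
    {x : Pt d} {A : Config d} (hP : (A.map (pairFactor φ β x)).prod ≤ Real.exp (2 * β * B))
    {j j' : Pt d → ℝ} (hj : IsCutoff j) (hj' : IsCutoff j') :
    ‖cutoffCorrelation φ β z j (x ::ₘ A) - cutoffCorrelation φ β z j' (x ::ₘ A)‖ₑ ≤
      ENNReal.ofReal (z * Real.exp (2 * β * B)) * ‖j x - j' x‖ₑ *
        lpLint (fun ξ => (ξ.map fun y => fh (x - y)).prod *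
          ‖cutoffCorrelation φ β z j' (A + ξ)‖ₑ) +
      ENNReal.ofReal (z * Real.exp (2 * β * B)) *
        lpLint (fun ξ => (ξ.map fun y => fh (x - y)).prod *
          ‖cutoffCorrelation φ β z j (A + ξ) - cutoffCorrelation φ β z j' (A + ξ)‖ₑ) := by
  have hP0 := prod_pairFactor_nonneg (φ := φ) (β := β) x A
  have hI := (isKSSolution_cutoffCorrelation hf hβ hz hB hstab hj).lpIntegrable hf (by positivity) x A
  have hI' := (isKSSolution_cutoffCorrelation hf hβ hz hB hstab hj').lpIntegrable hf
    (by positivity) x A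
  set P := (A.map (pairFactor φ β x)).prod with hPdef
  have hsub := lpInt_add hI (hI'.const_mul (-1))
  rw [lpInt_const_mul] at hsub
  have h1 : cutoffCorrelation φ β z j (x ::ₘ A) - cutoffCorrelation φ β z j' (x ::ₘ A) =
      (z * P) * (j x - j' x) * lpInt (fun ξ => (ξ.map fun y => mayer d φ β (x - y)).prod *
        cutoffCorrelation φ β z j' (A + ξ)) +
      (z * P) * j x * lpInt (fun ξ => (ξ.map fun y => mayer d φ β (x - y)).prod *
        (cutoffCorrelation φ β z j (A + ξ) - cutoffCorrelation φ β z j' (A + ξ))) := by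
    have h2 : (fun ξ : Config d => (ξ.map fun y => mayer d φ β (x - y)).prod *
        (cutoffCorrelation φ β z j (A + ξ) - cutoffCorrelation φ β z j' (A + ξ))) = fun ξ =>
        (ξ.map fun y => mayer d φ β (x - y)).prod * cutoffCorrelation φ β z j (A + ξ) +
        -1 * ((ξ.map fun y => mayer d φ β (x - y)).prod * cutoffCorrelation φ β z j' (A + ξ)) := by
      funext ξ; ring
    rw [cutoffCorrelation_cons hf hβ hz hstab hj, cutoffCorrelation_cons hf hβ hz hstab hj', h2,
      hsub]
    ring
  have hzP : ‖z * P‖ₑ ≤ ENNReal.ofReal (z * Real.exp (2 * β * B)) := by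
    rw [Real.enorm_of_nonneg (mul_nonneg hz.le hP0)]
    exact ENNReal.ofReal_le_ofReal (mul_le_mul_of_nonneg_left hP hz.le)
  have hjx : ‖j x‖ₑ ≤ 1 := by
    rw [Real.enorm_of_nonneg (hj.nonneg x), ← ENNReal.ofReal_one]
    exact ENNReal.ofReal_le_ofReal (hj.le_one x)
  have hlp : ∀ F : Config d → ℝ, ‖lpInt (fun ξ => (ξ.map fun y => mayer d φ β (x - y)).prod * F ξ)‖ₑ
      ≤ lpLint (fun ξ => (ξ.map fun y => fh (x - y)).prod * ‖F ξ‖ₑ) := fun F =>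
    (enorm_lpInt_le _).trans (lpLint_mono fun ξ => by
      rw [enorm_mul]
      exact mul_le_mul' (enorm_multiset_prod_le _ _ _ fun y => hfh _) le_rfl)
  rw [h1]
  refine (enorm_add_le _ _).trans (add_le_add ?_ ?_)
  · rw [enorm_mul, enorm_mul]
    exact mul_le_mul' (mul_le_mul' hzP le_rfl) (hlp _)
  · rw [enorm_mul, enorm_mul]
    refine mul_le_mul' ?_ (hlp _)
    simpa using mul_le_mul' hzP hjx

/-- The difference of two cutoff correlations obeys the Kirkwood-Salsburg inequality up to a term
proportional to `|j x - j' x| → 0`, and it vanishes at `A = 0`. Iterating the contraction yields a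
limit superior at most `2 θ^n v^|A|` for every `n`. -/
theorem tendsto_cutoffCorrelation_sub (hα : (d : ℝ) < α) (hC : 0 < C)
    (hf : Integrable (mayer d φ β)) (hpoly : ∀ x : Pt d, |mayer d φ β x| ≤ C * nuBar α x)
    (hβ : 0 < β) (hz : 0 < z) (hB : 0 ≤ B) (hstab : IsStable d φ B)
    (hsmall : z * Real.exp (2 * β * B) * (nuOne d φ β * Real.exp 1 + C * nuBarOne d α *
      (Real.exp 1 + (2 : ℝ) ^ (1 + α))) < 1)
    {j j' : ℕ → Pt d → ℝ} (hj : ∀ N, IsCutoff (j N)) (hj' : ∀ N, IsCutoff (j' N))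
    (hlim : ∀ x, Tendsto (fun N => j N x) atTop (𝓝 1))
    (hlim' : ∀ x, Tendsto (fun N => j' N x) atTop (𝓝 1)) (A : Config d) :
    Tendsto (fun N => cutoffCorrelation φ β z (j N) A - cutoffCorrelation φ β z (j' N) A) atTop
      (𝓝 0) := by
  have hα0 : 0 < α := lt_of_le_of_lt (Nat.cast_nonneg d) hα
  set h := z * Real.exp (2 * β * B) with hh
  have hh0 : 0 < h := by positivity
  obtain ⟨fh, hfm, hfh, hfb, hint⟩ := exists_measurable_majorant hα0 hC hf hpoly
  have hv := mul_exp_lt_ksRadius hα hC hh0 hsmall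
  have hv0 := ksRadius_pos (φ := φ) (β := β) hα hC
  have hc : 0 ≤ ksRadius d φ β α C * nuOne d φ β := mul_nonneg hv0.le nuOne_nonneg
  have hvc : ENNReal.ofReal (ksRadius d φ β α C) * ∫⁻ y, fh y =
      ENNReal.ofReal (ksRadius d φ β α C * nuOne d φ β) := by
    rw [hint, ofReal_ksRadius_mul hα hC]
  set c := ksRadius d φ β α C * nuOne d φ β with hcdef
  set v := ksRadius d φ β α C with hvdef
  set V := ENNReal.ofReal v with hV
  set θ : ℝ≥0∞ := ENNReal.ofReal (h * Real.exp c / v) with hθdef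
  have hθ1 : θ < 1 := by
    rw [hθdef, ENNReal.ofReal_lt_one]
    exact (div_lt_one hv0).2 hv
  have hθV : ENNReal.ofReal h * ENNReal.ofReal (Real.exp c) = θ * V := by
    rw [hθdef, hV, ← ENNReal.ofReal_mul hh0.le, ← ENNReal.ofReal_mul (by positivity),
      div_mul_cancel₀ _ hv0.ne']
  have hb : ∀ {i : Pt d → ℝ}, IsCutoff i → ∀ A, ‖cutoffCorrelation φ β z i A‖ₑ ≤
      V ^ Multiset.card A := fun hi A =>
    (isKSSolution_cutoffCorrelation hf hβ hz hB hstab hi).enorm_le hα hC hf hpoly hβ hz hstab hh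
      hsmall A
  set e : ℕ → Config d → ℝ≥0∞ := fun N A =>
    ‖cutoffCorrelation φ β z (j N) A - cutoffCorrelation φ β z (j' N) A‖ₑ with he
  have he2 : ∀ N A, e N A ≤ 2 * V ^ Multiset.card A := fun N A => by
    refine (enorm_sub_le).trans ?_
    rw [two_mul]
    exact add_le_add (hb (hj N) A) (hb (hj' N) A)
  have hem : ∀ N A k, AEMeasurable (fun y : Fin k → Pt d => e N (A + famConf y)) volume :=
    fun N A k =>
    (((isKSSolution_cutoffCorrelation hf hβ hz hB hstab (hj N)).meas A k).sub
      ((isKSSolution_cutoffCorrelation hf hβ hz hB hstab (hj' N)).meas A k)).enorm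
  have hlp : ∀ (x : Pt d) (A : Config d), lpLint (fun ξ => (ξ.map fun y => fh (x - y)).prod *
      V ^ Multiset.card (A + ξ)) = V ^ Multiset.card A * ENNReal.ofReal (Real.exp c) := by
    intro x A
    rw [← lpLint_prod_pow hfm x V hc hvc, ← lpLint_const_mul (ENNReal.pow_ne_top ENNReal.ofReal_ne_top)]
    congr 1
    funext ξ
    rw [Multiset.card_add, pow_add, mul_left_comm]
  -- Subtraction in `ℝ≥0∞` is truncated at `0`, so convergence to `0` says that the limit superior
  -- of `e N A` is at most the subtracted term.
  have key : ∀ (n : ℕ) (A : Config d),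
      Tendsto (fun N => e N A - 2 * θ ^ n * V ^ Multiset.card A) atTop (𝓝 0) := by
    intro n
    induction n with
    | zero =>
      intro A
      refine tendsto_const_nhds.congr fun N => ?_
      rw [pow_zero, mul_one, tsub_eq_zero_of_le (he2 N A)]
    | succ n ih =>
      intro A
      by_cases hA : A = 0
      · subst hA
        refine tendsto_const_nhds.congr fun N => ?_
        have : e N 0 = 0 := by
          rw [he]
          simp only
          rw [(isKSSolution_cutoffCorrelation hf hβ hz hB hstab (hj N)).zero,
            (isKSSolution_cutoffCorrelation hf hβ hz hB hstab (hj' N)).zero, sub_self, enorm_zero]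
        rw [this, zero_tsub]
      obtain ⟨x, A', rfl, hP⟩ := exists_good_point hβ hstab hA
      set b : ℕ → ℝ≥0∞ := fun N => lpLint fun ξ => (ξ.map fun y => fh (x - y)).prod *
        (e N (A' + ξ) - 2 * θ ^ n * V ^ Multiset.card (A' + ξ)) with hbdef
      have hbl : Tendsto b atTop (𝓝 0) := by
        refine tendsto_lpLint_zero (G := fun ξ => (ξ.map fun y => fh (x - y)).prod *
          (2 * V ^ Multiset.card (A' + ξ))) (fun N k => ?_) (fun N ξ => ?_) ?_ (fun ξ => ?_)
        · simp only [famConf_map_prod, Multiset.card_add, card_famConf]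
          have hm : Measurable fun y : Fin k → Pt d => ∏ i, fh (x - y i) :=
            Finset.measurable_fun_prod _ fun i _ =>
              (hfm.comp (measurable_const_sub x)).comp (measurable_pi_apply i)
          exact hm.aemeasurable.mul ((hem N A' k).sub aemeasurable_const)
        · exact mul_le_mul' le_rfl (tsub_le_self.trans (he2 N _))
        · simp only [mul_left_comm _ (2 : ℝ≥0∞)]
          rw [lpLint_const_mul (by simp), hlp]
          exact ENNReal.mul_ne_top (by simp) (ENNReal.mul_ne_top
            (ENNReal.pow_ne_top ENNReal.ofReal_ne_top) ENNReal.ofReal_ne_top)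
        · have hne : (ξ.map fun y => fh (x - y)).prod ≠ ⊤ := by
            refine Multiset.prod_induction (· ≠ ⊤) _ (fun _ _ => ENNReal.mul_ne_top) ENNReal.one_ne_top
              fun t ht => ?_
            obtain ⟨y, -, rfl⟩ := Multiset.mem_map.1 ht
            exact ne_top_of_le_ne_top
              (ENNReal.mul_ne_top ENNReal.ofReal_ne_top ENNReal.ofReal_ne_top) (hfb (x - y))
          simpa using ENNReal.Tendsto.const_mul (ih (A' + ξ)) (Or.inr hne)
      have hal : Tendsto (fun N => ‖j N x - j' N x‖ₑ) atTop (𝓝 0) := by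
        simpa using ((hlim x).sub (hlim' x)).enorm
      have hsum : Tendsto (fun N => ENNReal.ofReal h * ‖j N x - j' N x‖ₑ *
          (V ^ Multiset.card A' * ENNReal.ofReal (Real.exp c)) + ENNReal.ofReal h * b N) atTop
          (𝓝 0) := by
        have h1 := ENNReal.Tendsto.mul_const (ENNReal.Tendsto.const_mul hal
          (Or.inr (ENNReal.ofReal_ne_top (r := h)))) (b := V ^ Multiset.card A' *
            ENNReal.ofReal (Real.exp c)) (Or.inr (ENNReal.mul_ne_top
            (ENNReal.pow_ne_top ENNReal.ofReal_ne_top) ENNReal.ofReal_ne_top))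
        have h2 := ENNReal.Tendsto.const_mul hbl (Or.inr (ENNReal.ofReal_ne_top (r := h)))
        simpa using h1.add h2
      refine tendsto_of_tendsto_of_tendsto_of_le_of_le tendsto_const_nhds hsum
        (fun N => zero_le) fun N => ?_
      simp only
      rw [tsub_le_iff_right]
      refine (enorm_cutoffCorrelation_sub_le hf hβ hz hB hstab hfh hP (hj N) (hj' N)).trans ?_
      rw [add_assoc]
      refine add_le_add (mul_le_mul' le_rfl ?_) ?_
      · rw [← hlp x A']
        exact lpLint_mono fun ξ => mul_le_mul' le_rfl (hb (hj' N) _)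
      · have h3 : lpLint (fun ξ => (ξ.map fun y => fh (x - y)).prod * e N (A' + ξ)) ≤
            b N + 2 * θ ^ n * (V ^ Multiset.card A' * ENNReal.ofReal (Real.exp c)) := by
          have h4 := lpLint_add_prod hfm x (2 * θ ^ n * V ^ Multiset.card A') V
            (fun ξ => e N (A' + ξ) - 2 * θ ^ n * V ^ Multiset.card (A' + ξ))
          rw [lpLint_prod_pow hfm x V hc hvc] at h4
          rw [← mul_assoc, ← h4]
          refine lpLint_mono fun ξ => mul_le_mul' le_rfl ?_
          rw [mul_assoc _ _ (V ^ Multiset.card ξ), ← pow_add, ← Multiset.card_add]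
          exact le_tsub_add
        refine (mul_le_mul' le_rfl h3).trans (le_of_eq ?_)
        rw [mul_add, Multiset.card_cons, pow_succ, pow_succ]
        congr 1
        calc _ = 2 * θ ^ n * V ^ Multiset.card A' *
              (ENNReal.ofReal h * ENNReal.ofReal (Real.exp c)) := by ring
          _ = _ := by rw [hθV]; ring
  have hfin : Tendsto (fun N => e N A) atTop (𝓝 0) := by
    have hθlim : Tendsto (fun n : ℕ => 2 * θ ^ n * V ^ Multiset.card A) atTop (𝓝 0) := by
      have := ENNReal.Tendsto.mul_const (ENNReal.Tendsto.const_mul (a := 2)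
        (ENNReal.tendsto_pow_atTop_nhds_zero_of_lt_one hθ1) (Or.inr (by simp)))
        (b := V ^ Multiset.card A) (Or.inr (ENNReal.pow_ne_top ENNReal.ofReal_ne_top))
      simpa using this
    rw [ENNReal.tendsto_nhds_zero]
    intro ε hε
    have hε2 : 0 < ε / 2 := ENNReal.half_pos hε.ne'
    obtain ⟨n, hn⟩ := (ENNReal.tendsto_nhds_zero.1 hθlim (ε / 2) hε2).exists
    filter_upwards [ENNReal.tendsto_nhds_zero.1 (key n A) (ε / 2) hε2] with N hN
    calc e N A ≤ (e N A - 2 * θ ^ n * V ^ Multiset.card A) + 2 * θ ^ n * V ^ Multiset.card A :=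
          le_tsub_add
      _ ≤ ε / 2 + ε / 2 := add_le_add hN hn
      _ = ε := ENNReal.add_halves ε
  rw [tendsto_zero_iff_norm_tendsto_zero]
  have := (ENNReal.tendsto_toReal ENNReal.zero_ne_top).comp hfin
  simpa [he, Function.comp_def] using this

/-- The cutoffs given by the indicators of balls. -/
def ballCutoff (d : ℕ) (N : ℕ) : Pt d → ℝ := (Metric.ball (0 : Pt d) N).indicator 1

theorem isCutoff_ballCutoff (N : ℕ) : IsCutoff (ballCutoff d N) where
  measurable := measurable_one.indicator measurableSet_ball
  nonneg x := Set.indicator_nonneg (fun _ _ => zero_le_one) x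
  le_one x := Set.indicator_le' (fun _ _ => le_rfl) (fun _ _ => zero_le_one) x
  bounded_support := Metric.isBounded_ball.subset (Set.support_indicator_subset)

theorem tendsto_ballCutoff (x : Pt d) : Tendsto (fun N => ballCutoff d N x) atTop (𝓝 1) := by
  obtain ⟨N₀, hN₀⟩ := exists_nat_gt ‖x‖
  refine tendsto_const_nhds.congr' ?_
  filter_upwards [eventually_ge_atTop N₀] with N hN
  rw [ballCutoff, Set.indicator_of_mem, Pi.one_apply]
  rw [mem_ball_zero_iff]
  exact hN₀.trans_le (by exact_mod_cast hN)

theorem exists_isInfiniteVolumeCorrelation (hα : (d : ℝ) < α) (hC : 0 < C)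
    (hf : Integrable (mayer d φ β)) (hpoly : ∀ x : Pt d, |mayer d φ β x| ≤ C * nuBar α x)
    (hβ : 0 < β) (hz : 0 < z) (hB : 0 ≤ B) (hstab : IsStable d φ B)
    (hsmall : z * Real.exp (2 * β * B) * (nuOne d φ β * Real.exp 1 + C * nuBarOne d α *
      (Real.exp 1 + (2 : ℝ) ^ (1 + α))) < 1) :
    ∃ ρ : Config d → ℝ, IsInfiniteVolumeCorrelation φ β z ρ := by
  have hsub : ∀ {j j' : ℕ → Pt d → ℝ}, (∀ N, IsCutoff (j N)) → (∀ N, IsCutoff (j' N)) →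
    (∀ x, Tendsto (fun N => j N x) atTop (𝓝 1)) → (∀ x, Tendsto (fun N => j' N x) atTop (𝓝 1)) →
    ∀ A : Config d, Tendsto (fun N => cutoffCorrelation φ β z (j N) A -
      cutoffCorrelation φ β z (j' N) A) atTop (𝓝 0) := fun hj hj' hl hl' A =>
    tendsto_cutoffCorrelation_sub hα hC hf hpoly hβ hz hB hstab hsmall hj hj' hl hl' A
  have hcauchy : ∀ A : Config d,
      CauchySeq fun N => cutoffCorrelation φ β z (ballCutoff d N) A := by
    intro A
    rw [cauchySeq_iff_tendsto]
    -- The Cauchy property is tested along sequences of pairs of indices, which are two sequences of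
    -- cutoffs tending to `1`.
    refine tendsto_of_seq_tendsto fun s hs => ?_
    rw [← prod_atTop_atTop_eq] at hs
    have h1 := tendsto_fst.comp hs
    have h2 := tendsto_snd.comp hs
    rw [uniformity_eq_comap_nhds_zero ℝ, tendsto_comap_iff]
    exact hsub (fun N => isCutoff_ballCutoff (s N).2) (fun N => isCutoff_ballCutoff (s N).1)
      (fun x => (tendsto_ballCutoff x).comp h2) (fun x => (tendsto_ballCutoff x).comp h1) A
  choose ρ hρ using fun A => cauchySeq_tendsto_of_complete (hcauchy A)
  refine ⟨ρ, fun j hj hl A => ?_⟩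
  have := (hsub hj (fun N => isCutoff_ballCutoff N) hl (fun x => tendsto_ballCutoff x) A).add (hρ A)
  simpa using this

end Limit

end

section

open SetFun

/-! ### Partitions and the recursive definition of the PTCF. -/

section Partitions

variable {ι : Type} [DecidableEq ι]

/-- The sum over the partitions of `I` of the products of `F` over the blocks. -/
def partSum (F : Finset ι → ℝ) (I : Finset ι) : ℝ :=
  ∑ P : Finpartition I, ∏ J ∈ P.parts, F J

theorem insert_extend_aux {i₀ : ι} {I J : Finset ι} (hi : i₀ ∉ I) (hJ : J ⊆ I) :
    Disjoint (I \ J) (insert i₀ J) ∧ (I \ J) ⊔ insert i₀ J = insert i₀ I := by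
  constructor
  · rw [Finset.disjoint_left]
    intro x hx hx'
    rw [Finset.mem_sdiff] at hx
    rcases Finset.mem_insert.1 hx' with rfl | h
    · exact hi hx.1
    · exact hx.2 h
  · rw [Finset.sup_eq_union, Finset.union_insert, Finset.sdiff_union_of_subset hJ]

/-- Adding the block `insert i₀ J` to a partition of `I \ J`. -/
def addBlock {i₀ : ι} {I J : Finset ι} (hi : i₀ ∉ I) (hJ : J ⊆ I) (Q : Finpartition (I \ J)) :
    Finpartition (insert i₀ I) :=
  Q.extend (Finset.insert_ne_empty i₀ J) (insert_extend_aux hi hJ).1 (insert_extend_aux hi hJ).2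

theorem parts_addBlock {i₀ : ι} {I J : Finset ι} (hi : i₀ ∉ I) (hJ : J ⊆ I)
    (Q : Finpartition (I \ J)) : (addBlock hi hJ Q).parts = insert (insert i₀ J) Q.parts := rfl

theorem insert_notMem_parts {i₀ : ι} {I J J' : Finset ι} (hi : i₀ ∉ I)
    (Q : Finpartition (I \ J)) : insert i₀ J' ∉ Q.parts := fun h =>
  hi (Finset.mem_sdiff.1 (Q.subset h (Finset.mem_insert_self i₀ J'))).1

theorem addBlock_injective {i₀ : ι} {I J J' : Finset ι} (hi : i₀ ∉ I) (hJ : J ⊆ I) (hJ' : J' ⊆ I)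
    {Q : Finpartition (I \ J)} {Q' : Finpartition (I \ J')}
    (h : addBlock hi hJ Q = addBlock hi hJ' Q') : (⟨J, Q⟩ : Σ J, Finpartition (I \ J)) = ⟨J', Q'⟩ := by
  have hp := congrArg Finpartition.parts h
  rw [parts_addBlock, parts_addBlock] at hp
  have h1 : insert i₀ J = insert i₀ J' := by
    have : insert i₀ J ∈ insert (insert i₀ J') Q'.parts := hp ▸ Finset.mem_insert_self _ _
    exact (Finset.mem_insert.1 this).resolve_right (insert_notMem_parts hi Q')
  have h2 : J = J' := by
    rw [← Finset.erase_insert (fun h => hi (hJ h)), h1, Finset.erase_insert fun h => hi (hJ' h)]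
  subst h2
  have h3 : Q = Q' := Finpartition.ext (by
    rw [← Finset.erase_insert (insert_notMem_parts (J' := J) hi Q), hp,
      Finset.erase_insert (insert_notMem_parts hi Q')])
  rw [h3]

theorem exists_addBlock {i₀ : ι} {I : Finset ι} (hi : i₀ ∉ I) (P : Finpartition (insert i₀ I)) :
    ∃ (J : Finset ι) (hJ : J ⊆ I) (Q : Finpartition (I \ J)), addBlock hi hJ Q = P := by
  obtain ⟨t, ht, hit⟩ := P.exists_mem (Finset.mem_insert_self i₀ I)
  have hins : insert i₀ (t.erase i₀) = t := Finset.insert_erase hit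
  have hJ : t.erase i₀ ⊆ I := fun x hx => by
    have h1 := P.subset ht (Finset.mem_of_mem_erase hx)
    exact (Finset.mem_insert.1 h1).resolve_left (Finset.ne_of_mem_erase hx)
  have hsup : (P.parts.erase t).sup id = I \ t.erase i₀ := by
    ext x
    simp only [Finset.mem_sup, Finset.mem_erase, id, Finset.mem_sdiff]
    constructor
    · rintro ⟨s, ⟨hst, hs⟩, hxs⟩
      have hxt : x ∉ t := fun hxt => hst (P.eq_of_mem_parts hs ht hxs hxt)
      have hxi : x ≠ i₀ := fun h => hxt (h ▸ hit)
      exact ⟨(Finset.mem_insert.1 (P.subset hs hxs)).resolve_left hxi, fun h => hxt h.2⟩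
    · rintro ⟨hxI, hx⟩
      obtain ⟨s, hs, hxs⟩ := P.exists_mem (Finset.mem_insert_of_mem (b := i₀) hxI)
      refine ⟨s, ⟨fun hst => hx ⟨fun h => hi (h ▸ hxI), hst ▸ hxs⟩, hs⟩, hxs⟩
  refine ⟨t.erase i₀, hJ, P.ofSubset (Finset.erase_subset t P.parts) hsup, Finpartition.ext ?_⟩
  rw [parts_addBlock, hins]
  exact Finset.insert_erase ht

/-- Partitions are classified by the block containing `i₀`. -/
theorem partSum_insert (F : Finset ι → ℝ) {i₀ : ι} {I : Finset ι} (hi : i₀ ∉ I) :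
    partSum F (insert i₀ I) = ∑ J ∈ I.powerset, F (insert i₀ J) * partSum F (I \ J) := by
  simp only [partSum, Finset.mul_sum]
  rw [Finset.sum_sigma']
  symm
  refine Finset.sum_bij (fun p hp => addBlock hi (Finset.mem_powerset.1 (Finset.mem_sigma.1 hp).1) p.2)
    (fun _ _ => Finset.mem_univ _) (fun p _ q _ h => addBlock_injective hi _ _ h) (fun P _ => ?_)
    (fun p hp => ?_)
  · obtain ⟨J, hJ, Q, rfl⟩ := exists_addBlock hi P
    exact ⟨⟨J, Q⟩, by simp [hJ], rfl⟩
  · rw [parts_addBlock, Finset.prod_insert (insert_notMem_parts hi p.2)]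

variable {d : ℕ} (ρ : Config d → ℝ) (η : ι → Config d)

/-- The recursion with its subtracted terms moved to the other side; the missing one-block partition
is the PTCF itself. The empty set needs `ρ 0 = 1`, its only partition having the empty product. -/
theorem partSum_ptcf (hρ : ρ 0 = 1) (I : Finset ι) :
    partSum (ptcf ρ η) I = ρ (∑ i ∈ I, η i) := by
  rcases I.eq_empty_or_nonempty with rfl | hI
  · have : ∀ P : Finpartition (∅ : Finset ι), P.parts = ∅ := fun P =>
      P.parts_eq_empty_iff.2 rfl
    simp only [partSum, this, Finset.prod_empty, Finset.sum_const, Finset.card_univ,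
      Finset.sum_empty, hρ]
    have hu : Fintype.card (Finpartition (∅ : Finset ι)) = 1 :=
      Fintype.card_eq_one_iff.2 ⟨Finpartition.empty _, fun P => Finpartition.ext (this P)⟩
    rw [hu]; simp
  · have hI' : I ≠ ⊥ := hI.ne_empty
    have h2 : ∀ P : Finpartition I, ¬ 2 ≤ P.parts.card → P = Finpartition.indiscrete hI' := by
      intro P hP
      have h1 : P.parts.card = 1 := by
        have := Finset.card_pos.2 (P.parts_nonempty hI')
        omega
      obtain ⟨t, ht⟩ := Finset.card_eq_one.1 h1
      have := P.sup_parts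
      rw [ht, Finset.sup_singleton, id] at this
      refine Finpartition.ext ?_
      rw [ht, this]
      rfl
    have hn : ¬ 2 ≤ (Finpartition.indiscrete hI').parts.card := by
      simp [Finpartition.indiscrete]
    rw [partSum, ← Fintype.sum_subtype_add_sum_subtype (fun P : Finpartition I => 2 ≤ P.parts.card),
      Fintype.sum_eq_single (⟨Finpartition.indiscrete hI', hn⟩ :
        {P : Finpartition I // ¬ 2 ≤ P.parts.card}) fun P hP =>
        absurd (Subtype.ext (h2 P.1 P.2)) hP]
    simp only [Finpartition.indiscrete, Finset.prod_singleton]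
    have h3 := ptcf.eq_1 ρ η I
    have h4 : ∀ P : {P : Finpartition I // 2 ≤ P.parts.card},
        ∏ J : {J : Finset ι // J ∈ P.1.parts}, ptcf ρ η J.1 = ∏ J ∈ P.1.parts, ptcf ρ η J :=
      fun P => Finset.prod_coe_sort P.1.parts (ptcf ρ η)
    rw [Finset.sum_congr rfl fun P _ => h4 P] at h3
    linarith

/-- Splitting off the block of `i₀` says that `clusterCorr η ρ (η i₀)` is the convolution of `J ↦
ptcf ρ η (insert i₀ J)` with `clusterCorr η ρ 0`; multiplying by the inverse `r` isolates the PTCF.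
-/
theorem ptcf_eq_truncated (hρ : ρ 0 = 1) {r : SetFun ι ℝ}
    (hr : ∀ S, (clusterCorr η ρ 0 * r) S = (1 : SetFun ι ℝ) S) {i₀ : ι} {S : Finset ι}
    (hi : i₀ ∉ S) : ptcf ρ η (insert i₀ S) = (clusterCorr η ρ (η i₀) * r) S := by
  set F : SetFun ι ℝ := ⟨fun J => ptcf ρ η (insert i₀ J)⟩ with hF
  have h1 : ∀ I ⊆ S, clusterCorr η ρ (η i₀) I = (F * clusterCorr η ρ 0) I := by
    intro I hI
    have hiI : i₀ ∉ I := fun h => hi (hI h)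
    rw [clusterCorr_apply, ← Finset.sum_insert hiI, ← partSum_ptcf ρ η hρ, partSum_insert _ hiI,
      mul_apply]
    refine Finset.sum_congr rfl fun J _ => ?_
    rw [clusterCorr_apply, zero_add, partSum_ptcf ρ η hρ]
  have h2 : (clusterCorr η ρ (η i₀) * r) S = (F * clusterCorr η ρ 0 * r) S := by
    rw [mul_apply, mul_apply]
    exact Finset.sum_congr rfl fun I hI => by rw [h1 I (Finset.mem_powerset.1 hI)]
  rw [h2, mul_assoc, show clusterCorr η ρ 0 * r = 1 from ext_apply hr, mul_one]

variable {ρ}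

theorem tendsto_ptcf {ρs : ℕ → Config d → ℝ}
    (h : ∀ A, Tendsto (fun N => ρs N A) atTop (𝓝 (ρ A))) (I : Finset ι) :
    Tendsto (fun N => ptcf (ρs N) η I) atTop (𝓝 (ptcf ρ η I)) := by
  induction I using Finset.strongInduction with
  | H I ih =>
    simp only [ptcf.eq_1 (I := I)]
    refine (h _).sub (tendsto_finsetSum _ fun P _ => tendsto_finsetProd _ fun J _ => ih _ ?_)
    refine lt_of_le_of_ne (P.1.le J.2) fun h => ?_
    obtain ⟨K, hK, hne⟩ := Finset.exists_mem_ne (s := P.1.parts) P.2 J.1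
    have hdis := P.1.disjoint hK J.2 hne
    have hKI : K ≤ J.1 := (P.1.le hK).trans (le_of_eq h.symm)
    exact P.1.ne_bot hK (hdis.eq_bot_of_le hKI)

end Partitions

end

end PTCF

end

/-! ### The main theorem. -/

theorem mainTheorem2 (d : ℕ) (hd : 1 ≤ d) (φ : ℝ → WithTop ℝ) (β z B α C : ℝ)
    (hβ : 0 < β) (hz : 0 < z) (hB : 0 ≤ B) (hα : (d : ℝ) < α) (hC : 0 < C)
    (hstab : PTCF.IsStable d φ B)
    (hreg : MeasureTheory.Integrable (PTCF.mayer d φ β))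
    (hpoly : ∀ x : PTCF.Pt d, |PTCF.mayer d φ β x| ≤ C * PTCF.nuBar α x)
    (hsmall : z * Real.exp (2 * β * B) *
      (PTCF.nuOne d φ β * Real.exp 1 +
        C * PTCF.nuBarOne d α * (Real.exp 1 + (2 : ℝ) ^ (1 + α))) < 1) :
    MeasureTheory.Integrable (fun x : PTCF.Pt d => PTCF.nuBar α x) ∧
    ∃ ρ : PTCF.Config d → ℝ, PTCF.IsInfiniteVolumeCorrelation φ β z ρ ∧
      ∀ m : ℕ, 2 ≤ m → ∀ η : Fin m → PTCF.Config d, (∀ i, η i ≠ 0) →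
        (∀ σ ∈ Finset.Icc 1 m,
          0 < PTCF.constA α C (z * Real.exp (2 * β * B)) (PTCF.nuOne d φ β)
            (C * PTCF.nuBarOne d α) (fun i => Multiset.card (η i)) σ) ∧
        |PTCF.ptcf ρ η Finset.univ| ≤
          ∑ σ ∈ Finset.Icc 1 m,
            PTCF.constA α C (z * Real.exp (2 * β * B)) (PTCF.nuOne d φ β)
              (C * PTCF.nuBarOne d α) (fun i => Multiset.card (η i)) σ *
            PTCF.maxTreeWeight α η := by
  refine ⟨PTCF.integrable_nuBar hα, ?_⟩
  obtain ⟨ρ, hρ⟩ :=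
    PTCF.exists_isInfiniteVolumeCorrelation hα hC hreg hpoly hβ hz hB hstab hsmall
  refine ⟨ρ, hρ, fun m hm η hη => ?_⟩
  have hh : 0 < z * Real.exp (2 * β * B) := by positivity
  have hn₂ : 0 < C * PTCF.nuBarOne d α := mul_pos hC (PTCF.nuBarOne_pos hα)
  have hw : 0 < 1 - z * Real.exp (2 * β * B) * PTCF.nuOne d φ β * Real.exp 1 -
      z * Real.exp (2 * β * B) * (C * PTCF.nuBarOne d α) * (2 : ℝ) ^ (1 + α) := by
    have : 0 < z * Real.exp (2 * β * B) * (C * PTCF.nuBarOne d α) * Real.exp 1 := by positivity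
    nlinarith
  refine ⟨fun σ hσ => PTCF.constA_pos hC hh hn₂ hw (by omega) _
    (fun i => Multiset.card_pos.2 (hη i)) hσ, ?_⟩
  obtain ⟨n, rfl⟩ : ∃ n, m = n + 2 := ⟨m - 2, by omega⟩
  rw [← Finset.sum_mul]
  -- The PTCF is a polynomial in finitely many values of `ρ`, so a bound uniform over the ball
  -- cutoffs passes to the limit.
  have hlim := PTCF.tendsto_ptcf η (hρ (PTCF.ballCutoff d) PTCF.isCutoff_ballCutoff
    PTCF.tendsto_ballCutoff) Finset.univ
  refine le_of_tendsto hlim.abs (Eventually.of_forall fun N => ?_)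
  have hks := PTCF.isKSSolution_cutoffCorrelation hreg hβ hz hB hstab
    (PTCF.isCutoff_ballCutoff (d := d) N)
  obtain ⟨r, hr⟩ := PTCF.SetFun.exists_mul_eq_one
    (PTCF.clusterCorr η (PTCF.cutoffCorrelation φ β z (PTCF.ballCutoff d N)) 0)
    (by simpa [PTCF.clusterCorr_apply] using hks.zero)
  rw [← Finset.insert_erase (Finset.mem_univ (0 : Fin (n + 2))),
    PTCF.ptcf_eq_truncated _ η hks.zero hr (Finset.notMem_erase _ _)]
  exact hks.abs_truncated_le hα hC hreg hpoly hβ hz hstab rfl hsmall hr
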